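/- **Problem.** An instance of $O2|\mathrm{shortest\ path}|C_{\max}$ consists of a directed graph $G=(V,A)$ (parallel arcs allowed) with distinguished vertices $s,t$, such that there is at least one directed $s$–$t$ path, and, for each arc $a_j\in A$ with its job $J_j$, rational processing times $p_{1j},p_{2j}\ge 0$ on two machines. A solution is a directed $s$–$t$ path $P$ (no repeated vertex) together with a feasible non-preemptive two-machine open shop schedule of the job set $J_P=\{J_j: a_j\in P\}$: no machine processes two jobs at the same time, no job is processed on both machines at the same time, and the order of the two operations of a job is free. The aim is to minimize the makespan (the largest completion time); $\mathrm{OPT}$ denotes the minimum over all paths and schedules. **Subroutines.** *GS* is the algorithm of Gonzalez and Sahni for $O2||C_{\max}$. *ABV* is the min-max path algorithm of Aissi, Bazgan and Vanderpooten for two nonnegative weights $w^1,w^2$ per arc: a shortest path with respect to $w^1+w^2$ gives bounds $L$ (half its length) and $U$ (the larger of its two total weights); if $U=0$ this path is returned, otherwise the weights are multiplied by $|V|/(\varepsilon L)$ and rounded down, dynamic programming over pairs of total weights finds an $s$–$t$ walk minimizing the larger total scaled weight, and a path made of arcs of this walk is returned. **The GAR algorithm** (the framework UAR with $m=2$, the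 GS algorithm and $\rho=1$). Input: an instance and a rational $\varepsilon>0$. 1. Set $(w^1_j,w^2_j):=(p_{1j},p_{2j})$ for all $j$, $D:=\emptyset$, $M:=(1+\varepsilon)\sum_{j}(p_{1j}+p_{2j})+1$. Find an $s$–$t$ path $P$ by ABV (with accuracy $\varepsilon$ and the weights $w$), and schedule $J_P$ by GS; let $\sigma'$ be the schedule and $C'_{\max}$ its makespan. Set $(S,\sigma,C_{\max}):=(J_P,\sigma',C'_{\max})$. 2. While $J_P\cap D=\emptyset$ and some $J_j\in J_P$ satisfies $p_{1j}+p_{2j}\ge C'_{\max}$: for every job $J_j\notin D$ with $p_{1j}+p_{2j}\ge C'_{\max}$ set $(w^1_j,w^2_j):=(M,M)$ and add $J_j$ to $D$; find a new path $P$ by ABV with the current weights, schedule $J_P$ by GS, and let $\sigma'$ and $C'_{\max}$ be the new schedule and makespan; if $C'_{\max}<C_{\max}$, set $(S,\sigma,C_{\max}):=(J_P,\sigma',C'_{\max})$. 3. Return $S$, $\sigma$, $C_{\max}$. **Theorem.** The GAR algorithm is an FPTAS for $O2|\mathrm{shortest\ path}|C_{\max}$: there is a polynomial $q$ such that, for every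 instance (with at least one $s$–$t$ path) and every rational $\varepsilon>0$, the algorithm terminates after at most $q(N,1/\varepsilon)$ steps, where $N$ is the encoding length in bits of the input (the instance and $\varepsilon$) and arithmetic operations are charged by the bit length of their operands; it returns the job set $S$ of an $s$–$t$ path, a feasible open shop schedule $\sigma$ of $S$, and the makespan $C_{\max}$ of $\sigma$; and $C_{\max}\le(1+\varepsilon)\,\mathrm{OPT}$. -/

import Mathlib

/-!
# The problem `O2 | shortest path | C_max` and the GAR algorithm

Contents: (1) the optimization problem; (2) a small first-order programming language with a
cost semantics (bit cost for arithmetic); (3) the algorithms of Gonzalez-Sahni (GS),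
Aissi-Bazgan-Vanderpooten (ABV), the framework UAR and its instance GAR, as programs of this
language; (4) what it means to be an FPTAS for the problem.
-/

namespace OpenShopPath

/-! ## 1. The problem -/

/-- An instance: a directed multigraph (loops and parallel arcs allowed) with vertices `Fin numV`
and arcs `Fin numA`, two distinguished vertices `s`, `t`, and, for the job of the arc `j`, its
processing times `p 0 j`, `p 1 j` on the two machines. -/
structure Inst where
  numV : ℕ
  numA : ℕ
  tail : Fin numA → Fin numV
  head : Fin numA → Fin numV
  s : Fin numV
  t : Fin numV
  p : Fin 2 → Fin numA → ℚ
  p_nonneg : ∀ i j, 0 ≤ p i j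

namespace Inst

/-- `I.IsWalk u P v`: the list of arcs `P` is a directed walk from `u` to `v`. -/
def IsWalk (I : Inst) : Fin I.numV → List (Fin I.numA) → Fin I.numV → Prop
  | u, [], v => u = v
  | u, e :: P, v => I.tail e = u ∧ I.IsWalk (I.head e) P v

/-- A directed path from `s` to `t`: a directed walk that visits no vertex twice. -/
def IsPath (I : Inst) (P : List (Fin I.numA)) : Prop :=
  I.IsWalk I.s P I.t ∧ (I.s :: P.map I.head).Nodup

/-- `start i j` is the time at which the job `j` starts on machine `i`; it then occupies the
machine, without preemption, until `start i j + p i j`. The schedule of the jobs of `P` is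
feasible for the open shop if no machine works on two jobs at a time and no job is on both
machines at a time (the order of the two operations of a job is free). -/
structure IsSchedule (I : Inst) (P : List (Fin I.numA)) (start : Fin 2 → Fin I.numA → ℝ) :
    Prop where
  nonneg : ∀ i, ∀ j ∈ P, 0 ≤ start i j
  machine : ∀ i, ∀ j ∈ P, ∀ k ∈ P, j ≠ k →
    start i j + (I.p i j : ℝ) ≤ start i k ∨ start i k + (I.p i k : ℝ) ≤ start i j
  job : ∀ j ∈ P, start 0 j + (I.p 0 j : ℝ) ≤ start 1 j ∨ start 1 j + (I.p 1 j : ℝ) ≤ start 0 j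

/-- The makespan: the largest completion time of an operation (`0` if there is no job). -/
noncomputable def makespan (I : Inst) (P : List (Fin I.numA)) (start : Fin 2 → Fin I.numA → ℝ) :
    ℝ :=
  (P.map fun j => max (start 0 j + (I.p 0 j : ℝ)) (start 1 j + (I.p 1 j : ℝ))).foldr max 0

/-- The optimal value: the least makespan over all `s`-`t` paths and all feasible schedules of
their jobs (meaningful if there is an `s`-`t` path). -/
noncomputable def opt (I : Inst) : ℝ :=
  sInf {C | ∃ P start, I.IsPath P ∧ I.IsSchedule P start ∧ C = I.makespan P start}

end Inst

/-! ## 2. The programming language -/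

/-- Data types: rational numbers, truth values, pairs, lists. -/
inductive Ty where
  | num : Ty
  | bool : Ty
  | prod : Ty → Ty → Ty
  | list : Ty → Ty

/-- The values of a data type. -/
@[reducible] def Ty.den : Ty → Type
  | .num => ℚ
  | .bool => Bool
  | .prod a b => a.den × b.den
  | .list a => List a.den

/-- The four arithmetic operations. -/
inductive Op where
  | add : Op
  | sub : Op
  | mul : Op
  | div : Op

def Op.apply : Op → ℚ → ℚ → ℚ
  | .add, x, y => x + y
  | .sub, x, y => x - y
  | .mul, x, y => x * y
  | .div, x, y => x / y

/-- Expressions, with variables in `V` (parametric higher-order abstract syntax: a program is an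
expression given for every `V`, so it can act on data only through the constructors below).
`bind x f` is `let v := x; f v`. `fold l i f` runs through the list `l` from left to right,
updating an accumulator, which starts as `i`, by `f`. -/
inductive Tm (V : Ty → Type) : Ty → Type where
  | var {a : Ty} : V a → Tm V a
  | bind {a b : Ty} : Tm V a → (V a → Tm V b) → Tm V b
  | lit : ℚ → Tm V .num
  | arith : Op → Tm V .num → Tm V .num → Tm V .num
  | floor : Tm V .num → Tm V .num
  | le : Tm V .num → Tm V .num → Tm V .bool
  | tt : Tm V .bool
  | ff : Tm V .bool
  | cond {a : Ty} : Tm V .bool → Tm V a → Tm V a → Tm V a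
  | pair {a b : Ty} : Tm V a → Tm V b → Tm V (.prod a b)
  | fst {a b : Ty} : Tm V (.prod a b) → Tm V a
  | snd {a b : Ty} : Tm V (.prod a b) → Tm V b
  | nil {a : Ty} : Tm V (.list a)
  | cons {a : Ty} : Tm V a → Tm V (.list a) → Tm V (.list a)
  | fold {a b : Ty} : Tm V (.list a) → Tm V b → (V b → V a → Tm V b) → Tm V b

/-- The number of bits of a rational number in lowest terms (at least `1`). -/
def bits (q : ℚ) : ℕ := q.num.natAbs.size + q.den.size

/-- The encoding length of a value. -/
def size : (a : Ty) → a.den → ℕ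
  | .num, q => bits q
  | .bool, _ => 1
  | .prod a b, x => size a x.1 + size b x.2 + 1
  | .list a, l => (l.map fun x => size a x + 1).sum + 1

/-- The total cost of a fold: `step` updates the accumulator, `c` is the cost of one update, and
one more unit per list element is spent on the traversal. -/
def foldCost {α β : Type} (step : β → α → β) (c : β → α → ℕ) : β → List α → ℕ
  | _, [] => 0
  | b, x :: l => c b x + 1 + foldCost step c (step b x) l

namespace Tm

/-- The value of an expression. -/
def val : {a : Ty} → Tm Ty.den a → a.den
  | _, var x => x
  | _, bind x f => (f x.val).val
  | _, lit q => q
  | _, arith o x y => o.apply x.val y.val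
  | _, floor x => ((⌊x.val⌋ : ℤ) : ℚ)
  | _, le x y => decide (x.val ≤ y.val)
  | _, tt => true
  | _, ff => false
  | _, cond b x y => match b.val with
    | true => x.val
    | false => y.val
  | _, pair x y => (x.val, y.val)
  | _, fst x => x.val.1
  | _, snd x => x.val.2
  | _, nil => []
  | _, cons x l => x.val :: l.val
  | _, fold l i f => l.val.foldl (fun b x => (f b x).val) i.val

/-- The number of steps needed to evaluate an expression: every construct costs one step, and an
operation on numbers costs in addition the square of the number of bits of its arguments (the cost
of schoolbook arithmetic). Data are shared, not copied (lists and pairs are linked cells). -/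
def cost : {a : Ty} → Tm Ty.den a → ℕ
  | _, var _ => 1
  | _, bind x f => x.cost + (f x.val).cost + 1
  | _, lit q => bits q + 1
  | _, arith _ x y => x.cost + y.cost + (bits x.val + bits y.val) ^ 2 + 1
  | _, floor x => x.cost + bits x.val ^ 2 + 1
  | _, le x y => x.cost + y.cost + (bits x.val + bits y.val) ^ 2 + 1
  | _, tt => 1
  | _, ff => 1
  | _, cond b x y => b.cost + (match b.val with
    | true => x.cost
    | false => y.cost) + 1
  | _, pair x y => x.cost + y.cost + 1
  | _, fst x => x.cost + 1
  | _, snd x => x.cost + 1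
  | _, nil => 1
  | _, cons x l => x.cost + l.cost + 1
  | _, fold l i f =>
      l.cost + i.cost + foldCost (fun b x => (f b x).val) (fun b x => (f b x).cost) i.val l.val + 1

end Tm

/-- A program with one `while` loop: the state is initialized from the input; as long as the guard
holds, the body is executed; then the output is read off the state. -/
structure WhileProg (inp st out : Ty) where
  init : ∀ {V : Ty → Type}, V inp → Tm V st
  guard : ∀ {V : Ty → Type}, V st → Tm V .bool
  body : ∀ {V : Ty → Type}, V st → Tm V st
  output : ∀ {V : Ty → Type}, V st → Tm V out

namespace WhileProg

variable {inp st out : Ty}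

/-- `A.Loop x o c`: started in the state `x`, the loop terminates and the output is `o`, after `c`
steps in total. -/
inductive Loop (A : WhileProg inp st out) : st.den → out.den → ℕ → Prop
  | exit {x : st.den} : (A.guard (V := Ty.den) x).val = false →
      Loop A x (A.output (V := Ty.den) x).val
        ((A.guard (V := Ty.den) x).cost + (A.output (V := Ty.den) x).cost)
  | step {x : st.den} {o : out.den} {c : ℕ} : (A.guard (V := Ty.den) x).val = true →
      Loop A (A.body (V := Ty.den) x).val o c →
      Loop A x o ((A.guard (V := Ty.den) x).cost + (A.body (V := Ty.den) x).cost + c)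

/-- `A.Runs x o c`: on the input `x` the program terminates with the output `o` after `c` steps. -/
def Runs (A : WhileProg inp st out) (x : inp.den) (o : out.den) (c : ℕ) : Prop :=
  ∃ c', A.Loop (A.init (V := Ty.den) x).val o c' ∧ c = (A.init (V := Ty.den) x).cost + c'

end WhileProg

/-! ### Abbreviations -/

section Abbreviations

variable {V : Ty → Type} {a b : Ty}

instance : Add (Tm V .num) := ⟨.arith .add⟩
instance : Sub (Tm V .num) := ⟨.arith .sub⟩
instance : Mul (Tm V .num) := ⟨.arith .mul⟩
instance : Div (Tm V .num) := ⟨.arith .div⟩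

/-- `lets x fun v => y` is `let v := x; y`. -/
def lets (x : Tm V a) (f : Tm V a → Tm V b) : Tm V b := .bind x fun v => f (.var v)

/-- Fold over a list. -/
def loop (l : Tm V (.list a)) (i : Tm V b) (f : Tm V b → Tm V a → Tm V b) : Tm V b :=
  .fold l i fun v w => f (.var v) (.var w)

def not (x : Tm V .bool) : Tm V .bool := .cond x .ff .tt
def and (x y : Tm V .bool) : Tm V .bool := .cond x y .ff
def lt (x y : Tm V .num) : Tm V .bool := not (.le y x)
def eq (x y : Tm V .num) : Tm V .bool := and (.le x y) (.le y x)
def maxOf (x y : Tm V .num) : Tm V .num :=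
  lets x fun x => lets y fun y => .cond (.le x y) y x

/-- Does some element of the list satisfy `f`? -/
def any (l : Tm V (.list a)) (f : Tm V a → Tm V .bool) : Tm V .bool :=
  loop l .ff fun r x => .cond r .tt (f x)

def reverse (l : Tm V (.list a)) : Tm V (.list a) := loop l .nil fun r x => .cons x r

def map (l : Tm V (.list a)) (f : Tm V a → Tm V b) : Tm V (.list b) :=
  reverse (loop l .nil fun r x => .cons (f x) r)

def filter (l : Tm V (.list a)) (f : Tm V a → Tm V .bool) : Tm V (.list a) :=
  reverse (loop l .nil fun r x => .cond (f x) (.cons x r) r)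

def append (l l' : Tm V (.list a)) : Tm V (.list a) :=
  loop (reverse l) l' fun r x => .cons x r

/-- The sum of `f x` over the elements `x` of the list. -/
def sumOf (l : Tm V (.list a)) (f : Tm V a → Tm V .num) : Tm V .num :=
  loop l (.lit 0) fun r x => r + f x

end Abbreviations

/-! ## 3. The algorithms -/

/-- An arc together with its job: `(number, (tail, (head, (p₁, p₂))))`. -/
abbrev arcTy : Ty := .prod .num (.prod .num (.prod .num (.prod .num .num)))

/-- An arc with its current weights and a mark: `(arc, ((w₁, w₂), mark))`; the mark says whether
the job belongs to the set `D` of modified jobs. -/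
abbrev warcTy : Ty := .prod arcTy (.prod (.prod .num .num) .bool)

/-- A job with its starting times on the two machines: `(job, (start₁, start₂))`. -/
abbrev entryTy : Ty := .prod arcTy (.prod .num .num)

section Records

variable {V : Ty → Type}

def jobId (e : Tm V arcTy) : Tm V .num := e.fst
def jobTail (e : Tm V arcTy) : Tm V .num := e.snd.fst
def jobHead (e : Tm V arcTy) : Tm V .num := e.snd.snd.fst
def p₁ (e : Tm V arcTy) : Tm V .num := e.snd.snd.snd.fst
def p₂ (e : Tm V arcTy) : Tm V .num := e.snd.snd.snd.snd

def w₁ (e : Tm V warcTy) : Tm V .num := e.snd.fst.fst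
def w₂ (e : Tm V warcTy) : Tm V .num := e.snd.fst.snd
def marked (e : Tm V warcTy) : Tm V .bool := e.snd.snd
def mkWarc (e : Tm V arcTy) (x y : Tm V .num) (m : Tm V .bool) : Tm V warcTy :=
  .pair e (.pair (.pair x y) m)

def start₁ (x : Tm V entryTy) : Tm V .num := x.snd.fst
def start₂ (x : Tm V entryTy) : Tm V .num := x.snd.snd
def mkEntry (e : Tm V arcTy) (x y : Tm V .num) : Tm V entryTy := .pair e (.pair x y)

end Records

section GS

/-! ### The algorithm of Gonzalez and Sahni for `O2 || C_max`

Let `A` be the set of jobs with `p₁ ≥ p₂` and `B` the set of the other jobs. Let `r` be a job of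
`A` with the largest `p₁`, and `l` a job of `B` with the largest `p₂` (a dummy job, numbered `-1`
and with processing times `0`, if there is none), `A' = A ∖ {r}`, `B' = B ∖ {l}`, and let `T₁`,
`T₂` be the total processing times on the two machines. If `T₁ - p₁(l) ≥ T₂ - p₂(r)`, then the
first machine processes `l, B', A', r` and the second one `r, l, B', A'`; otherwise the second
machine processes `r, A', B', l` and the first one `l, r, A', B'`. -/

variable {V : Ty → Type}

def dummy : Tm V arcTy := .pair (.lit (-1)) (.pair (.lit 0) (.pair (.lit 0)
  (.pair (.lit 0) (.lit 0))))

/-- The lists `A'`, `B'` and the jobs `r`, `l`, as `((A', B'), (r, l))`; the lists may contain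
dummy jobs. -/
def gsSplit (J : Tm V (.list arcTy)) :
    Tm V (.prod (.prod (.list arcTy) (.list arcTy)) (.prod arcTy arcTy)) :=
  loop J (.pair (.pair .nil .nil) (.pair dummy dummy)) fun x j =>
    lets x.fst.fst fun A' => lets x.fst.snd fun B' =>
    lets x.snd.fst fun r => lets x.snd.snd fun l =>
    .cond (.le (p₂ j) (p₁ j))
      (.cond (.le (p₁ r) (p₁ j))
        (.pair (.pair (.cons r A') B') (.pair j l))
        (.pair (.pair (.cons j A') B') (.pair r l)))
      (.cond (.le (p₂ l) (p₂ j))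
        (.pair (.pair A' (.cons l B')) (.pair r j))
        (.pair (.pair A' (.cons j B')) (.pair r l)))

/-- Process the jobs of `J` on both machines in this order and without idle time, from time `x`
on the first machine and from time `y` on the second one. -/
def layout (J : Tm V (.list arcTy)) (x y : Tm V .num) : Tm V (.list entryTy) :=
  Tm.fst (loop J (.pair (.nil : Tm V (.list entryTy)) (.pair x y)) fun st j =>
    .pair (.cons (mkEntry j st.snd.fst st.snd.snd) st.fst)
      (.pair (st.snd.fst + p₁ j) (st.snd.snd + p₂ j)))

/-- The schedule and its makespan. -/
def gs (J : Tm V (.list arcTy)) : Tm V (.prod (.list entryTy) .num) :=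
  lets J fun J =>
  lets (gsSplit J) fun x =>
  lets x.fst.fst fun A' => lets x.fst.snd fun B' =>
  lets x.snd.fst fun r => lets x.snd.snd fun l =>
  lets (sumOf J p₁) fun T₁ => lets (sumOf J p₂) fun T₂ =>
  lets (.cond (.le (T₂ - p₂ r) (T₁ - p₁ l))
    (.cons (mkEntry r (maxOf (T₁ - p₁ r) (p₂ r)) (.lit 0))
      (layout (.cons l (append B' A')) (.lit 0) (maxOf (p₂ r) (T₁ - T₂ + p₂ r))))
    (.cons (mkEntry l (.lit 0) (maxOf (T₂ - p₂ l) (p₁ l)))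
      (layout (.cons r (append A' B')) (maxOf (p₁ l) (T₂ - T₁ + p₁ l)) (.lit 0)))) fun σ =>
  lets (filter σ fun x => .le (.lit 0) (jobId x.fst)) fun σ =>
  .pair σ (loop σ (.lit 0) fun C x =>
    maxOf C (maxOf (start₁ x + p₁ x.fst) (start₂ x + p₂ x.fst)))

end GS

section ABV

/-! ### The algorithm of Aissi, Bazgan and Vanderpooten for min-max paths (two weights)

A shortest path `P₀` with respect to `w₁ + w₂` gives bounds `L ≤ OPT ≤ U ≤ 2 L` for the min-max
problem. The weights are multiplied by `|V| / (ε L)` and rounded down, and the scaled problem is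
solved by dynamic programming over all pairs of weights of walks. -/

variable {V : Ty → Type}

/-- Bellman-Ford: for each vertex reached, a label `(vertex, (distance, reversed path))`, with
respect to the arc weights `w`, which are nonnegative. -/
def spLabels (vs : Tm V (.list .num)) (s : Tm V .num) (E : Tm V (.list warcTy))
    (w : Tm V warcTy → Tm V .num) : Tm V (.list (.prod .num (.prod .num (.list warcTy)))) :=
  loop vs (.cons (.pair s (.pair (.lit 0) .nil)) .nil) fun T _ =>
  loop E T fun T e =>
  loop T T fun T' x =>
    .cond (eq x.fst (jobTail e.fst))
      (lets (jobHead e.fst) fun y => lets (x.snd.fst + w e) fun d =>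
        .cond (any T' fun z => and (eq z.fst y) (.le z.snd.fst d))
          T'
          (.cons (.pair y (.pair d (.cons e x.snd.snd))) (filter T' fun z => not (eq z.fst y))))
      T'

/-- A shortest path from `s` to `t` with respect to `w₁ + w₂`, with the arcs of `E` (the empty list
if there is no path). -/
def shortestPath (vs : Tm V (.list .num)) (s t : Tm V .num) (E : Tm V (.list warcTy)) :
    Tm V (.list warcTy) :=
  reverse (loop (spLabels vs s E fun e => w₁ e + w₂ e) .nil fun P x =>
    .cond (eq x.fst t) x.snd.snd P)

/-- Dynamic programming: a label `(vertex, ((a₁, a₂), reversed walk))` for each vertex and each pair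
`(a₁, a₂)` with `a₁, a₂ ≤ B` of total scaled weights of a walk found from `s` to that vertex, where
the scaled weights are `⌊k * w₁⌋` and `⌊k * w₂⌋`. -/
def mmLabels (vs : Tm V (.list .num)) (s : Tm V .num) (E : Tm V (.list warcTy))
    (k B : Tm V .num) : Tm V (.list (.prod .num (.prod (.prod .num .num) (.list warcTy)))) :=
  loop vs (.cons (.pair s (.pair (.pair (.lit 0) (.lit 0)) .nil)) .nil) fun S _ =>
  loop E S fun S e =>
  lets (.floor (k * w₁ e)) fun c₁ => lets (.floor (k * w₂ e)) fun c₂ =>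
  loop S S fun S' x =>
    .cond (eq x.fst (jobTail e.fst))
      (lets (jobHead e.fst) fun y =>
        lets (x.snd.fst.fst + c₁) fun a₁ => lets (x.snd.fst.snd + c₂) fun a₂ =>
        .cond (and (and (.le a₁ B) (.le a₂ B))
            (not (any S' fun z =>
              and (eq z.fst y) (and (eq z.snd.fst.fst a₁) (eq z.snd.fst.snd a₂)))))
          (.cons (.pair y (.pair (.pair a₁ a₂) (.cons e x.snd.snd))) S')
          S')
      S'

/-- The ABV algorithm: a path from `s` to `t` whose larger total weight is at most `1 + ε` times
the least possible one. The walk found by dynamic programming is finally freed of its cycles, by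
computing a shortest path that uses only its arcs. -/
def abv (ε : Tm V .num) (vs : Tm V (.list .num)) (s t : Tm V .num) (E : Tm V (.list warcTy)) :
    Tm V (.list warcTy) :=
  lets E fun E =>
  lets (shortestPath vs s t E) fun P₀ =>
  lets (sumOf P₀ w₁) fun W₁ => lets (sumOf P₀ w₂) fun W₂ =>
  lets (maxOf W₁ W₂) fun U => lets ((W₁ + W₂) / .lit 2) fun L =>
  .cond (.le U (.lit 0))
    P₀
    (lets (sumOf vs (fun _ => .lit 1) / (ε * L)) fun k => lets (U * k) fun B =>
      lets (Tm.snd (loop (mmLabels vs s E k B) (.pair B (.nil : Tm V (.list warcTy))) fun r x =>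
        .cond (eq x.fst t)
          (lets (maxOf x.snd.fst.fst x.snd.fst.snd) fun m =>
            .cond (.le m r.fst) (.pair m x.snd.snd) r)
          r)) fun Q =>
      shortestPath vs s t Q)

end ABV

section UAR

/-! ### The framework UAR, for two machines, and the algorithm GAR -/

/-- Input: `(ε, (vertices, (arcs, (s, t))))`. -/
abbrev inputTy : Ty := .prod .num (.prod (.list .num) (.prod (.list arcTy) (.prod .num .num)))

/-- A solution: `(path, (schedule, makespan))`. -/
abbrev solTy : Ty := .prod (.list warcTy) (.prod (.list entryTy) .num)

/-- The state: `((input, M), (weighted arcs, (current solution, best solution)))`. -/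
abbrev stateTy : Ty := .prod (.prod inputTy .num) (.prod (.list warcTy) (.prod solTy solTy))

/-- Output: `(numbers of the arcs of the path, (list of (job number, (start₁, start₂)), makespan))`. -/
abbrev outputTy : Ty :=
  .prod (.list .num) (.prod (.list (.prod .num (.prod .num .num))) .num)

/-- An algorithm that schedules a given list of jobs and also returns the makespan. -/
abbrev ShopAlg : Type 1 :=
  ∀ {V : Ty → Type}, Tm V (.list arcTy) → Tm V (.prod (.list entryTy) .num)

variable {V : Ty → Type}

/-- Find a path by the ABV algorithm for the current weights and schedule its jobs. -/
def solve (alg : ShopAlg) (inp : Tm V inputTy) (E : Tm V (.list warcTy)) : Tm V solTy :=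
  lets inp fun inp =>
  lets inp.fst fun ε => lets inp.snd.fst fun vs =>
  lets inp.snd.snd.snd.fst fun s => lets inp.snd.snd.snd.snd fun t =>
  lets (abv ε vs s t E) fun P => .pair P (alg (map P fun e => e.fst))

/-- `UAR(alg, ρ, 2)` for the open shop. -/
def uar (alg : ShopAlg) (ρ : ℚ) : WhileProg inputTy stateTy outputTy where
  init := fun x =>
    lets (.var x) fun inp =>
    lets inp.snd.snd.fst fun J =>
    lets (map J fun e => mkWarc e (p₁ e) (p₂ e) .ff) fun E =>
    lets (solve alg inp E) fun cur =>
    lets ((.lit 1 + inp.fst) * sumOf J (fun e => p₁ e + p₂ e) + .lit 1) fun M =>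
    .pair (.pair inp M) (.pair E (.pair cur cur))
  guard := fun x =>
    lets (Tm.var x).snd.snd.fst fun cur =>
    lets (.lit ρ * cur.snd.snd) fun C =>
    and (not (any cur.fst fun e => marked e))
      (any cur.fst fun e => .le C (p₁ e.fst + p₂ e.fst))
  body := fun x =>
    lets (.var x) fun st =>
    lets st.fst.fst fun inp => lets st.fst.snd fun M =>
    lets st.snd.snd.snd fun best =>
    lets (.lit ρ * st.snd.snd.fst.snd.snd) fun C =>
    lets (map st.snd.fst fun e =>
      .cond (and (not (marked e)) (.le C (p₁ e.fst + p₂ e.fst))) (mkWarc e.fst M M .tt) e) fun E =>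
    lets (solve alg inp E) fun cur =>
    .pair (.pair inp M) (.pair E (.pair cur (.cond (lt cur.snd.snd best.snd.snd) cur best)))
  output := fun x =>
    lets (Tm.var x).snd.snd.snd fun best =>
    .pair (map best.fst fun e => jobId e.fst)
      (.pair (map best.snd.fst fun x => .pair (jobId x.fst) (.pair (start₁ x) (start₂ x)))
        best.snd.snd)

/-- The GAR algorithm: UAR with the algorithm of Gonzalez and Sahni and `ρ = 1`. -/
def gar : WhileProg inputTy stateTy outputTy := uar gs 1

end UAR

/-! ## 4. FPTAS -/

/-- The input that describes the instance `I` and the accuracy `ε`: vertices and arcs are numbered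
from `0`, and both are listed explicitly. -/
def encode (I : Inst) (ε : ℚ) : inputTy.den :=
  (ε,
    (List.finRange I.numV).map (fun (v : Fin I.numV) => ((v : ℕ) : ℚ)),
    (List.finRange I.numA).map (fun (j : Fin I.numA) =>
      (((j : ℕ) : ℚ), ((I.tail j : ℕ) : ℚ), ((I.head j : ℕ) : ℚ), I.p 0 j, I.p 1 j)),
    ((I.s : ℕ) : ℚ), ((I.t : ℕ) : ℚ))

/-- The output `o` describes the path `P`, the schedule `start` of the jobs of `P` (one entry for
each of them, in any order), and the makespan of this schedule. -/
def Describes (I : Inst) (o : outputTy.den) (P : List (Fin I.numA))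
    (start : Fin 2 → Fin I.numA → ℚ) : Prop :=
  o.1 = P.map (fun (j : Fin I.numA) => ((j : ℕ) : ℚ)) ∧
  o.2.1.Perm (P.map fun (j : Fin I.numA) => (((j : ℕ) : ℚ), start 0 j, start 1 j)) ∧
  (o.2.2 : ℝ) = I.makespan P (fun i j => (start i j : ℝ))

/-- `A` is a fully polynomial time approximation scheme for `O2 | shortest path | C_max`: for every
instance that has an `s`-`t` path and every `ε > 0`, it terminates after a number of steps bounded
by a fixed polynomial in the encoding length of the input and `1 / ε`, and returns an `s`-`t` path
and a feasible schedule of its jobs with makespan at most `(1 + ε) * OPT`. -/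
def IsFPTAS {st : Ty} (A : WhileProg inputTy st outputTy) : Prop :=
  ∃ c d : ℕ, ∀ (I : Inst) (ε : ℚ), (∃ P, I.IsPath P) → 0 < ε →
    ∃ (o : outputTy.den) (n : ℕ), A.Runs (encode I ε) o n ∧
      (n : ℚ) ≤ c * ((size inputTy (encode I ε) : ℚ) + 1 / ε) ^ d ∧
      ∃ (P : List (Fin I.numA)) (start : Fin 2 → Fin I.numA → ℚ),
        Describes I o P start ∧
        I.IsPath P ∧
        I.IsSchedule P (fun i j => (start i j : ℝ)) ∧
        I.makespan P (fun i j => (start i j : ℝ)) ≤ (1 + (ε : ℝ)) * I.opt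

end OpenShopPath

namespace OpenShopPath

/-! ### Values of the derived program constructs. -/

section Values

variable {a b : Ty}

/-! Approximation. For every path Q, a feasible schedule of its jobs lasts at least as long as the
load of each machine (`sum_le_makespan`) and as the length p₁ + p₂ of each single job of Q
(`job_le_makespan`). Against these lower bounds stand two guarantees: the makespan of the
Gonzalez–Sahni schedule is at most the larger machine load or at most the length of one of the jobs
(`gs_spec`), and ABV returns a path whose larger total weight is within 1 + ε of the minimum
(`abv_spec`).

Compare the output with an arbitrary path Q (`best_le`). If some job of Q has been marked, then at
that moment its length was at least the current makespan, hence at least the best one, and the best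
makespan never increases; so the output is bounded by the length of a job of Q. This is the field
`opt` of `Inv`. If no job of Q is marked, the final path P has weight at most 1 + ε times that of Q,
which is less than M, so P avoids all marked jobs and its weights are true processing times. The
false guard then says that no job of P is as long as the makespan, which excludes the second
alternative of `gs_spec`; the makespan is therefore at most the larger load of P, and this is at
most 1 + ε times the larger load of Q.

Min-max paths. With k = |V| / (εL), rounding down loses at most one unit per arc, so at most |V| on
a simple path; in the original scale this is εL, and L is a lower bound for the optimum. The dynamic
program keeps only scaled weights up to B = kU ≤ 2|V| / ε, which bounds the number of its labels by
a polynomial (`MGood.length_le`).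

Running time. Each pass through the loop marks a new job (`unmarked_lt`), so there are at most as
many passes as arcs. The lists are bounded by the same invariants that prove correctness (`Good`,
`MGood`). The numbers need care, since bit costs are charged: all weights, M included, are multiples
of one fraction 1 / D, so sums and differences of polynomially many of them have a number of bits
linear in the input length (`Rep.bits_le`); products, quotients and roundings occur only to a
bounded depth; and the labels of the dynamic program are natural numbers at most B, hence no longer
than B. The predicate `Cst` separates the two concerns: one proves that all numbers have at most K
bits, and then counts operations. `exists_instBound` supplies explicit bounds for all parameters,
and `isFPTAS_gar` multiplies them. -/

@[simp] theorem val_var (x : a.den) : (Tm.var x : Tm Ty.den a).val = x := (rfl)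
@[simp] theorem val_lit (q : ℚ) : (Tm.lit q : Tm Ty.den .num).val = q := (rfl)
@[simp] theorem val_tt : (Tm.tt : Tm Ty.den .bool).val = true := (rfl)
@[simp] theorem val_ff : (Tm.ff : Tm Ty.den .bool).val = false := (rfl)
@[simp] theorem val_nil : (Tm.nil : Tm Ty.den (.list a)).val = [] := (rfl)
@[simp] theorem val_cons (x : Tm Ty.den a) (l : Tm Ty.den (.list a)) :
    (Tm.cons x l).val = x.val :: l.val := (rfl)
@[simp] theorem val_pair (x : Tm Ty.den a) (y : Tm Ty.den b) :
    (Tm.pair x y).val = (x.val, y.val) := (rfl)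
@[simp] theorem val_fst (x : Tm Ty.den (.prod a b)) : x.fst.val = x.val.1 := (rfl)
@[simp] theorem val_snd (x : Tm Ty.den (.prod a b)) : x.snd.val = x.val.2 := (rfl)
@[simp] theorem val_add (x y : Tm Ty.den .num) :
    (x + y).val = HAdd.hAdd (α := ℚ) (β := ℚ) (γ := ℚ) x.val y.val := (rfl)
@[simp] theorem val_sub (x y : Tm Ty.den .num) :
    (x - y).val = HSub.hSub (α := ℚ) (β := ℚ) (γ := ℚ) x.val y.val := (rfl)
@[simp] theorem val_mul (x y : Tm Ty.den .num) :
    (x * y).val = HMul.hMul (α := ℚ) (β := ℚ) (γ := ℚ) x.val y.val := (rfl)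
@[simp] theorem val_div (x y : Tm Ty.den .num) :
    (x / y).val = HDiv.hDiv (α := ℚ) (β := ℚ) (γ := ℚ) x.val y.val := (rfl)
@[simp] theorem val_le (x y : Tm Ty.den .num) :
    (Tm.le x y).val = decide (LE.le (α := ℚ) x.val y.val) := (rfl)

@[simp] theorem val_cond (c : Tm Ty.den .bool) (x y : Tm Ty.den a) :
    (Tm.cond c x y).val = if @Eq Bool c.val true then x.val else y.val := by
  simp only [Tm.val]
  cases c.val <;> rfl

@[simp] theorem val_lets (x : Tm Ty.den a) (f : Tm Ty.den a → Tm Ty.den b) :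
    (lets x f).val = (f (.var x.val)).val := (rfl)

theorem val_loop (l : Tm Ty.den (.list a)) (i : Tm Ty.den b)
    (f : Tm Ty.den b → Tm Ty.den a → Tm Ty.den b) :
    (loop l i f).val = l.val.foldl (fun b x => (f (.var b) (.var x)).val) i.val := (rfl)

@[simp] theorem val_not (x : Tm Ty.den .bool) : (not x).val = !x.val := by
  cases h : x.val <;> simp [not, h]

@[simp] theorem val_and (x y : Tm Ty.den .bool) : (and x y).val = (x.val && y.val) := by
  cases h : x.val <;> simp [and, h]

@[simp] theorem val_lt (x y : Tm Ty.den .num) :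
    (lt x y).val = decide (LT.lt (α := ℚ) x.val y.val) := by
  rw [Bool.eq_iff_iff]; simp [lt]

@[simp] theorem val_eq (x y : Tm Ty.den .num) : (eq x y).val = decide (@Eq ℚ x.val y.val) := by
  rw [Bool.eq_iff_iff]; simp [eq, le_antisymm_iff]

@[simp] theorem val_maxOf (x y : Tm Ty.den .num) : (maxOf x y).val = max (α := ℚ) x.val y.val := by
  by_cases h : x.val ≤ y.val <;> simp [maxOf, max_def, h]

@[simp] theorem val_any (l : Tm Ty.den (.list a)) (f : Tm Ty.den a → Tm Ty.den .bool) :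
    (any l f).val = l.val.any fun x => (f (.var x)).val := by
  have H : ∀ (l : List a.den) (r : Bool),
      l.foldl (fun r x => if r = true then true else (f (.var x)).val) r
        = (r || l.any fun x => (f (.var x)).val) := by
    intro l
    induction l with
    | nil => simp
    | cons x l ih => intro r; rw [List.foldl_cons, ih]; cases r <;> simp
  simp only [any, val_loop, val_cond, val_var, val_tt, val_ff]
  exact H l.val false

@[simp] theorem val_reverse (l : Tm Ty.den (.list a)) : (reverse l).val = l.val.reverse := by
  simp [reverse, val_loop]

@[simp] theorem val_map (l : Tm Ty.den (.list a)) (f : Tm Ty.den a → Tm Ty.den b) :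
    (map l f).val = l.val.map fun x => (f (.var x)).val := by
  have H : ∀ (l : List a.den) (r : List b.den),
      l.foldl (fun r x => (f (.var x)).val :: r) r
        = (l.map fun x => (f (.var x)).val).reverse ++ r := by
    intro l
    induction l with
    | nil => simp
    | cons x l ih => intro r; rw [List.foldl_cons, ih]; simp
  simp [map, val_loop, H]

@[simp] theorem val_filter (l : Tm Ty.den (.list a)) (f : Tm Ty.den a → Tm Ty.den .bool) :
    (filter l f).val = l.val.filter fun x => (f (.var x)).val := by
  have H : ∀ (l : List a.den) (r : List a.den),
      l.foldl (fun r x => if @Eq Bool (f (.var x)).val true then x :: r else r) r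
        = (l.filter fun x => (f (.var x)).val).reverse ++ r := by
    intro l
    induction l with
    | nil => simp
    | cons x l ih =>
      intro r; rw [List.foldl_cons, ih]
      by_cases h : (f (.var x)).val = true <;> simp [h]
  simp [filter, val_loop, H]

@[simp] theorem val_append (l l' : Tm Ty.den (.list a)) :
    (append l l').val = l.val ++ l'.val := by
  simp [append, val_loop]

@[simp] theorem val_sumOf (l : Tm Ty.den (.list a)) (f : Tm Ty.den a → Tm Ty.den .num) :
    (sumOf l f).val = (l.val.map fun x => (f (.var x)).val).sum := by
  have H : ∀ (l : List a.den) (r : ℚ),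
      l.foldl (fun r x => r + (f (.var x)).val) r
        = r + (l.map fun x => (f (.var x)).val).sum := by
    intro l
    induction l with
    | nil => simp
    | cons x l ih => intro r; rw [List.foldl_cons, ih]; simp [add_assoc]
  simp [sumOf, val_loop, H]

end Values

/-! ### Bounds on the number of steps -/

/-- The evaluation of `x` takes at most `n` steps, if an operation on numbers of at most `K` bits
is charged `4 * K ^ 2 + 1`. -/
def Cst (K n : ℕ) {a : Ty} (x : Tm Ty.den a) : Prop := x.cost ≤ n * (4 * K ^ 2 + 1)

namespace Cst

variable {K : ℕ} {a b : Ty} {m n k : ℕ}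

theorem mono {x : Tm Ty.den a} (h : Cst K m x) (hn : m ≤ n) : Cst K n x :=
  le_trans h (Nat.mul_le_mul_right _ hn)

theorem var {x : a.den} : Cst K 1 (Tm.var x : Tm Ty.den a) := by
  simp only [Cst, Tm.cost]; nlinarith

theorem tt : Cst K 1 (Tm.tt : Tm Ty.den .bool) := by
  simp only [Cst, Tm.cost]; nlinarith

theorem ff : Cst K 1 (Tm.ff : Tm Ty.den .bool) := by
  simp only [Cst, Tm.cost]; nlinarith

theorem nil : Cst K 1 (Tm.nil : Tm Ty.den (.list a)) := by
  simp only [Cst, Tm.cost]; nlinarith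

theorem lit {q : ℚ} (h : bits q ≤ K) : Cst K 1 (Tm.lit q : Tm Ty.den .num) := by
  simp only [Cst, Tm.cost]; nlinarith [Nat.le_self_pow two_ne_zero K]

theorem fst {x : Tm Ty.den (.prod a b)} (h : Cst K n x) : Cst K (n + 1) x.fst := by
  simp only [Cst, Tm.cost] at *; nlinarith

theorem snd {x : Tm Ty.den (.prod a b)} (h : Cst K n x) : Cst K (n + 1) x.snd := by
  simp only [Cst, Tm.cost] at *; nlinarith

theorem pair {x : Tm Ty.den a} {y : Tm Ty.den b} (hx : Cst K m x) (hy : Cst K n y) :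
    Cst K (m + n + 1) (Tm.pair x y) := by
  simp only [Cst, Tm.cost] at *; nlinarith

theorem cons {x : Tm Ty.den a} {y : Tm Ty.den (.list a)} (hx : Cst K m x) (hy : Cst K n y) :
    Cst K (m + n + 1) (Tm.cons x y) := by
  simp only [Cst, Tm.cost] at *; nlinarith

theorem lets {x : Tm Ty.den a} {f : Tm Ty.den a → Tm Ty.den b} (hx : Cst K m x)
    (hf : Cst K n (f (.var x.val))) : Cst K (m + n + 1) (OpenShopPath.lets x f) := by
  have : (OpenShopPath.lets x f).cost = x.cost + (f (.var x.val)).cost + 1 := (rfl)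
  simp only [Cst] at *; nlinarith

/-- Each branch is analysed under the outcome of the test, so that facts checked by the program are
available. The two branch bounds are added instead of maximized, which keeps all bounds linear. -/
theorem cond {c : Tm Ty.den .bool} {x y : Tm Ty.den a} (hc : Cst K k c)
    (hx : c.val = true → Cst K m x) (hy : c.val = false → Cst K n y) :
    Cst K (k + (m + n) + 1) (Tm.cond c x y) := by
  simp only [Cst, Tm.cost] at *
  cases h : c.val
  · have := hy h
    simp only; nlinarith
  · have := hx h
    simp only; nlinarith

theorem sq_le {x y : ℕ} (hx : x ≤ K) (hy : y ≤ K) : (x + y) ^ 2 ≤ 4 * K ^ 2 := by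
  nlinarith [Nat.pow_le_pow_left (Nat.add_le_add hx hy) 2]

theorem arith {o : Op} {x y : Tm Ty.den .num} (hx : Cst K m x) (hy : Cst K n y)
    (bx : bits x.val ≤ K) (ky : bits y.val ≤ K) : Cst K (m + n + 1) (Tm.arith o x y) := by
  simp only [Cst, Tm.cost] at *
  nlinarith [sq_le bx ky]

theorem add {x y : Tm Ty.den .num} (hx : Cst K m x) (hy : Cst K n y)
    (bx : bits x.val ≤ K) (ky : bits y.val ≤ K) : Cst K (m + n + 1) (x + y) := arith hx hy bx ky

theorem sub {x y : Tm Ty.den .num} (hx : Cst K m x) (hy : Cst K n y)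
    (bx : bits x.val ≤ K) (ky : bits y.val ≤ K) : Cst K (m + n + 1) (x - y) := arith hx hy bx ky

theorem mul {x y : Tm Ty.den .num} (hx : Cst K m x) (hy : Cst K n y)
    (bx : bits x.val ≤ K) (ky : bits y.val ≤ K) : Cst K (m + n + 1) (x * y) := arith hx hy bx ky

theorem div {x y : Tm Ty.den .num} (hx : Cst K m x) (hy : Cst K n y)
    (bx : bits x.val ≤ K) (ky : bits y.val ≤ K) : Cst K (m + n + 1) (x / y) := arith hx hy bx ky

theorem le {x y : Tm Ty.den .num} (hx : Cst K m x) (hy : Cst K n y)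
    (bx : bits x.val ≤ K) (ky : bits y.val ≤ K) : Cst K (m + n + 1) (Tm.le x y) := by
  simp only [Cst, Tm.cost] at *
  nlinarith [sq_le bx ky]

theorem floor {x : Tm Ty.den .num} (hx : Cst K m x) (bx : bits x.val ≤ K) :
    Cst K (m + 1) (Tm.floor x) := by
  simp only [Cst, Tm.cost] at *
  nlinarith [Nat.pow_le_pow_left bx 2]

theorem not {x : Tm Ty.den .bool} (hx : Cst K m x) : Cst K (m + 3) (OpenShopPath.not x) :=
  (cond hx (fun _ => ff) fun _ => tt).mono (by omega)

theorem and {x y : Tm Ty.den .bool} (hx : Cst K m x) (hy : x.val = true → Cst K n y) :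
    Cst K (m + n + 2) (OpenShopPath.and x y) :=
  (cond hx hy fun _ => ff).mono (by omega)

theorem eq {x y : Tm Ty.den .num} (hx : Cst K m x) (hy : Cst K n y)
    (bx : bits x.val ≤ K) (ky : bits y.val ≤ K) :
    Cst K (2 * m + 2 * n + 4) (OpenShopPath.eq x y) :=
  (and (le hx hy bx ky) fun _ => le hy hx ky bx).mono (by omega)

theorem lt {x y : Tm Ty.den .num} (hx : Cst K m x) (hy : Cst K n y)
    (bx : bits x.val ≤ K) (ky : bits y.val ≤ K) :
    Cst K (m + n + 4) (OpenShopPath.lt x y) :=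
  (not (le hy hx ky bx)).mono (by omega)

theorem maxOf {x y : Tm Ty.den .num} (hx : Cst K m x) (hy : Cst K n y)
    (bx : bits x.val ≤ K) (ky : bits y.val ≤ K) :
    Cst K (m + n + 8) (OpenShopPath.maxOf x y) :=
  (lets hx (lets (f := fun y => .cond (.le (.var x.val) y) y (.var x.val)) hy
    (cond (le (x := .var x.val) (y := .var y.val) var var bx ky)
      (fun _ => var) fun _ => var))).mono (by omega)

/-- Invariant and cost are proved together, because a step is cheap only for accumulators that
satisfy the invariant. -/
theorem foldCost_le {α β : Type} {step : β → α → β} {c : β → α → ℕ} (Inv : β → Prop) {M : ℕ} :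
    ∀ {l : List α} {b : β}, Inv b →
      (∀ b, Inv b → ∀ x ∈ l, Inv (step b x) ∧ c b x ≤ M) →
      Inv (l.foldl step b) ∧ foldCost step c b l ≤ l.length * (M + 1)
  | [], b, h0, _ => by simp [foldCost, h0]
  | x :: l, b, h0, h => by
    obtain ⟨h1, h2⟩ := h b h0 x (by simp)
    obtain ⟨h3, h4⟩ := foldCost_le Inv (l := l) h1 fun b hb y hy => h b hb y (by simp [hy])
    refine ⟨h3, ?_⟩
    simp only [foldCost, List.length_cons]
    nlinarith

/-- A loop with an invariant. -/
theorem loop {l : Tm Ty.den (.list a)} {i : Tm Ty.den b}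
    {f : Tm Ty.den b → Tm Ty.den a → Tm Ty.den b} (Inv : b.den → Prop)
    (hl : Cst K m l) (hi : Cst K n i) (h0 : Inv i.val)
    (h : ∀ v, Inv v → ∀ x ∈ l.val, Inv (f (.var v) (.var x)).val ∧
      Cst K k (f (.var v) (.var x))) :
    Cst K (m + n + l.val.length * (k + 1) + 1) (OpenShopPath.loop l i f) := by
  have := (foldCost_le Inv (M := k * (4 * K ^ 2 + 1))
    (step := fun b x => (f (.var b) (.var x)).val) (c := fun b x => (f (.var b) (.var x)).cost)
    h0 h).2
  simp only [Cst, OpenShopPath.loop, Tm.cost] at *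
  refine (Nat.add_le_add_right (Nat.add_le_add (Nat.add_le_add hl hi) this) 1).trans ?_
  have : l.val.length * (k * (4 * K ^ 2 + 1) + 1)
      ≤ l.val.length * ((k + 1) * (4 * K ^ 2 + 1)) := by
    apply Nat.mul_le_mul_left; nlinarith
  nlinarith

theorem any {l : Tm Ty.den (.list a)} {f : Tm Ty.den a → Tm Ty.den .bool}
    (hl : Cst K m l) (h : ∀ x ∈ l.val, Cst K k (f (.var x))) :
    Cst K (m + l.val.length * (k + 4) + 2) (OpenShopPath.any l f) :=
  (loop (fun _ => True) hl ff trivial fun _ _ x hx =>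
    ⟨trivial, (cond var (fun _ => tt) fun _ => h x hx)⟩).mono (by grind)

/-- A property of the accumulator alone cannot say how many terms have been added so far. Indexing
the steps by the prefix already processed can, and this is what bounds running sums. -/
theorem foldCost_le_of_prefix {α β : Type} {step : β → α → β} {c : β → α → ℕ} {M : ℕ} :
    ∀ {l : List α} {b : β}, (∀ l₁ x, l₁ ++ [x] <+: l → c (l₁.foldl step b) x ≤ M) →
      foldCost step c b l ≤ l.length * (M + 1)
  | [], b, _ => by simp [foldCost]
  | x :: l, b, h => by
    have h1 : c b x ≤ M := h [] x (by simp)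
    have h2 := foldCost_le_of_prefix (l := l) (b := step b x) (c := c) (M := M) fun l₁ y hy =>
      h (x :: l₁) y (by simpa using hy)
    simp only [foldCost, List.length_cons]
    nlinarith

theorem sumOf {l : Tm Ty.den (.list a)} {f : Tm Ty.den a → Tm Ty.den .num}
    (hl : Cst K m l) (h : ∀ x ∈ l.val, Cst K k (f (.var x)))
    (bf : ∀ x ∈ l.val, bits (f (.var x)).val ≤ K)
    (bs : ∀ l', l' <+: l.val → bits (l'.map fun x => (f (.var x)).val).sum ≤ K) :
    Cst K (m + l.val.length * (k + 3) + 2) (OpenShopPath.sumOf l f) := by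
  -- The empty prefix has sum `0`, so `bs` also covers the initial literal.
  have h0 : Cst K 1 (Tm.lit 0 : Tm Ty.den .num) := lit (bs [] (by simp))
  have hs : ∀ l' : List a.den, l'.foldl (fun r x => r + (f (.var x)).val) 0
      = (l'.map fun x => (f (.var x)).val).sum := fun l' => by
    have := val_sumOf (.var l') f
    rwa [OpenShopPath.sumOf, val_loop] at this
  have := foldCost_le_of_prefix (l := l.val) (b := (0 : ℚ)) (M := (k + 2) * (4 * K ^ 2 + 1))
    (step := fun r x => r + (f (.var x)).val)
    (c := fun r x => ((Tm.var r : Tm Ty.den .num) + f (.var x)).cost) (fun l₁ x hx => by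
      have hx' : x ∈ l.val := hx.subset (by simp)
      refine (add var (h x hx') ?_ (bf x hx')).mono (show _ ≤ k + 2 by omega)
      rw [val_var, hs]
      exact bs l₁ ((List.prefix_append _ _).trans hx))
  have e : (OpenShopPath.sumOf l f).cost = l.cost + (Tm.lit 0 : Tm Ty.den .num).cost
    + foldCost (fun r x => r + (f (.var x)).val)
      (fun r x => ((Tm.var r : Tm Ty.den .num) + f (.var x)).cost) 0 l.val + 1 := (rfl)
  simp only [Cst] at *
  rw [e]
  have : l.val.length * ((k + 2) * (4 * K ^ 2 + 1) + 1)
      ≤ l.val.length * ((k + 3) * (4 * K ^ 2 + 1)) := by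
    apply Nat.mul_le_mul_left; nlinarith
  nlinarith

theorem reverse {l : Tm Ty.den (.list a)} (hl : Cst K m l) :
    Cst K (m + l.val.length * 4 + 2) (OpenShopPath.reverse l) :=
  (loop (fun _ => True) hl nil trivial fun _ _ x hx => ⟨trivial, cons var var⟩).mono (by grind)

theorem map {l : Tm Ty.den (.list a)} {f : Tm Ty.den a → Tm Ty.den b}
    (hl : Cst K m l) (h : ∀ x ∈ l.val, Cst K k (f (.var x))) :
    Cst K (m + l.val.length * (k + 7) + 4) (OpenShopPath.map l f) := by
  refine (reverse (loop (fun _ => True) hl nil trivial fun _ _ x hx =>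
    ⟨trivial, cons (h x hx) var⟩)).mono ?_
  have : (OpenShopPath.loop l .nil fun r x => .cons (f x) r).val.length = l.val.length := by
    have := congrArg List.length (val_map l f)
    simpa [OpenShopPath.map] using this
  rw [this]; nlinarith

theorem filter {l : Tm Ty.den (.list a)} {f : Tm Ty.den a → Tm Ty.den .bool}
    (hl : Cst K m l) (h : ∀ x ∈ l.val, Cst K k (f (.var x))) :
    Cst K (m + l.val.length * (k + 10) + 4) (OpenShopPath.filter l f) := by
  refine (reverse (loop (fun _ => True) hl nil trivial fun _ _ x hx =>
    ⟨trivial, cond (h x hx) (fun _ => cons var var) fun _ => var⟩)).mono ?_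
  have : (OpenShopPath.loop l .nil fun r x => .cond (f x) (.cons x r) r).val.length
      ≤ l.val.length := by
    have := congrArg List.length (val_filter l f)
    simp only [OpenShopPath.filter, val_reverse, List.length_reverse] at this
    rw [this]; exact List.length_filter_le _ _
  nlinarith

theorem append {l l' : Tm Ty.den (.list a)} (hl : Cst K m l) (hl' : Cst K n l') :
    Cst K (m + n + l.val.length * 8 + 3) (OpenShopPath.append l l') := by
  refine (loop (fun _ => True) (reverse hl) hl' trivial fun _ _ x hx =>
    ⟨trivial, cons var var⟩).mono ?_
  simp only [val_reverse, List.length_reverse]; omega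

end Cst

/-! ### Walks and labels -/

section Walks

variable {α : Type} {tl hd : α → ℚ} {s : ℚ}

/-- `RWalk tl hd s P v`: the arcs of `P`, in reversed order, form a walk from `s` to `v`, where
`tl` and `hd` are the tails and heads of the arcs. -/
def RWalk (tl hd : α → ℚ) (s : ℚ) : List α → ℚ → Prop
  | [], v => v = s
  | e :: P, v => hd e = v ∧ RWalk tl hd s P (tl e)

theorem RWalk.end_mem : ∀ {P : List α} {v : ℚ}, RWalk tl hd s P v → v ∈ s :: P.map hd
  | [], _, h => by simpa [RWalk] using h
  | e :: P, v, h => by simp [h.1]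

/-- Walks are stored with the last arc first, so a suffix of the list is an initial part of the
walk: stop at a visit of `y`. -/
theorem RWalk.exists_suffix : ∀ {P : List α} {v y : ℚ}, RWalk tl hd s P v → y ∈ s :: P.map hd →
    ∃ q, q <:+ P ∧ RWalk tl hd s q y
  | [], _, y, _, hy => ⟨[], by simp, by simpa [RWalk] using hy⟩
  | e :: P, v, y, h, hy => by
    by_cases hye : y = hd e
    · exact ⟨e :: P, List.suffix_rfl, hye.symm, h.2⟩
    · obtain ⟨q, hq, hq'⟩ := RWalk.exists_suffix (y := y) h.2 (by simpa [hye] using hy)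
      exact ⟨q, hq.trans (List.suffix_cons _ _), hq'⟩

theorem nodup_of_suffix {P q : List α} (h : q <:+ P) (hP : (s :: P.map hd).Nodup) :
    (s :: q.map hd).Nodup :=
  hP.sublist ((h.sublist.map hd).cons_cons s)

/-- Make the walk simple up to its last arc. If the end vertex has already been visited, cut there;
otherwise append the arc. -/
theorem RWalk.exists_simple : ∀ {P : List α} {v : ℚ}, RWalk tl hd s P v →
    ∃ q, q ⊆ P ∧ RWalk tl hd s q v ∧ (s :: q.map hd).Nodup
  | [], v, h => ⟨[], by simp, h, by simp⟩
  | e :: P, v, h => by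
    obtain ⟨q, h1, h2, h3⟩ := RWalk.exists_simple h.2
    by_cases hv : v ∈ s :: q.map hd
    · obtain ⟨r, hr, hr'⟩ := h2.exists_suffix hv
      exact ⟨r, fun a ha => List.mem_cons_of_mem _ (h1 (hr.subset ha)), hr', nodup_of_suffix hr h3⟩
    · refine ⟨e :: q, List.cons_subset_cons _ h1, ⟨h.1, h2⟩, ?_⟩
      have := List.nodup_cons.2 ⟨hv, h3⟩
      rw [List.map_cons, h.1]
      exact this.perm (List.Perm.swap _ _ _)

theorem length_lt_of_simple {P : List α} {vs : List ℚ} (hP : (s :: P.map hd).Nodup)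
    (h : s :: P.map hd ⊆ vs) : P.length + 1 ≤ vs.length := by
  simpa using (hP.subperm h).length_le

/-- Since the entries of `P` are distinct, inclusion as sets already gives inclusion as multisets.
-/
theorem sum_map_le_of_subset {P Q : List α} {w : α → ℚ} (hP : P.Nodup) (hPQ : P ⊆ Q)
    (hw : ∀ e ∈ Q, 0 ≤ w e) : (P.map w).sum ≤ (Q.map w).sum := by
  obtain ⟨P', hP', hs⟩ := hP.subperm hPQ
  rw [← (hP'.map w).sum_eq]
  refine (hs.map w).sum_le_sum ?_
  simpa using hw

theorem sum_map_nonneg {P : List α} {w : α → ℚ} (hw : ∀ e ∈ P, 0 ≤ w e) : 0 ≤ (P.map w).sum :=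
  List.sum_nonneg (by simpa using hw)

end Walks

/-! ### Shortest paths -/

section Shortest

variable {α : Type} (tl hd : α → ℚ) (s : ℚ) (w : α → ℚ)

/-- Extend the label `x` by the arc `e`. -/
def relax (e : α) (T : List (ℚ × ℚ × List α)) (x : ℚ × ℚ × List α) : List (ℚ × ℚ × List α) :=
  if x.1 = tl e then
    if ∃ z ∈ T, z.1 = hd e ∧ z.2.1 ≤ x.2.1 + w e then T
    else (hd e, x.2.1 + w e, e :: x.2.2) :: T.filter fun z => !decide (z.1 = hd e)
  else T

/-- Extend all labels by the arc `e`. -/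
def relaxArc (T : List (ℚ × ℚ × List α)) (e : α) : List (ℚ × ℚ × List α) :=
  T.foldl (relax tl hd w e) T

/-- A round of the algorithm of Bellman and Ford. -/
def relaxAll (E : List α) (T : List (ℚ × ℚ × List α)) : List (ℚ × ℚ × List α) :=
  E.foldl (relaxArc tl hd w) T

/-- The vertex `v` has a label of distance at most `d`. -/
def Cov (T : List (ℚ × ℚ × List α)) (v d : ℚ) : Prop := ∃ z ∈ T, z.1 = v ∧ z.2.1 ≤ d

/-- The field `cov` is what keeps the stored walks simple, even when arcs have weight zero: each
vertex on the stored walk has a label in the table that is no worse than the part of the walk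
leading there. -/
structure GoodLabel (E : List α) (T : List (ℚ × ℚ × List α)) (x : ℚ × ℚ × List α) : Prop where
  walk : RWalk tl hd s x.2.2 x.1
  sub : x.2.2 ⊆ E
  sum : (x.2.2.map w).sum = x.2.1
  simple : (s :: x.2.2.map hd).Nodup
  cov : ∀ q v, q <:+ x.2.2 → RWalk tl hd s q v → Cov T v (q.map w).sum

/-- Having one label per vertex bounds the length of the table by the number of vertices and makes
the label of `t` unique. -/
structure Good (E : List α) (T : List (ℚ × ℚ × List α)) : Prop where
  label : ∀ x ∈ T, GoodLabel tl hd s w E T x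
  nodup : (T.map Prod.fst).Nodup

variable {tl hd s w} {E : List α} {T T' : List (ℚ × ℚ × List α)} {x : ℚ × ℚ × List α} {e : α}

/-- A pass iterates over a snapshot of the labels while the table changes. A label of the snapshot
may have been replaced meanwhile, but it stays good as long as the coverage of the table only
improves. -/
theorem GoodLabel.mono (h : GoodLabel tl hd s w E T x) (hc : ∀ v d, Cov T v d → Cov T' v d) :
    GoodLabel tl hd s w E T' x :=
  ⟨h.walk, h.sub, h.sum, h.simple, fun q v h1 h2 => hc _ _ (h.cov q v h1 h2)⟩

theorem cov_relax {v d : ℚ} (h : Cov T v d) : Cov (relax tl hd w e T x) v d := by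
  unfold relax
  split_ifs with h1 h2
  · exact h
  · obtain ⟨z, hz, rfl, hd'⟩ := h
    by_cases hv : z.1 = hd e
    · refine ⟨_, List.mem_cons_self, hv.symm, ?_⟩
      push Not at h2
      exact (h2 z hz hv).le.trans hd'
    · exact ⟨z, List.mem_cons_of_mem _ (by simp [hz, hv]), rfl, hd'⟩
  · exact h

theorem cov_relax_new (h : x.1 = tl e) : Cov (relax tl hd w e T x) (hd e) (x.2.1 + w e) := by
  unfold relax
  split_ifs with h2
  · exact h2
  · exact ⟨_, List.mem_cons_self, rfl, le_rfl⟩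

/-- The essential point is that a new label cannot close a cycle: the vertex would then already have
a label that is at least as good, and the table would not have been changed. -/
theorem Good.relax (hw : ∀ e ∈ E, 0 ≤ w e) (hT : Good tl hd s w E T) (he : e ∈ E)
    (hx : GoodLabel tl hd s w E T x) : Good tl hd s w E (relax tl hd w e T x) := by
  have hc : ∀ v d, Cov T v d → Cov (OpenShopPath.relax tl hd w e T x) v d :=
    fun v d => cov_relax
  have hnew : x.1 = tl e → Cov (OpenShopPath.relax tl hd w e T x) (hd e) (x.2.1 + w e) :=
    cov_relax_new
  revert hc hnew
  unfold OpenShopPath.relax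
  split_ifs with h1 h2
  · exact fun _ _ => hT
  · intro hc hnew
    refine ⟨?_, ?_⟩
    · intro z hz
      rcases List.mem_cons.1 hz with rfl | hz
      · refine ⟨⟨rfl, h1 ▸ hx.walk⟩, ?_, ?_, ?_, ?_⟩
        · exact List.cons_subset.2 ⟨he, hx.sub⟩
        · simp [hx.sum, add_comm]
        -- If the walk had visited the head of `e`, its part up to that visit would be covered by a
        -- label of distance at most that of the whole walk, since weights are nonnegative. That
        -- label contradicts `h2`.
        · have : hd e ∉ s :: x.2.2.map hd := by
            intro hmem
            obtain ⟨q, hq, hq'⟩ := hx.walk.exists_suffix hmem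
            obtain ⟨z, hz, hz1, hz2⟩ := hx.cov q _ hq hq'
            apply h2
            refine ⟨z, hz, hz1, hz2.trans ?_⟩
            have h3 : (q.map w).sum ≤ (x.2.2.map w).sum :=
              (hq.sublist.map w).sum_le_sum (by simpa using fun a ha => hw a (hx.sub ha))
            have := hw e he
            linarith [hx.sum]
          exact (List.nodup_cons.2 ⟨this, hx.simple⟩).perm (List.Perm.swap _ _ _)
        · intro q v hq hq'
          rcases List.suffix_cons_iff.1 hq with rfl | hq
          · have := hnew h1
            rw [List.map_cons, List.sum_cons, hx.sum, ← hq'.1, add_comm (w e)]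
            exact this
          · exact hc _ _ (hx.cov q v hq hq')
      · exact (hT.label z (List.mem_of_mem_filter hz)).mono hc
    · rw [List.map_cons, List.nodup_cons]
      refine ⟨by simp, hT.nodup.sublist (List.filter_sublist.map _)⟩
  · exact fun _ _ => hT

/-- Here `l` is the unread part of the snapshot and `T` the evolving table; separating them makes
the induction possible. -/
theorem relaxArc_aux (hw : ∀ e ∈ E, 0 ≤ w e) (he : e ∈ E) :
    ∀ {l : List (ℚ × ℚ × List α)} {T : List (ℚ × ℚ × List α)}, Good tl hd s w E T →
      (∀ x ∈ l, GoodLabel tl hd s w E T x) →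
      Good tl hd s w E (l.foldl (relax tl hd w e) T) ∧
      (∀ v d, Cov T v d → Cov (l.foldl (relax tl hd w e) T) v d) ∧
      ∀ x ∈ l, x.1 = tl e → Cov (l.foldl (relax tl hd w e) T) (hd e) (x.2.1 + w e)
  | [], T, hT, _ => by simp [hT]
  | x :: l, T, hT, hl => by
    obtain ⟨h1, h2, h3⟩ := relaxArc_aux hw he (l := l) (T := relax tl hd w e T x)
      (hT.relax hw he (hl x (by simp)))
      fun y hy => (hl y (by simp [hy])).mono fun v d => cov_relax
    refine ⟨h1, fun v d h => h2 v d (cov_relax h), ?_⟩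
    intro y hy hy'
    rcases List.mem_cons.1 hy with rfl | hy
    · exact h2 _ _ (cov_relax_new hy')
    · exact h3 y hy hy'

theorem Good.relaxArc (hw : ∀ e ∈ E, 0 ≤ w e) (he : e ∈ E) (hT : Good tl hd s w E T) :
    Good tl hd s w E (relaxArc tl hd w T e) := (relaxArc_aux hw he hT hT.label).1

theorem relaxAll_aux (hw : ∀ e ∈ E, 0 ≤ w e) : ∀ {F : List α} {T : List (ℚ × ℚ × List α)},
    Good tl hd s w E T → F ⊆ E →
      Good tl hd s w E (relaxAll tl hd w F T) ∧
      (∀ v d, Cov T v d → Cov (relaxAll tl hd w F T) v d) ∧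
      ∀ e ∈ F, ∀ d, Cov T (tl e) d → Cov (relaxAll tl hd w F T) (hd e) (d + w e)
  | [], T, hT, _ => by simp [relaxAll, hT]
  | e :: F, T, hT, hF => by
    obtain ⟨he, hF⟩ := List.cons_subset.1 hF
    obtain ⟨h1, h2, h3⟩ := relaxArc_aux hw he hT hT.label
    obtain ⟨h4, h5, h6⟩ := relaxAll_aux hw (F := F) (T := OpenShopPath.relaxArc tl hd w T e) h1 hF
    refine ⟨h4, fun v d h => h5 v d (h2 v d h), ?_⟩
    rintro f hf d hd'
    rcases List.mem_cons.1 hf with rfl | hf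
    · obtain ⟨z, hz, hz1, hz2⟩ := hd'
      obtain ⟨y, hy, hy1, hy2⟩ := h5 _ _ (h3 z hz hz1)
      exact ⟨y, hy, hy1, hy2.trans (by linarith)⟩
    · exact h6 f hf d (h2 _ _ hd')

theorem good_init : Good tl hd s w E [(s, 0, [])] where
  label x hx := by
    obtain rfl := List.mem_singleton.1 hx
    refine ⟨rfl, by simp, by simp, by simp, ?_⟩
    intro q v hq hq'
    obtain rfl := List.suffix_nil.1 hq
    exact ⟨_, List.mem_cons_self, hq'.symm, by simp⟩
  nodup := by simp

/-- The labels after one round for each element of `vs`. -/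
theorem rounds_spec (hw : ∀ e ∈ E, 0 ≤ w e) {β : Type} (vs : List β) :
    Good tl hd s w E (vs.foldl (fun T _ => relaxAll tl hd w E T) [(s, 0, [])]) ∧
    ∀ P v, P ⊆ E → RWalk tl hd s P v → P.length ≤ vs.length →
      Cov (vs.foldl (fun T _ => relaxAll tl hd w E T) [(s, 0, [])]) v (P.map w).sum := by
  -- Rounds are peeled off at the end: the last round handles the last arc of the walk, which is the
  -- head of its reversed list.
  induction vs using List.reverseRecOn with
  | nil =>
    refine ⟨good_init, ?_⟩
    intro P v _ hP hl
    obtain rfl : P = [] := by simpa using hl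
    exact ⟨_, List.mem_cons_self, hP.symm, by simp⟩
  | append_singleton vs b ih =>
    simp only [List.foldl_append, List.foldl_cons, List.foldl_nil]
    obtain ⟨h1, h2, h3⟩ := relaxAll_aux hw ih.1 (List.Subset.refl E)
    refine ⟨h1, ?_⟩
    intro P v hPE hP hl
    match P, hP with
    | [], hP => exact h2 _ _ (ih.2 [] v (by simp) hP (by simp))
    | e :: P, hP =>
      obtain ⟨he, hPE⟩ := List.cons_subset.1 hPE
      have := h3 e he _ (ih.2 P _ hPE hP.2 (by simpa using hl))
      rw [hP.1] at this
      simpa [add_comm] using this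

theorem RWalk.mem_of_sub {vs : List ℚ} {P : List α} {v : ℚ} (h : RWalk tl hd s P v)
    (hP : P ⊆ E) (hs : s ∈ vs) (hE : ∀ e ∈ E, hd e ∈ vs) : v ∈ vs := by
  rcases List.mem_cons.1 h.end_mem with rfl | h
  · exact hs
  · obtain ⟨e, he, rfl⟩ := List.mem_map.1 h
    exact hE e (hP he)

theorem Good.length_le {vs : List ℚ} (h : Good tl hd s w E T) (hs : s ∈ vs)
    (hE : ∀ e ∈ E, hd e ∈ vs) : T.length ≤ vs.length := by
  have : T.map Prod.fst ⊆ vs := by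
    intro v hv
    obtain ⟨x, hx, rfl⟩ := List.mem_map.1 hv
    exact (h.label x hx).walk.mem_of_sub (h.label x hx).sub hs hE
  simpa using (h.nodup.subperm this).length_le

theorem GoodLabel.length_le {vs : List ℚ} (h : GoodLabel tl hd s w E T x) (hs : s ∈ vs)
    (hE : ∀ e ∈ E, hd e ∈ vs) : x.2.2.length + 1 ≤ vs.length := by
  refine length_lt_of_simple h.simple (List.cons_subset.2 ⟨hs, ?_⟩)
  intro v hv
  obtain ⟨e, he, rfl⟩ := List.mem_map.1 hv
  exact hE e (h.sub he)

end Shortest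

/-! ### Dynamic programming -/

section Dynamic

variable {α : Type} (tl hd : α → ℚ) (s : ℚ) (c₁ c₂ : α → ℚ) (B : ℚ)

/-- Extend the label `x` by the arc `e`. -/
def extend (e : α) (S : List (ℚ × (ℚ × ℚ) × List α)) (x : ℚ × (ℚ × ℚ) × List α) :
    List (ℚ × (ℚ × ℚ) × List α) :=
  if x.1 = tl e then
    if (x.2.1.1 + c₁ e ≤ B ∧ x.2.1.2 + c₂ e ≤ B) ∧
      ¬ ∃ z ∈ S, z.1 = hd e ∧ z.2.1.1 = x.2.1.1 + c₁ e ∧ z.2.1.2 = x.2.1.2 + c₂ e then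
      (hd e, (x.2.1.1 + c₁ e, x.2.1.2 + c₂ e), e :: x.2.2) :: S
    else S
  else S

/-- Extend all labels by the arc `e`. -/
def extendArc (S : List (ℚ × (ℚ × ℚ) × List α)) (e : α) : List (ℚ × (ℚ × ℚ) × List α) :=
  S.foldl (extend tl hd c₁ c₂ B e) S

/-- A round of the dynamic program. -/
def extendAll (E : List α) (S : List (ℚ × (ℚ × ℚ) × List α)) : List (ℚ × (ℚ × ℚ) × List α) :=
  E.foldl (extendArc tl hd c₁ c₂ B) S

/-- In contrast to `GoodLabel`, the walk may contain cycles; it only has to respect the budget `B`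
in both weights. -/
structure MGoodLabel (E : List α) (x : ℚ × (ℚ × ℚ) × List α) : Prop where
  walk : RWalk tl hd s x.2.2 x.1
  sub : x.2.2 ⊆ E
  sum₁ : (x.2.2.map c₁).sum = x.2.1.1
  sum₂ : (x.2.2.map c₂).sum = x.2.1.2
  le₁ : x.2.1.1 ≤ B
  le₂ : x.2.1.2 ≤ B

/-- The key of a label is its vertex together with both weights, and `nodup` says that keys are
distinct. This is what makes the labels countable. -/
structure MGood (E : List α) (S : List (ℚ × (ℚ × ℚ) × List α)) : Prop where
  label : ∀ x ∈ S, MGoodLabel tl hd s c₁ c₂ B E x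
  nodup : (S.map fun x => (x.1, x.2.1)).Nodup

variable {tl hd s c₁ c₂ B} {E : List α} {S S' : List (ℚ × (ℚ × ℚ) × List α)}
  {x : ℚ × (ℚ × ℚ) × List α} {e : α}

theorem subset_extend : S ⊆ extend tl hd c₁ c₂ B e S x := by
  unfold extend
  split_ifs <;> simp

theorem extend_new (h : x.1 = tl e) (h₁ : x.2.1.1 + c₁ e ≤ B) (h₂ : x.2.1.2 + c₂ e ≤ B) :
    ∃ z ∈ extend tl hd c₁ c₂ B e S x,
      z.1 = hd e ∧ z.2.1 = (x.2.1.1 + c₁ e, x.2.1.2 + c₂ e) := by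
  unfold extend
  rw [if_pos h]
  split_ifs with h3
  · exact ⟨_, List.mem_cons_self, rfl, rfl⟩
  · have : ∃ z ∈ S, z.1 = hd e ∧ z.2.1.1 = x.2.1.1 + c₁ e ∧ z.2.1.2 = x.2.1.2 + c₂ e := by
      by_contra h4
      exact h3 ⟨⟨h₁, h₂⟩, h4⟩
    obtain ⟨z, hz, h4, h5, h6⟩ := this
    exact ⟨z, hz, h4, Prod.ext h5 h6⟩

theorem MGood.extend (hS : MGood tl hd s c₁ c₂ B E S) (he : e ∈ E)
    (hx : MGoodLabel tl hd s c₁ c₂ B E x) : MGood tl hd s c₁ c₂ B E (extend tl hd c₁ c₂ B e S x) := by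
  unfold OpenShopPath.extend
  split_ifs with h1 h2
  · refine ⟨?_, ?_⟩
    · intro z hz
      rcases List.mem_cons.1 hz with rfl | hz
      · exact ⟨⟨rfl, h1 ▸ hx.walk⟩, List.cons_subset.2 ⟨he, hx.sub⟩, by simp [hx.sum₁, add_comm],
          by simp [hx.sum₂, add_comm], h2.1.1, h2.1.2⟩
      · exact hS.label z hz
    · rw [List.map_cons, List.nodup_cons]
      refine ⟨?_, hS.nodup⟩
      intro hmem
      obtain ⟨z, hz, hz'⟩ := List.mem_map.1 hmem
      simp only [Prod.ext_iff] at hz'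
      exact h2.2 ⟨z, hz, hz'.1, hz'.2.1, hz'.2.2⟩
  · exact hS
  · exact hS

theorem extendArc_aux (he : e ∈ E) :
    ∀ {l S : List (ℚ × (ℚ × ℚ) × List α)}, MGood tl hd s c₁ c₂ B E S →
      (∀ x ∈ l, MGoodLabel tl hd s c₁ c₂ B E x) →
      MGood tl hd s c₁ c₂ B E (l.foldl (extend tl hd c₁ c₂ B e) S) ∧
      S ⊆ l.foldl (extend tl hd c₁ c₂ B e) S ∧
      ∀ x ∈ l, x.1 = tl e → x.2.1.1 + c₁ e ≤ B → x.2.1.2 + c₂ e ≤ B →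
        ∃ z ∈ l.foldl (extend tl hd c₁ c₂ B e) S,
          z.1 = hd e ∧ z.2.1 = (x.2.1.1 + c₁ e, x.2.1.2 + c₂ e)
  | [], S, hS, _ => by simp [hS]
  | x :: l, S, hS, hl => by
    obtain ⟨h1, h2, h3⟩ := extendArc_aux he (l := l) (S := extend tl hd c₁ c₂ B e S x)
      (hS.extend he (hl x (by simp))) fun y hy => hl y (by simp [hy])
    refine ⟨h1, fun _ hz => h2 (subset_extend hz), ?_⟩
    intro y hy hy' hy₁ hy₂
    rcases List.mem_cons.1 hy with rfl | hy
    · obtain ⟨z, hz, hz'⟩ := extend_new (S := S) (hd := hd) hy' hy₁ hy₂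
      exact ⟨z, h2 hz, hz'⟩
    · exact h3 y hy hy' hy₁ hy₂

theorem extendAll_aux : ∀ {F : List α} {S : List (ℚ × (ℚ × ℚ) × List α)},
    MGood tl hd s c₁ c₂ B E S → F ⊆ E →
      MGood tl hd s c₁ c₂ B E (extendAll tl hd c₁ c₂ B F S) ∧
      S ⊆ extendAll tl hd c₁ c₂ B F S ∧
      ∀ e ∈ F, ∀ x ∈ S, x.1 = tl e → x.2.1.1 + c₁ e ≤ B → x.2.1.2 + c₂ e ≤ B →
        ∃ z ∈ extendAll tl hd c₁ c₂ B F S,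
          z.1 = hd e ∧ z.2.1 = (x.2.1.1 + c₁ e, x.2.1.2 + c₂ e)
  | [], S, hS, _ => by simp [extendAll, hS]
  | e :: F, S, hS, hF => by
    obtain ⟨he, hF⟩ := List.cons_subset.1 hF
    obtain ⟨h1, h2, h3⟩ := extendArc_aux he hS hS.label
    obtain ⟨h4, h5, h6⟩ := extendAll_aux (F := F) (S := extendArc tl hd c₁ c₂ B S e) h1 hF
    refine ⟨h4, fun _ hz => h5 (h2 hz), ?_⟩
    intro f hf x hx hx' hx₁ hx₂
    rcases List.mem_cons.1 hf with rfl | hf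
    · obtain ⟨z, hz, hz'⟩ := h3 x hx hx' hx₁ hx₂
      exact ⟨z, h5 hz, hz'⟩
    · exact h6 f hf x (h2 hx) hx' hx₁ hx₂

theorem mgood_init (hB : 0 ≤ B) : MGood tl hd s c₁ c₂ B E [(s, (0, 0), [])] where
  label x hx := by
    obtain rfl := List.mem_singleton.1 hx
    exact ⟨rfl, by simp, by simp, by simp, hB, hB⟩
  nodup := by simp

/-- The labels after one round for each element of `vs`. -/
theorem mrounds_spec (hB : 0 ≤ B) (h₁ : ∀ e ∈ E, 0 ≤ c₁ e) (h₂ : ∀ e ∈ E, 0 ≤ c₂ e)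
    {β : Type} (vs : List β) :
    MGood tl hd s c₁ c₂ B E (vs.foldl (fun S _ => extendAll tl hd c₁ c₂ B E S) [(s, (0, 0), [])]) ∧
    ∀ P v, P ⊆ E → RWalk tl hd s P v → P.length ≤ vs.length →
      (P.map c₁).sum ≤ B → (P.map c₂).sum ≤ B →
      ∃ z ∈ vs.foldl (fun S _ => extendAll tl hd c₁ c₂ B E S) [(s, (0, 0), [])],
        z.1 = v ∧ z.2.1 = ((P.map c₁).sum, (P.map c₂).sum) := by
  induction vs using List.reverseRecOn with
  | nil =>
    refine ⟨mgood_init hB, ?_⟩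
    intro P v _ hP hl _ _
    obtain rfl : P = [] := by simpa using hl
    exact ⟨_, List.mem_cons_self, hP.symm, by simp⟩
  | append_singleton vs b ih =>
    simp only [List.foldl_append, List.foldl_cons, List.foldl_nil]
    obtain ⟨h1, h2, h3⟩ := extendAll_aux ih.1 (List.Subset.refl E)
    refine ⟨h1, ?_⟩
    intro P v hPE hP hl hP₁ hP₂
    match P, hP with
    | [], hP =>
      obtain ⟨z, hz, hz'⟩ := ih.2 [] v (by simp) hP (by simp) hP₁ hP₂
      exact ⟨z, h2 hz, hz'⟩
    | e :: P, hP =>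
      obtain ⟨he, hPE⟩ := List.cons_subset.1 hPE
      simp only [List.map_cons, List.sum_cons] at hP₁ hP₂ ⊢
      -- The walk without its last arc also respects the budget, because the weights are
      -- nonnegative.
      obtain ⟨z, hz, hz1, hz2⟩ := ih.2 P _ hPE hP.2 (by simpa using hl)
        (by linarith [h₁ e he]) (by linarith [h₂ e he])
      have := h3 e he z hz hz1 (by rw [hz2]; simpa [add_comm] using hP₁)
        (by rw [hz2]; simpa [add_comm] using hP₂)
      rw [hP.1, hz2] at this
      simpa [add_comm] using this

/-- The number of labels, if the weights are natural numbers. -/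
theorem MGood.length_le {vs : List ℚ} {b : ℕ} (h : MGood tl hd s c₁ c₂ B E S) (hs : s ∈ vs)
    (hE : ∀ e ∈ E, hd e ∈ vs) (h₁ : ∀ e ∈ E, ∃ n : ℕ, c₁ e = n) (h₂ : ∀ e ∈ E, ∃ n : ℕ, c₂ e = n)
    (hb : B < b) : S.length ≤ vs.length * b ^ 2 := by
  have key : ∀ (c : α → ℚ), (∀ e ∈ E, ∃ n : ℕ, c e = n) → ∀ P ⊆ E, (P.map c).sum ≤ B →
      ∃ n : ℕ, n < b ∧ (P.map c).sum = n := by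
    intro c hc P hP hle
    have : ∃ n : ℕ, (P.map c).sum = n := by
      clear hle
      induction P with
      | nil => exact ⟨0, by simp⟩
      | cons e P ih =>
        obtain ⟨he, hP⟩ := List.cons_subset.1 hP
        obtain ⟨n, hn⟩ := ih hP
        obtain ⟨k, hk⟩ := hc e he
        exact ⟨k + n, by simp [hn, hk]⟩
    obtain ⟨n, hn⟩ := this
    refine ⟨n, ?_, hn⟩
    have : (n : ℚ) < b := by rw [← hn]; exact hle.trans_lt hb
    exact_mod_cast this
  classical
  -- The keys are distinct elements of the product of the vertex set with the square of `{0, …, b -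
  -- 1}`.
  have hsub : (S.map fun x => (x.1, x.2.1)).toFinset ⊆
      vs.toFinset ×ˢ (((Finset.range b).image (Nat.cast : ℕ → ℚ)) ×ˢ
        ((Finset.range b).image (Nat.cast : ℕ → ℚ))) := by
    intro y hy
    obtain ⟨x, hx, rfl⟩ := List.mem_map.1 (List.mem_toFinset.1 hy)
    have hx' := h.label x hx
    obtain ⟨n, hn, hn'⟩ := key c₁ h₁ x.2.2 hx'.sub (hx'.sum₁.trans_le hx'.le₁)
    obtain ⟨k, hk, hk'⟩ := key c₂ h₂ x.2.2 hx'.sub (hx'.sum₂.trans_le hx'.le₂)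
    simp only [Finset.mem_product, List.mem_toFinset, Finset.mem_image, Finset.mem_range]
    exact ⟨hx'.walk.mem_of_sub hx'.sub hs hE, ⟨n, hn, by rw [← hn', hx'.sum₁]⟩,
      ⟨k, hk, by rw [← hk', hx'.sum₂]⟩⟩
  have h3 := Finset.card_le_card hsub
  rw [List.toFinset_card_of_nodup h.nodup, List.length_map, Finset.card_product,
    Finset.card_product] at h3
  refine h3.trans (Nat.mul_le_mul (List.toFinset_card_le _) ?_)
  rw [sq]
  have : ((Finset.range b).image (Nat.cast : ℕ → ℚ)).card ≤ b := by
    simpa using Finset.card_image_le (s := Finset.range b) (f := (Nat.cast : ℕ → ℚ))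
  exact Nat.mul_le_mul this this

/-- The lengths of the walks found. -/
theorem length_extendAll (F : List α) : ∀ {S : List (ℚ × (ℚ × ℚ) × List α)} {m : ℕ},
    (∀ x ∈ S, x.2.2.length ≤ m) →
    ∀ x ∈ extendAll tl hd c₁ c₂ B F S, x.2.2.length ≤ m + F.length := by
  -- Within the pass for one arc only labels of the snapshot `l` are extended, so walks grow by at
  -- most one arc per pass, not per label.
  have h0 : ∀ {l S : List (ℚ × (ℚ × ℚ) × List α)} {m : ℕ} {e : α}, (∀ x ∈ l, x.2.2.length ≤ m) →
      (∀ x ∈ S, x.2.2.length ≤ m + 1) →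
      ∀ x ∈ l.foldl (extend tl hd c₁ c₂ B e) S, x.2.2.length ≤ m + 1 := by
    intro l
    induction l with
    | nil => intro S m e _ h; exact h
    | cons x l ih =>
      intro S m e hl hS
      refine ih (fun y hy => hl y (by simp [hy])) ?_
      have hx := hl x (by simp)
      unfold extend
      split_ifs with h1 h2
      · intro y hy
        rcases List.mem_cons.1 hy with rfl | hy
        · simpa using hx
        · exact hS y hy
      · exact hS
      · exact hS
  induction F with
  | nil => intro S m h; simpa [extendAll] using h
  | cons e F ih =>
    intro S m h x hx
    have := ih (S := extendArc tl hd c₁ c₂ B S e) (m := m + 1)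
      (h0 h fun x hx => (h x hx).trans (by omega)) x hx
    simp only [List.length_cons]; omega

theorem length_mrounds {β : Type} (vs : List β) :
    ∀ x ∈ vs.foldl (fun S _ => extendAll tl hd c₁ c₂ B E S) [(s, (0, 0), [])],
      x.2.2.length ≤ vs.length * E.length := by
  induction vs using List.reverseRecOn with
  | nil => simp
  | append_singleton vs b ih =>
    simp only [List.foldl_append, List.foldl_cons, List.foldl_nil]
    intro x hx
    have := length_extendAll E ih x hx
    simpa [add_mul] using this

end Dynamic

/-! ### The min-max path algorithm -/

section

/-- The tail of a weighted arc. -/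
def wtail (e : warcTy.den) : ℚ := e.1.2.1
/-- The head of a weighted arc. -/
def whead (e : warcTy.den) : ℚ := e.1.2.2.1
/-- The first weight. -/
def wt₁ (e : warcTy.den) : ℚ := e.2.1.1
/-- The second weight. -/
def wt₂ (e : warcTy.den) : ℚ := e.2.1.2

/-- The innermost step of the algorithm of Bellman and Ford. -/
def relaxTm {V : Ty → Type} (w : Tm V warcTy → Tm V .num) (e : Tm V warcTy)
    (T : Tm V (.list (.prod .num (.prod .num (.list warcTy)))))
    (x : Tm V (.prod .num (.prod .num (.list warcTy)))) :
    Tm V (.list (.prod .num (.prod .num (.list warcTy)))) :=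
  .cond (eq x.fst (jobTail e.fst))
    (lets (jobHead e.fst) fun y => lets (x.snd.fst + w e) fun d =>
      .cond (any T fun z => and (eq z.fst y) (.le z.snd.fst d))
        T
        (.cons (.pair y (.pair d (.cons e x.snd.snd))) (filter T fun z => not (eq z.fst y))))
    T

theorem val_relaxTm (w : Tm Ty.den warcTy → Tm Ty.den .num) (e : warcTy.den)
    (T : List (ℚ × ℚ × List warcTy.den)) (x : ℚ × ℚ × List warcTy.den) :
    (relaxTm w (.var e) (.var T) (.var x)).val
      = relax wtail whead (fun e => (w (.var e)).val) e T x := by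
  simp only [relaxTm, relax, wtail, whead, jobTail, jobHead, val_cond, val_eq, val_var,
    val_fst, val_snd, val_lets, val_add, val_filter, val_not, val_cons, val_pair,
    decide_eq_true_eq]
  refine if_congr Iff.rfl (if_congr ?_ rfl rfl) rfl
  rw [val_any, List.any_eq_true]
  simp

/-- A pass through all labels. -/
def relaxArcTm {V : Ty → Type} (w : Tm V warcTy → Tm V .num)
    (T : Tm V (.list (.prod .num (.prod .num (.list warcTy))))) (e : Tm V warcTy) :
    Tm V (.list (.prod .num (.prod .num (.list warcTy)))) :=
  loop T T fun T' x => relaxTm w e T' x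

theorem val_relaxArcTm (w : Tm Ty.den warcTy → Tm Ty.den .num) (e : warcTy.den)
    (T : List (ℚ × ℚ × List warcTy.den)) :
    (relaxArcTm w (.var T) (.var e)).val
      = relaxArc wtail whead (fun e => (w (.var e)).val) T e := by
  simp only [relaxArcTm, val_loop, val_relaxTm, val_var, relaxArc]

theorem val_spLabels (vs : Tm Ty.den (.list .num)) (s : Tm Ty.den .num)
    (E : Tm Ty.den (.list warcTy)) (w : Tm Ty.den warcTy → Tm Ty.den .num) :
    (spLabels vs s E w).val = vs.val.foldl
      (fun T _ => relaxAll wtail whead (fun e => (w (.var e)).val) E.val T) [(s.val, 0, [])] := by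
  have : spLabels vs s E w = loop vs (.cons (.pair s (.pair (.lit 0) .nil)) .nil) fun T _ =>
    loop E T fun T e => relaxArcTm w T e := rfl
  simp only [this, val_loop, val_relaxArcTm]
  rfl

/-- The fold keeps the last match. That the choice does not matter follows elsewhere, from the
uniqueness of labels. -/
theorem foldl_select {β γ : Type} (p : β → Prop) [DecidablePred p] (g : β → γ) :
    ∀ (l : List β) (i : γ), (∃ x ∈ l, p x) →
      ∃ x ∈ l, p x ∧ l.foldl (fun r x => if p x then g x else r) i = g x := by
  intro l
  induction l using List.reverseRecOn with
  | nil => simp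
  | append_singleton l y ih =>
    intro i h
    simp only [List.foldl_append, List.foldl_cons, List.foldl_nil]
    by_cases hy : p y
    · exact ⟨y, by simp, hy, by simp [hy]⟩
    · obtain ⟨x, hx, hpx⟩ := h
      have hx' : x ∈ l := by
        rcases List.mem_append.1 hx with h | h
        · exact h
        · obtain rfl := List.mem_singleton.1 h
          exact absurd hpx hy
      obtain ⟨z, hz, hz'⟩ := ih i ⟨x, hx', hpx⟩
      exact ⟨z, by simp [hz], by simpa [hy] using hz'⟩

variable {vs : Tm Ty.den (.list .num)} {s t : Tm Ty.den .num} {E : Tm Ty.den (.list warcTy)}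

/-- The result is the reverse of a simple walk, which is as short as any walk with at most `|vs|`
arcs. -/
theorem shortestPath_spec (hw : ∀ e ∈ E.val, 0 ≤ wt₁ e + wt₂ e) {P : List warcTy.den}
    (hPE : P ⊆ E.val) (hP : RWalk wtail whead s.val P t.val) (hl : P.length ≤ vs.val.length) :
    ∃ R, (shortestPath vs s t E).val = R.reverse ∧ R ⊆ E.val ∧
      RWalk wtail whead s.val R t.val ∧ (s.val :: R.map whead).Nodup ∧
      ∀ Q, Q ⊆ E.val → RWalk wtail whead s.val Q t.val → Q.length ≤ vs.val.length →
        (R.map fun e => wt₁ e + wt₂ e).sum ≤ (Q.map fun e => wt₁ e + wt₂ e).sum := by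
  obtain ⟨hG, hC⟩ := rounds_spec (s := s.val) (tl := wtail) (hd := whead) hw vs.val
  set T := vs.val.foldl
      (fun T _ => relaxAll wtail whead (fun e => wt₁ e + wt₂ e) E.val T) [(s.val, 0, [])] with hT
  have hT' : (spLabels vs s E fun e => w₁ e + w₂ e).val = T := by
    rw [val_spLabels]; rfl
  have hex : ∃ x ∈ T, x.1 = t.val := by
    obtain ⟨z, hz, hz', _⟩ := hC P _ hPE hP hl
    exact ⟨z, hz, hz'⟩
  obtain ⟨x, hx, hx1, hx2⟩ := foldl_select (fun x : ℚ × ℚ × List warcTy.den => x.1 = t.val)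
    (fun x => x.2.2) T [] hex
  have hg := hG.label x hx
  refine ⟨x.2.2, ?_, hg.sub, hx1 ▸ hg.walk, hg.simple, ?_⟩
  · rw [shortestPath, val_reverse, val_loop, hT', ← hx2]
    simp
  · intro Q hQE hQ hl
    obtain ⟨z, hz, hz1, hz2⟩ := hC Q _ hQE hQ hl
    -- There is only one label at `t`, so the covering label is the selected one.
    obtain rfl : z = x := List.inj_on_of_nodup_map hG.nodup hz hx (hz1.trans hx1.symm)
    rw [hg.sum]
    exact hz2

/-- The innermost step of the dynamic program. -/
def extendTm {V : Ty → Type} (c₁ c₂ B : Tm V .num) (e : Tm V warcTy)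
    (S : Tm V (.list (.prod .num (.prod (.prod .num .num) (.list warcTy)))))
    (x : Tm V (.prod .num (.prod (.prod .num .num) (.list warcTy)))) :
    Tm V (.list (.prod .num (.prod (.prod .num .num) (.list warcTy)))) :=
  .cond (eq x.fst (jobTail e.fst))
    (lets (jobHead e.fst) fun y =>
      lets (x.snd.fst.fst + c₁) fun a₁ => lets (x.snd.fst.snd + c₂) fun a₂ =>
      .cond (and (and (.le a₁ B) (.le a₂ B))
          (not (any S fun z =>
            and (eq z.fst y) (and (eq z.snd.fst.fst a₁) (eq z.snd.fst.snd a₂)))))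
        (.cons (.pair y (.pair (.pair a₁ a₂) (.cons e x.snd.snd))) S)
        S)
    S

theorem val_extendTm (c₁ c₂ : warcTy.den → ℚ) (B : Tm Ty.den .num) (e : warcTy.den)
    (S : List (ℚ × (ℚ × ℚ) × List warcTy.den)) (x : ℚ × (ℚ × ℚ) × List warcTy.den) :
    (extendTm (.var (c₁ e)) (.var (c₂ e)) B (.var e) (.var S) (.var x)).val
      = extend wtail whead c₁ c₂ B.val e S x := by
  simp only [extendTm, extend, wtail, whead, jobTail, jobHead, val_cond, val_eq, val_var,
    val_fst, val_snd, val_lets, val_add, val_and, val_le, val_not, val_any,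
    val_cons, val_pair, decide_eq_true_eq]
  refine if_congr Iff.rfl (if_congr ?_ rfl rfl) rfl
  rw [Bool.and_eq_true, Bool.and_eq_true, Bool.not_eq_true', ← Bool.not_eq_true, List.any_eq_true]
  simp

/-- A pass through all labels. -/
def extendArcTm {V : Ty → Type} (k B : Tm V .num)
    (S : Tm V (.list (.prod .num (.prod (.prod .num .num) (.list warcTy))))) (e : Tm V warcTy) :
    Tm V (.list (.prod .num (.prod (.prod .num .num) (.list warcTy)))) :=
  lets (.floor (k * w₁ e)) fun c₁ => lets (.floor (k * w₂ e)) fun c₂ =>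
  loop S S fun S' x => extendTm c₁ c₂ B e S' x

theorem val_extendArcTm (k B : Tm Ty.den .num) (e : warcTy.den)
    (S : List (ℚ × (ℚ × ℚ) × List warcTy.den)) :
    (extendArcTm k B (.var S) (.var e)).val
      = extendArc wtail whead (fun e => ((⌊k.val * wt₁ e⌋ : ℤ) : ℚ))
        (fun e => ((⌊k.val * wt₂ e⌋ : ℤ) : ℚ)) B.val S e := by
  simp only [extendArcTm, val_lets, val_loop, val_var, extendArc]
  congr 1
  funext S x
  exact val_extendTm (fun e => ((⌊k.val * wt₁ e⌋ : ℤ) : ℚ))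
    (fun e => ((⌊k.val * wt₂ e⌋ : ℤ) : ℚ)) B e S x

theorem val_mmLabels (k B : Tm Ty.den .num) :
    (mmLabels vs s E k B).val = vs.val.foldl
      (fun S _ => extendAll wtail whead (fun e => ((⌊k.val * wt₁ e⌋ : ℤ) : ℚ))
        (fun e => ((⌊k.val * wt₂ e⌋ : ℤ) : ℚ)) B.val E.val S) [(s.val, (0, 0), [])] := by
  have : mmLabels vs s E k B = loop vs
    (.cons (.pair s (.pair (.pair (.lit 0) (.lit 0)) .nil)) .nil) fun S _ =>
    loop E S fun S e => extendArcTm k B S e := rfl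
  simp only [this, val_loop, val_extendArcTm]
  rfl

/-- The start value `B` acts as a threshold: the default walk `i` survives only if every label at
`t` exceeds it. The comparison is not strict, so a label that meets the threshold exactly replaces
the default. -/
theorem foldl_min (t : ℚ) (g : ℚ × (ℚ × ℚ) × List warcTy.den → ℚ)
    (l : List (ℚ × (ℚ × ℚ) × List warcTy.den)) (B : ℚ)
    (i : List warcTy.den) :
    let r := l.foldl (fun (r : ℚ × List warcTy.den) x =>
      if x.1 = t then (if g x ≤ r.1 then (g x, x.2.2) else r) else r) (B, i)
    r.1 ≤ B ∧ (∀ x ∈ l, x.1 = t → r.1 ≤ g x) ∧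
      (r = (B, i) ∧ (∀ x ∈ l, x.1 = t → B < g x) ∨ ∃ x ∈ l, x.1 = t ∧ r = (g x, x.2.2)) := by
  induction l using List.reverseRecOn with
  | nil => simp
  | append_singleton l y ih =>
    simp only [List.foldl_append, List.foldl_cons, List.foldl_nil] at ih ⊢
    set r := l.foldl (fun (r : ℚ × List warcTy.den) x =>
      if x.1 = t then (if g x ≤ r.1 then (g x, x.2.2) else r) else r) (B, i)
    obtain ⟨h1, h2, h3⟩ := ih
    by_cases hy : y.1 = t
    · by_cases hm : g y ≤ r.1
      · rw [if_pos hy, if_pos hm]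
        refine ⟨hm.trans h1, ?_, Or.inr ⟨y, by simp, hy, rfl⟩⟩
        intro x hx hxt
        rcases List.mem_append.1 hx with hx | hx
        · exact hm.trans (h2 x hx hxt)
        · obtain rfl := List.mem_singleton.1 hx
          exact le_rfl
      · rw [if_pos hy, if_neg hm]
        refine ⟨h1, ?_, ?_⟩
        · intro x hx hxt
          rcases List.mem_append.1 hx with hx | hx
          · exact h2 x hx hxt
          · obtain rfl := List.mem_singleton.1 hx
            exact (not_le.1 hm).le
        · rcases h3 with ⟨h3, h4⟩ | ⟨x, hx, h3⟩
          · refine Or.inl ⟨h3, ?_⟩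
            intro x hx hxt
            rcases List.mem_append.1 hx with hx | hx
            · exact h4 x hx hxt
            · obtain rfl := List.mem_singleton.1 hx
              rw [h3] at hm
              exact not_le.1 hm
          · exact Or.inr ⟨x, by simp [hx], h3⟩
    · rw [if_neg hy]
      refine ⟨h1, ?_, ?_⟩
      · intro x hx hxt
        rcases List.mem_append.1 hx with hx | hx
        · exact h2 x hx hxt
        · obtain rfl := List.mem_singleton.1 hx
          exact absurd hxt hy
      · rcases h3 with ⟨h3, h4⟩ | ⟨x, hx, h3⟩
        · refine Or.inl ⟨h3, ?_⟩
          intro x hx hxt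
          rcases List.mem_append.1 hx with hx | hx
          · exact h4 x hx hxt
          · obtain rfl := List.mem_singleton.1 hx
            exact absurd hxt hy
        · exact Or.inr ⟨x, by simp [hx], h3⟩

/-- The selection of a walk to `t` of least larger scaled weight. -/
def mmSelect {V : Ty → Type}
    (S : Tm V (.list (.prod .num (.prod (.prod .num .num) (.list warcTy)))))
    (t B : Tm V .num) : Tm V (.list warcTy) :=
  Tm.snd (loop S (.pair B (.nil : Tm V (.list warcTy))) fun r x =>
    .cond (eq x.fst t)
      (lets (maxOf x.snd.fst.fst x.snd.fst.snd) fun m =>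
        .cond (.le m r.fst) (.pair m x.snd.snd) r)
      r)

theorem val_mmSelect (S : Tm Ty.den (.list (.prod .num (.prod (.prod .num .num) (.list warcTy)))))
    (t B : Tm Ty.den .num) : (mmSelect S t B).val =
      (S.val.foldl (fun (r : ℚ × List warcTy.den) x =>
        if x.1 = t.val then
          (if max x.2.1.1 x.2.1.2 ≤ r.1 then (max x.2.1.1 x.2.1.2, x.2.2) else r)
        else r) (B.val, [])).2 := by
  rw [mmSelect, val_snd, val_loop]
  simp

/-- The walk found by the dynamic program. -/
theorem mmSelect_spec {k B : Tm Ty.den .num} (hs : s.val ∈ vs.val)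
    (hE : ∀ e ∈ E.val, whead e ∈ vs.val) (h₁ : ∀ e ∈ E.val, 0 ≤ wt₁ e)
    (h₂ : ∀ e ∈ E.val, 0 ≤ wt₂ e) (hk : 0 < k.val) (hB : 0 ≤ B.val) {P : List warcTy.den}
    (hPE : P ⊆ E.val) (hP : RWalk wtail whead s.val P t.val)
    (hPn : (s.val :: P.map whead).Nodup)
    (hP₁ : k.val * (P.map wt₁).sum ≤ B.val) (hP₂ : k.val * (P.map wt₂).sum ≤ B.val) :
    ∃ Q, (mmSelect (mmLabels vs s E k B) t B).val = Q ∧ Q ⊆ E.val ∧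
      RWalk wtail whead s.val Q t.val ∧ Q.length ≤ vs.val.length * E.val.length ∧
      ∀ P, P ⊆ E.val → RWalk wtail whead s.val P t.val → (s.val :: P.map whead).Nodup →
        k.val * (P.map wt₁).sum ≤ B.val → k.val * (P.map wt₂).sum ≤ B.val →
        max (Q.map fun e => ((⌊k.val * wt₁ e⌋ : ℤ) : ℚ)).sum
            (Q.map fun e => ((⌊k.val * wt₂ e⌋ : ℤ) : ℚ)).sum
          ≤ max (k.val * (P.map wt₁).sum) (k.val * (P.map wt₂).sum) := by
  set c₁ : warcTy.den → ℚ := fun e => ((⌊k.val * wt₁ e⌋ : ℤ) : ℚ) with hc₁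
  set c₂ : warcTy.den → ℚ := fun e => ((⌊k.val * wt₂ e⌋ : ℤ) : ℚ) with hc₂
  have hn₁ : ∀ e ∈ E.val, 0 ≤ c₁ e := fun e he => by
    simpa [hc₁] using Int.floor_nonneg.2 (mul_nonneg hk.le (h₁ e he))
  have hn₂ : ∀ e ∈ E.val, 0 ≤ c₂ e := fun e he => by
    simpa [hc₂] using Int.floor_nonneg.2 (mul_nonneg hk.le (h₂ e he))
  obtain ⟨hG, hC⟩ := mrounds_spec (s := s.val) (tl := wtail) (hd := whead) hB hn₁ hn₂ vs.val
  have hlen₀ := length_mrounds (tl := wtail) (hd := whead) (s := s.val) (c₁ := c₁) (c₂ := c₂)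
    (B := B.val) (E := E.val) vs.val
  have hsum : ∀ (c w : warcTy.den → ℚ), (∀ e, c e ≤ k.val * w e) → ∀ P : List warcTy.den,
      (P.map c).sum ≤ k.val * (P.map w).sum := by
    intro c w hc P
    rw [← List.sum_map_mul_left]
    exact List.sum_le_sum fun e _ => hc e
  have hs₁ := hsum c₁ wt₁ fun e => Int.floor_le _
  have hs₂ := hsum c₂ wt₂ fun e => Int.floor_le _
  rw [val_mmSelect, val_mmLabels]
  set S := vs.val.foldl (fun S _ => extendAll wtail whead c₁ c₂ B.val E.val S)
    [(s.val, (0, 0), [])] with hS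
  have hlen : ∀ P, P ⊆ E.val → (s.val :: P.map whead).Nodup → P.length ≤ vs.val.length := by
    intro P hPE hP
    have := length_lt_of_simple hP (List.cons_subset.2 ⟨hs, fun v hv => by
      obtain ⟨e, he, rfl⟩ := List.mem_map.1 hv
      exact hE e (hPE he)⟩)
    omega
  have hlab : ∀ P, P ⊆ E.val → RWalk wtail whead s.val P t.val → (s.val :: P.map whead).Nodup →
        k.val * (P.map wt₁).sum ≤ B.val → k.val * (P.map wt₂).sum ≤ B.val →
        ∃ z ∈ S, z.1 = t.val ∧ z.2.1 = ((P.map c₁).sum, (P.map c₂).sum) :=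
    fun P h1 h2 h3 h4 h5 => hC P _ h1 h2 (hlen P h1 h3) ((hs₁ P).trans h4) ((hs₂ P).trans h5)
  obtain ⟨-, h2, h3⟩ := foldl_min t.val (fun x => max x.2.1.1 x.2.1.2) S B.val []
  rcases h3 with ⟨-, h3⟩ | ⟨x, hx, hxt, h3⟩
  -- The path `P` fits into the budget, hence it has a label at `t` within the threshold, and the
  -- default cannot have survived.
  · exfalso
    obtain ⟨z, hz, hz1, hz2⟩ := hlab P hPE hP hPn hP₁ hP₂
    refine (h3 z hz hz1).not_ge ?_
    rw [hz2]
    exact max_le ((hs₁ P).trans hP₁) ((hs₂ P).trans hP₂)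
  · have hg := hG.label x hx
    refine ⟨x.2.2, ?_, hg.sub, hxt ▸ hg.walk, ?_, ?_⟩
    · rw [h3]
    · exact hlen₀ x hx
    · intro R h4 h5 h6 h7 h8
      obtain ⟨z, hz, hz1, hz2⟩ := hlab R h4 h5 h6 h7 h8
      have := h2 z hz hz1
      rw [h3, hz2] at this
      rw [hg.sum₁, hg.sum₂]
      exact this.trans (max_le_max (hs₁ R) (hs₂ R))

end

/-! ### The approximation guarantee of the min-max path algorithm. -/

section

variable {vs : Tm Ty.den (.list .num)} {s t ε : Tm Ty.den .num} {E : Tm Ty.den (.list warcTy)}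

theorem val_abv : (abv ε vs s t E).val =
    let P₀ : List warcTy.den := (shortestPath vs s t (.var E.val)).val
    let W₁ : ℚ := (P₀.map wt₁).sum
    let W₂ : ℚ := (P₀.map wt₂).sum
    let k : ℚ := (vs.val.length : ℚ) / (ε.val * ((W₁ + W₂) / 2))
    let B : ℚ := max W₁ W₂ * k
    if max W₁ W₂ ≤ 0 then P₀ else
      (shortestPath vs s t
        (.var (mmSelect (mmLabels vs s (.var E.val) (.var k) (.var B)) t (.var B)).val)).val := by
  have h1 : ∀ P : List warcTy.den, (sumOf (.var P) w₁).val = (P.map wt₁).sum := fun P => by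
    rw [val_sumOf]; rfl
  have h2 : ∀ P : List warcTy.den, (sumOf (.var P) w₂).val = (P.map wt₂).sum := fun P => by
    rw [val_sumOf]; rfl
  have h3 : (sumOf vs fun _ => .lit 1).val = (vs.val.length : ℚ) := by
    rw [val_sumOf]; simp
  simp only [abv, val_lets, val_cond, h1, h2, h3, val_maxOf, val_le, val_var, val_lit, val_div,
    val_mul, val_add, decide_eq_true_eq]
  rfl

/-- The path found by ABV is an approximate solution of the min-max path problem. -/
theorem abv_spec (hε : 0 < ε.val) (hs : s.val ∈ vs.val) (hE : ∀ e ∈ E.val, whead e ∈ vs.val)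
    (h₁ : ∀ e ∈ E.val, 0 ≤ wt₁ e) (h₂ : ∀ e ∈ E.val, 0 ≤ wt₂ e) {P : List warcTy.den}
    (hPE : P ⊆ E.val) (hP : RWalk wtail whead s.val P t.val)
    (hPn : (s.val :: P.map whead).Nodup) :
    ∃ R, (abv ε vs s t E).val = R.reverse ∧ R ⊆ E.val ∧ RWalk wtail whead s.val R t.val ∧
      (s.val :: R.map whead).Nodup ∧
      ∀ Q, Q ⊆ E.val → RWalk wtail whead s.val Q t.val → (s.val :: Q.map whead).Nodup →
        max (R.map wt₁).sum (R.map wt₂).sum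
          ≤ (1 + ε.val) * max (Q.map wt₁).sum (Q.map wt₂).sum := by
  have hlen : ∀ P, P ⊆ E.val → (s.val :: P.map whead).Nodup → P.length + 1 ≤ vs.val.length := by
    intro P hPE hP
    exact length_lt_of_simple hP (List.cons_subset.2 ⟨hs, fun v hv => by
      obtain ⟨e, he, rfl⟩ := List.mem_map.1 hv
      exact hE e (hPE he)⟩)
  have hsum : ∀ P : List warcTy.den, (P.map fun e => wt₁ e + wt₂ e).sum
      = (P.map wt₁).sum + (P.map wt₂).sum := fun P => List.sum_map_add
  obtain ⟨R₀, hR₀, hR₀E, hR₀w, hR₀n, hR₀m⟩ := shortestPath_spec (vs := vs) (s := s) (t := t)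
    (E := .var E.val) (fun e he => add_nonneg (h₁ e he) (h₂ e he)) hPE hP
    ((Nat.le_succ _).trans (hlen P hPE hPn))
  simp only [val_var] at hR₀E hR₀m
  rw [val_abv, hR₀]
  simp only [List.map_reverse, List.sum_reverse]
  have n₁ : ∀ P, P ⊆ E.val → 0 ≤ (P.map wt₁).sum := fun P hP =>
    sum_map_nonneg fun e he => h₁ e (hP he)
  have n₂ : ∀ P, P ⊆ E.val → 0 ≤ (P.map wt₂).sum := fun P hP =>
    sum_map_nonneg fun e he => h₂ e (hP he)
  have hm₀ : ∀ Q, Q ⊆ E.val → RWalk wtail whead s.val Q t.val → (s.val :: Q.map whead).Nodup →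
      (R₀.map wt₁).sum + (R₀.map wt₂).sum ≤ (Q.map wt₁).sum + (Q.map wt₂).sum := by
    intro Q hQE hQ hQn
    rw [← hsum, ← hsum]
    exact hR₀m Q hQE hQ ((Nat.le_succ _).trans (hlen Q hQE hQn))
  set W₁ := (R₀.map wt₁).sum with hW₁
  set W₂ := (R₀.map wt₂).sum with hW₂
  have hW₁0 : 0 ≤ W₁ := n₁ R₀ hR₀E
  have hW₂0 : 0 ≤ W₂ := n₂ R₀ hR₀E
  split_ifs with hU
  · refine ⟨R₀, rfl, hR₀E, hR₀w, hR₀n, ?_⟩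
    intro Q hQE hQ hQn
    refine hU.trans (mul_nonneg (by linarith) ((n₁ Q hQE).trans (le_max_left _ _)))
  · have hU : 0 < max W₁ W₂ := not_le.1 hU
    have hL : 0 < (W₁ + W₂) / 2 := by
      rcases lt_max_iff.1 hU with h | h <;> linarith
    have hn : (1 : ℚ) ≤ vs.val.length := by
      exact_mod_cast (Nat.le_add_left 1 _).trans (hlen R₀ hR₀E hR₀n)
    set k : ℚ := (vs.val.length : ℚ) / (ε.val * ((W₁ + W₂) / 2)) with hk
    have hεL : 0 < ε.val * ((W₁ + W₂) / 2) := mul_pos hε hL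
    have hk0 : 0 < k := div_pos (by linarith) hεL
    have hkn : (vs.val.length : ℚ) = k * (ε.val * ((W₁ + W₂) / 2)) := by
      rw [hk, div_mul_cancel₀ _ hεL.ne']
    set B : ℚ := max W₁ W₂ * k with hB
    -- The dynamic program needs some path within the budget `B = U * k`. The initial shortest path
    -- is one, as `U` is its larger weight.
    obtain ⟨Q, hQ, hQE, hQw, -, hQm⟩ := mmSelect_spec (vs := vs) (s := s) (t := t)
      (E := .var E.val) (k := .var k) (B := .var B) hs hE h₁ h₂ hk0 (mul_nonneg hU.le hk0.le)
      hR₀E hR₀w hR₀n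
      (by simp only [val_var, hB]; rw [mul_comm]
          exact mul_le_mul_of_nonneg_right (le_max_left _ _) hk0.le)
      (by simp only [val_var, hB]; rw [mul_comm]
          exact mul_le_mul_of_nonneg_right (le_max_right _ _) hk0.le)
    simp only [val_var] at hQE hQm
    rw [hQ]
    -- The walk `Q` may have cycles. Its simplification `Q'` only shows that `t` can be reached by
    -- at most `|V|` arcs taken from `Q`; the path returned is the `R` of the next step.
    obtain ⟨Q', hQ'Q, hQ'w, hQ'n⟩ := hQw.exists_simple
    obtain ⟨R, hR, hRQ, hRw, hRn, -⟩ := shortestPath_spec (vs := vs) (s := s) (t := t)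
      (E := .var Q) (fun e he => add_nonneg (h₁ e (hQE he)) (h₂ e (hQE he))) hQ'Q hQ'w
      ((Nat.le_succ _).trans (hlen Q' (fun _ h => hQE (hQ'Q h)) hQ'n))
    simp only [val_var] at hRQ
    have hRE : R ⊆ E.val := fun _ h => hQE (hRQ h)
    refine ⟨R, hR, hRE, hRw, hRn, ?_⟩
    have hQR : ∀ w : warcTy.den → ℚ, (∀ e ∈ E.val, 0 ≤ w e) → k * (R.map w).sum
        ≤ (Q.map fun e => ((⌊k * w e⌋ : ℤ) : ℚ)).sum + vs.val.length := by
      intro w hw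
      have h3 : k * (R.map w).sum ≤ (R.map fun e => ((⌊k * w e⌋ : ℤ) : ℚ)).sum + R.length := by
        rw [← List.sum_map_mul_left]
        have : (R.map fun e => k * w e).sum ≤ (R.map fun e => ((⌊k * w e⌋ : ℤ) : ℚ) + 1).sum :=
          List.sum_le_sum fun e _ => (Int.lt_floor_add_one _).le
        refine this.trans (le_of_eq ?_)
        rw [List.sum_map_add]; simp
      have h4 : (R.map fun e => ((⌊k * w e⌋ : ℤ) : ℚ)).sum
          ≤ (Q.map fun e => ((⌊k * w e⌋ : ℤ) : ℚ)).sum := by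
        -- Although `R` is chosen for the unscaled sum of weights, it uses arcs of `Q` at most once
        -- each, so neither scaled weight can grow.
        refine sum_map_le_of_subset (List.Nodup.of_map _ (List.nodup_cons.1 hRn).2) hRQ ?_
        intro e he
        exact_mod_cast Int.floor_nonneg.2 (mul_nonneg hk0.le (hw e (hQE he)))
      have h5 : (R.length : ℚ) ≤ vs.val.length := by
        exact_mod_cast (Nat.le_succ _).trans (hlen R hRE hRn)
      linarith
    have hmax : ∀ P, P ⊆ E.val → RWalk wtail whead s.val P t.val → (s.val :: P.map whead).Nodup →
        max (P.map wt₁).sum (P.map wt₂).sum ≤ max W₁ W₂ →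
        (W₁ + W₂) / 2 ≤ max (P.map wt₁).sum (P.map wt₂).sum →
        max (R.map wt₁).sum (R.map wt₂).sum
          ≤ (1 + ε.val) * max (P.map wt₁).sum (P.map wt₂).sum := by
      intro P hPE hPw hPn hPU hPL
      set m := max (P.map wt₁).sum (P.map wt₂).sum with hm
      have h3 := hQm P hPE hPw hPn
        (by rw [hB, mul_comm]
            exact mul_le_mul_of_nonneg_right ((le_max_left _ _).trans hPU) hk0.le)
        (by rw [hB, mul_comm]
            exact mul_le_mul_of_nonneg_right ((le_max_right _ _).trans hPU) hk0.le)
      rw [← mul_max_of_nonneg _ _ hk0.le, ← hm] at h3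
      have h4 : ∀ x : ℚ, k * x ≤ k * m + vs.val.length → x ≤ (1 + ε.val) * m := by
        intro x hx
        -- The rounding error `|V|` equals `k * (ε * L)`; division by `k` leaves `ε * L`, and `L ≤
        -- m` by `hPL`.
        rw [hkn, ← mul_add] at hx
        have := le_of_mul_le_mul_left hx hk0
        nlinarith [mul_le_mul_of_nonneg_left hPL hε.le]
      refine max_le (h4 _ ?_) (h4 _ ?_)
      · linarith [hQR wt₁ h₁, (le_max_left _ _).trans h3]
      · linarith [hQR wt₂ h₂, (le_max_right _ _).trans h3]
    intro P hPE hPw hPn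
    have hL₁ : (W₁ + W₂) / 2 ≤ max (P.map wt₁).sum (P.map wt₂).sum := by
      linarith [hm₀ P hPE hPw hPn, le_max_left (P.map wt₁).sum (P.map wt₂).sum,
        le_max_right (P.map wt₁).sum (P.map wt₂).sum]
    -- A competitor heavier than `U` may be outside the budget, but then the initial path is a
    -- better competitor that is inside.
    by_cases hPU : max (P.map wt₁).sum (P.map wt₂).sum ≤ max W₁ W₂
    · exact hmax P hPE hPw hPn hPU hL₁
    · refine (hmax R₀ hR₀E hR₀w hR₀n le_rfl ?_).trans
        (mul_le_mul_of_nonneg_left (not_le.1 hPU).le (by linarith))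
      linarith [le_max_left W₁ W₂, le_max_right W₁ W₂]

end

/-! ### The open shop algorithm -/

section Shop

/-- Processing time on the first machine. -/
def pt₁ (j : arcTy.den) : ℚ := j.2.2.2.1
/-- Processing time on the second machine. -/
def pt₂ (j : arcTy.den) : ℚ := j.2.2.2.2
/-- The dummy job. -/
def dummyJob : arcTy.den := (-1, 0, 0, 0, 0)

variable {α : Type} (f g : α → ℚ)

/-- The schedule without idle time, from the times `x` and `y`. -/
def lay : List α → ℚ → ℚ → List (α × ℚ × ℚ)
  | [], _, _ => []
  | j :: J, x, y => (j, x, y) :: lay J (x + f j) (y + g j)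

/-- A feasible open shop schedule with processing times `f` and `g`, with makespan at most `C`. -/
structure Feas (σ : List (α × ℚ × ℚ)) (C : ℚ) : Prop where
  pw : σ.Pairwise fun a b => (a.2.1 + f a.1 ≤ b.2.1 ∨ b.2.1 + f b.1 ≤ a.2.1) ∧
    (a.2.2 + g a.1 ≤ b.2.2 ∨ b.2.2 + g b.1 ≤ a.2.2)
  each : ∀ a ∈ σ, 0 ≤ a.2.1 ∧ 0 ≤ a.2.2 ∧ a.2.1 + f a.1 ≤ C ∧ a.2.2 + g a.1 ≤ C ∧
    (a.2.1 + f a.1 ≤ a.2.2 ∨ a.2.2 + g a.1 ≤ a.2.1)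

variable {f g}

theorem map_fst_lay : ∀ (J : List α) (x y : ℚ), (lay f g J x y).map Prod.fst = J
  | [], _, _ => rfl
  | j :: J, x, y => by simp [lay, map_fst_lay J]

theorem lay_swap : ∀ (J : List α) (x y : ℚ),
    (lay f g J x y).map (fun a => (a.1, a.2.2, a.2.1)) = lay g f J y x
  | [], _, _ => rfl
  | j :: J, x, y => by simp [lay, lay_swap J]

theorem mem_lay : ∀ {J : List α} {x y : ℚ} {a : α × ℚ × ℚ}, a ∈ lay f g J x y →
    ∃ J₁ J₂, J = J₁ ++ a.1 :: J₂ ∧ a.2.1 = x + (J₁.map f).sum ∧ a.2.2 = y + (J₁.map g).sum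
  | [], _, _, _, h => by simp [lay] at h
  | j :: J, x, y, a, h => by
    rcases List.mem_cons.1 h with rfl | h
    · exact ⟨[], J, by simp⟩
    · obtain ⟨J₁, J₂, h1, h2, h3⟩ := mem_lay h
      exact ⟨j :: J₁, J₂, by simp [h1], by simp [h2, add_assoc], by simp [h3, add_assoc]⟩

theorem lay_pairwise : ∀ {J : List α} {x y : ℚ}, (∀ j ∈ J, 0 ≤ f j ∧ 0 ≤ g j) →
    (lay f g J x y).Pairwise fun a b => a.2.1 + f a.1 ≤ b.2.1 ∧ a.2.2 + g a.1 ≤ b.2.2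
  | [], _, _, _ => List.Pairwise.nil
  | j :: J, x, y, h => by
    refine List.Pairwise.cons ?_ (lay_pairwise fun k hk => h k (by simp [hk]))
    intro a ha
    obtain ⟨J₁, J₂, h1, h2, h3⟩ := mem_lay ha
    have : ∀ k ∈ J₁, 0 ≤ f k ∧ 0 ≤ g k := fun k hk => h k (by simp [h1, hk])
    have h4 := sum_map_nonneg fun k hk => (this k hk).1
    have h5 := sum_map_nonneg fun k hk => (this k hk).2
    simp only
    constructor <;> linarith

/-- Exchanging the machines reduces the second case of the algorithm to the first. -/
theorem Feas.swap {σ : List (α × ℚ × ℚ)} {C : ℚ} (h : Feas f g σ C) :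
    Feas g f (σ.map fun a => (a.1, a.2.2, a.2.1)) C where
  pw := by
    rw [List.pairwise_map]
    exact h.pw.imp fun h => ⟨h.2, h.1⟩
  each a ha := by
    obtain ⟨b, hb, rfl⟩ := List.mem_map.1 ha
    obtain ⟨h1, h2, h3, h4, h5⟩ := h.each b hb
    exact ⟨h2, h1, h4, h3, h5.symm⟩

theorem Feas.filter {σ : List (α × ℚ × ℚ)} {C : ℚ} (h : Feas f g σ C) (p : α × ℚ × ℚ → Bool) :
    Feas f g (σ.filter p) C :=
  ⟨h.pw.filter _, fun a ha => h.each a (List.mem_of_mem_filter ha)⟩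

/-- The schedule of Gonzalez and Sahni is feasible. -/
theorem gonzalezSahni_feas {r l : α} {A B : List α} (h0 : ∀ j ∈ r :: l :: (B ++ A), 0 ≤ f j ∧ 0 ≤ g j)
    (hA : ∀ a ∈ r :: A, g a ≤ f a ∧ f a ≤ f r) (hB : ∀ b ∈ l :: B, f b ≤ g b ∧ g b ≤ g l)
    {T₁ T₂ : ℚ} (hT₁ : T₁ = f r + f l + (B.map f).sum + (A.map f).sum)
    (hT₂ : T₂ = g r + g l + (B.map g).sum + (A.map g).sum) (h : T₂ - g r ≤ T₁ - f l) :
    Feas f g ((r, max (T₁ - f r) (g r), 0) ::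
        (lay f g (l :: (B ++ A)) 0 (max (g r) (T₁ - T₂ + g r))).reverse)
      (max (max T₁ T₂) (f r + g r)) := by
  have hr := h0 r (by simp)
  have hl := h0 l (by simp)
  have h0' : ∀ j ∈ l :: (B ++ A), 0 ≤ f j ∧ 0 ≤ g j := fun j hj =>
    h0 j (List.mem_cons_of_mem _ hj)
  set y := max (g r) (T₁ - T₂ + g r) with hy
  have hy1 : g r ≤ y := le_max_left _ _
  have hy2 : T₁ - T₂ + g r ≤ y := le_max_right _ _
  have hy3 : y + (T₂ - g r) ≤ max T₁ T₂ := by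
    rw [hy, max_def]
    split_ifs
    · linarith [le_max_left T₁ T₂]
    · linarith [le_max_right T₁ T₂]
  have key : ∀ J₁ j J₂, l :: (B ++ A) = J₁ ++ j :: J₂ →
      (J₁.map f).sum + f j ≤ y + (J₁.map g).sum ∧ (J₁.map f).sum + f j ≤ T₁ - f r ∧
      (J₁.map g).sum + g j ≤ T₂ - g r ∧ 0 ≤ (J₁.map f).sum ∧ 0 ≤ (J₁.map g).sum := by
    intro J₁ j J₂ hJ
    have e1 := congrArg (fun L => (L.map f).sum) hJ
    have e2 := congrArg (fun L => (L.map g).sum) hJ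
    simp only [List.map_cons, List.map_append, List.sum_cons, List.sum_append] at e1 e2
    have n1 : ∀ k ∈ J₁, 0 ≤ f k ∧ 0 ≤ g k := fun k hk => h0' k (by rw [hJ]; simp [hk])
    have n2 : ∀ k ∈ J₂, 0 ≤ f k ∧ 0 ≤ g k := fun k hk => h0' k (by rw [hJ]; simp [hk])
    have s1 := sum_map_nonneg fun k hk => (n1 k hk).1
    have s2 := sum_map_nonneg fun k hk => (n1 k hk).2
    have s3 := sum_map_nonneg fun k hk => (n2 k hk).1
    have s4 := sum_map_nonneg fun k hk => (n2 k hk).2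
    refine ⟨?_, by linarith, by linarith, s1, s2⟩
    match J₁, hJ with
    | [], hJ =>
      -- For the first job, `f l ≤ T₁ - T₂ + g r ≤ y` is the case assumption `h`.
      obtain rfl : l = j := (List.cons.inj hJ).1
      simp only [List.map_nil, List.sum_nil, add_zero, zero_add]
      linarith
    | b :: J₁, hJ =>
      obtain ⟨rfl, hJ'⟩ := List.cons.inj hJ
      simp only [List.map_cons, List.sum_cons] at e1 e2 s1 s2 ⊢
      -- If `j` lies in `A`, count from the end: with `y ≥ T₁ - T₂ + g r` it remains to see `g j + ∑
      -- g ≤ f r + ∑ f` over the later jobs. This holds since `g ≤ f` on `A` and `g j ≤ f j ≤ f r`.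
      rcases List.append_eq_append_iff.1 hJ' with ⟨A', h1, h2⟩ | ⟨B', h1, h2⟩
      · have hj : j ∈ A := by rw [h2]; simp
        have hsub : ∀ k ∈ J₂, g k ≤ f k := fun k hk =>
          (hA k (by rw [h2]; simp [hk])).1
        have s5 : (J₂.map g).sum ≤ (J₂.map f).sum := List.sum_le_sum hsub
        have := hA j (by simp [hj])
        linarith
      · match B', h2 with
        | [], h2 =>
          have hj : j ∈ A := by
            rw [List.nil_append] at h2; rw [← h2]; simp
          have hsub : ∀ k ∈ J₂, g k ≤ f k := fun k hk =>
            (hA k (by rw [List.nil_append] at h2; rw [← h2]; simp [hk])).1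
          have s5 : (J₂.map g).sum ≤ (J₂.map f).sum := List.sum_le_sum hsub
          have := hA j (by simp [hj])
          linarith
        | c :: B', h2 =>
          obtain rfl : j = c := (List.cons.inj h2).1
          -- If `j` lies in `B`, count from the start: `f l ≤ y` by `h`, `f j ≤ g j ≤ g l`, and `f ≤
          -- g` on the jobs between `l` and `j`.
          have hsub : ∀ k ∈ J₁, f k ≤ g k := fun k hk => (hB k (by rw [h1]; simp [hk])).1
          have s5 : (J₁.map f).sum ≤ (J₁.map g).sum := List.sum_le_sum hsub
          have := hB j (by rw [h1]; simp)
          linarith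
  have hlay : ∀ a ∈ lay f g (l :: (B ++ A)) 0 y, 0 ≤ a.2.1 ∧ y ≤ a.2.2 ∧
      a.2.1 + f a.1 ≤ T₁ - f r ∧ a.2.2 + g a.1 ≤ max T₁ T₂ ∧ a.2.1 + f a.1 ≤ a.2.2 := by
    intro a ha
    obtain ⟨J₁, J₂, h1, h2, h3⟩ := mem_lay ha
    obtain ⟨k1, k2, k3, k4, k5⟩ := key J₁ a.1 J₂ h1
    rw [h2, h3]
    refine ⟨by linarith, by linarith, by linarith, by linarith, by linarith⟩
  have hm1 : max T₁ T₂ ≤ max (max T₁ T₂) (f r + g r) := le_max_left _ _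
  have hm2 : f r + g r ≤ max (max T₁ T₂) (f r + g r) := le_max_right _ _
  have hm3 := le_max_left T₁ T₂
  have hm4 := le_max_left (T₁ - f r) (g r)
  have hm5 := le_max_right (T₁ - f r) (g r)
  refine ⟨List.Pairwise.cons ?_ ?_, ?_⟩
  · intro a ha
    obtain ⟨k1, k2, k3, k4, k5⟩ := hlay a (List.mem_reverse.1 ha)
    exact ⟨Or.inr (k3.trans hm4), Or.inl (by simpa only [zero_add] using hy1.trans k2)⟩
  · rw [List.pairwise_reverse]
    exact (lay_pairwise h0').imp fun h => ⟨Or.inr h.1, Or.inr h.2⟩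
  · intro a ha
    rcases List.mem_cons.1 ha with rfl | ha
    · refine ⟨hr.2.trans hm5, le_rfl, ?_, by simp only; linarith, Or.inr (by simp)⟩
      simp only
      rcases max_choice (T₁ - f r) (g r) with h | h <;> rw [h] <;> linarith
    · obtain ⟨k1, k2, k3, k4, k5⟩ := hlay a (List.mem_reverse.1 ha)
      exact ⟨k1, by linarith, by linarith, by linarith, Or.inl k5⟩

theorem val_layout (J : Tm Ty.den (.list arcTy)) (x y : Tm Ty.den .num) :
    (layout J x y).val = (lay pt₁ pt₂ J.val x.val y.val).reverse := by
  have H : ∀ (J : List arcTy.den) (r : List entryTy.den) (x y : ℚ),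
      (J.foldl (fun (st : List entryTy.den × ℚ × ℚ) j =>
        ((j, st.2.1, st.2.2) :: st.1, st.2.1 + pt₁ j, st.2.2 + pt₂ j)) (r, x, y)).1
        = (lay pt₁ pt₂ J x y).reverse ++ r := by
    intro J
    induction J with
    | nil => intro r x y; rfl
    | cons j J ih => intro r x y; rw [List.foldl_cons, ih]; simp [lay]
  rw [layout, val_fst, val_loop]
  exact (H J.val [] x.val y.val).trans (List.append_nil _)

/-- A step of the partition of the jobs. -/
def splitStep (x : (List arcTy.den × List arcTy.den) × arcTy.den × arcTy.den) (j : arcTy.den) :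
    (List arcTy.den × List arcTy.den) × arcTy.den × arcTy.den :=
  if pt₂ j ≤ pt₁ j then
    if pt₁ x.2.1 ≤ pt₁ j then ((x.2.1 :: x.1.1, x.1.2), (j, x.2.2))
    else ((j :: x.1.1, x.1.2), (x.2.1, x.2.2))
  else
    if pt₂ x.2.2 ≤ pt₂ j then ((x.1.1, x.2.2 :: x.1.2), (x.2.1, j))
    else ((x.1.1, j :: x.1.2), (x.2.1, x.2.2))

theorem val_gsSplit (J : Tm Ty.den (.list arcTy)) : (gsSplit J).val =
    J.val.foldl splitStep (([], []), (dummyJob, dummyJob)) := by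
  rw [gsSplit, val_loop]
  have : ∀ (l : List arcTy.den) (F G : (List arcTy.den × List arcTy.den) × arcTy.den × arcTy.den →
      arcTy.den → (List arcTy.den × List arcTy.den) × arcTy.den × arcTy.den) i, F = G →
      l.foldl F i = l.foldl G i := by rintro l F G i rfl; rfl
  refine this _ _ _ _ ?_
  funext x j
  simp only [splitStep, pt₁, pt₂, val_lets, val_cond, val_le, val_var, val_fst, val_snd, val_pair,
    val_cons, p₁, p₂, decide_eq_true_eq]
  rfl

/-- The two dummies start as `r` and `l` and are pushed into the lists when displaced, so they never
vanish. Counting them makes `perm` an exact invariant without case distinctions on empty classes. -/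
structure Split (J : List arcTy.den)
    (x : (List arcTy.den × List arcTy.den) × arcTy.den × arcTy.den) : Prop where
  perm : (x.2.1 :: x.2.2 :: (x.1.2 ++ x.1.1)).Perm (dummyJob :: dummyJob :: J)
  A : ∀ a ∈ x.2.1 :: x.1.1, pt₂ a ≤ pt₁ a ∧ pt₁ a ≤ pt₁ x.2.1
  B : ∀ b ∈ x.2.2 :: x.1.2, pt₁ b ≤ pt₂ b ∧ pt₂ b ≤ pt₂ x.2.2

theorem split_spec (J : List arcTy.den) :
    Split J (J.foldl splitStep (([], []), (dummyJob, dummyJob))) := by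
  induction J using List.reverseRecOn with
  | nil => exact ⟨List.Perm.refl _, by simp [dummyJob, pt₁, pt₂], by simp [dummyJob, pt₁, pt₂]⟩
  | append_singleton J j ih =>
    simp only [List.foldl_append, List.foldl_cons, List.foldl_nil]
    generalize J.foldl splitStep (([], []), (dummyJob, dummyJob)) = x at ih ⊢
    obtain ⟨⟨A, B⟩, r, l⟩ := x
    obtain ⟨h1, h2, h3⟩ := ih
    simp only at h1 h2 h3
    have h4 : (dummyJob :: dummyJob :: (J ++ [j])).Perm (j :: r :: l :: (B ++ A)) := by
      have : (dummyJob :: dummyJob :: (J ++ [j])).Perm (j :: dummyJob :: dummyJob :: J) := by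
        rw [← List.singleton_append (l := dummyJob :: dummyJob :: J)]
        exact (List.perm_append_comm (l₁ := dummyJob :: dummyJob :: J) (l₂ := [j]))
      exact this.trans (h1.symm.cons j)
    unfold splitStep
    simp only
    split_ifs with c1 c2 c3
    · refine ⟨?_, ?_, h3⟩
      · refine List.Perm.trans ?_ h4.symm
        simp only
        rw [List.perm_iff_count]
        intro z; simp only [List.count_cons, List.count_append]; omega
      · intro a ha
        rcases List.mem_cons.1 ha with rfl | ha
        · exact ⟨c1, le_rfl⟩
        · exact ⟨(h2 a ha).1, (h2 a ha).2.trans c2⟩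
    · refine ⟨?_, ?_, h3⟩
      · refine List.Perm.trans ?_ h4.symm
        simp only
        rw [List.perm_iff_count]
        intro z; simp only [List.count_cons, List.count_append]; omega
      · intro a ha
        simp only [List.mem_cons] at ha
        rcases ha with rfl | rfl | ha
        · exact h2 _ (by simp)
        · exact ⟨c1, (not_le.1 c2).le⟩
        · exact h2 a (by simp [ha])
    · refine ⟨?_, h2, ?_⟩
      · refine List.Perm.trans ?_ h4.symm
        simp only
        rw [List.perm_iff_count]
        intro z; simp only [List.count_cons, List.count_append]; omega
      · intro a ha
        rcases List.mem_cons.1 ha with rfl | ha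
        · exact ⟨(not_le.1 c1).le, le_rfl⟩
        · exact ⟨(h3 a ha).1, (h3 a ha).2.trans c3⟩
    · refine ⟨?_, h2, ?_⟩
      · refine List.Perm.trans ?_ h4.symm
        simp only
        rw [List.perm_iff_count]
        intro z; simp only [List.count_cons, List.count_append]; omega
      · intro a ha
        simp only [List.mem_cons] at ha
        rcases ha with rfl | rfl | ha
        · exact h3 _ (by simp)
        · exact ⟨(not_le.1 c1).le, (not_le.1 (by assumption)).le⟩
        · exact h3 a (by simp [ha])

/-- The largest completion time. -/
def completion (σ : List entryTy.den) : ℚ :=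
  σ.foldl (fun C x => max C (max (x.2.1 + pt₁ x.1) (x.2.2 + pt₂ x.1))) 0

theorem completion_le {σ : List entryTy.den} {C : ℚ} (hC : 0 ≤ C)
    (h : ∀ x ∈ σ, max (x.2.1 + pt₁ x.1) (x.2.2 + pt₂ x.1) ≤ C) : completion σ ≤ C := by
  induction σ using List.reverseRecOn with
  | nil => exact hC
  | append_singleton σ x ih =>
    rw [completion, List.foldl_append]
    exact max_le (ih fun y hy => h y (by simp [hy])) (h x (by simp))

/-- The schedule computed by the algorithm, before the dummy jobs are removed. -/
def gsEntries (J : List arcTy.den) : List entryTy.den :=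
  let x := J.foldl splitStep (([], []), (dummyJob, dummyJob))
  let r := x.2.1
  let l := x.2.2
  let T₁ := (J.map pt₁).sum
  let T₂ := (J.map pt₂).sum
  if T₂ - pt₂ r ≤ T₁ - pt₁ l then
    (r, max (T₁ - pt₁ r) (pt₂ r), 0) ::
      (lay pt₁ pt₂ (l :: (x.1.2 ++ x.1.1)) 0 (max (pt₂ r) (T₁ - T₂ + pt₂ r))).reverse
  else
    (l, 0, max (T₂ - pt₂ l) (pt₁ l)) ::
      (lay pt₁ pt₂ (r :: (x.1.1 ++ x.1.2)) (max (pt₁ l) (T₂ - T₁ + pt₁ l)) 0).reverse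

theorem val_gs (J : Tm Ty.den (.list arcTy)) : (gs J).val =
    ((gsEntries J.val).filter (fun x => decide (0 ≤ x.1.1)),
      completion ((gsEntries J.val).filter (fun x => decide (0 ≤ x.1.1)))) := by
  have h1 : ∀ P : List arcTy.den, (sumOf (.var P) p₁).val = (P.map pt₁).sum := fun P => by
    rw [val_sumOf]; rfl
  have h2 : ∀ P : List arcTy.den, (sumOf (.var P) p₂).val = (P.map pt₂).sum := fun P => by
    rw [val_sumOf]; rfl
  have h3 : ∀ (σ : List entryTy.den), (loop (.var σ) (.lit 0) fun C x =>
      maxOf C (maxOf (start₁ x + p₁ x.fst) (start₂ x + p₂ x.fst))).val = completion σ := by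
    intro σ
    rw [val_loop, completion]
    congr 1
    funext C x
    simp only [val_maxOf, val_add, start₁, start₂, p₁, p₂, val_fst, val_snd, val_var, pt₁, pt₂]
  simp only [gs, val_lets, h1, h2, h3, val_pair, val_filter]
  have h4 : ∀ (c : Tm Ty.den .bool) (x y : Tm Ty.den (.list entryTy)) , (Tm.cond c x y).val
      = if @Eq Bool c.val true then x.val else y.val := fun c x y => val_cond c x y
  have h5 : ∀ x : arcTy.den, (p₁ (.var x)).val = pt₁ x := fun _ => rfl
  have h6 : ∀ x : arcTy.den, (p₂ (.var x)).val = pt₂ x := fun _ => rfl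
  have : ∀ σ σ' : List entryTy.den, σ = σ' →
      (σ.filter (fun x => (Tm.le (.lit 0) (jobId (Tm.fst (.var x)))).val),
        completion (σ.filter (fun x => (Tm.le (.lit 0) (jobId (Tm.fst (.var x)))).val)))
      = (σ'.filter (fun x => decide (0 ≤ x.1.1)),
        completion (σ'.filter (fun x => decide (0 ≤ x.1.1)))) := by
    rintro σ _ rfl; rfl
  refine this _ _ ?_
  simp only [gsEntries, val_cond, val_le, val_sub, val_add, val_cons, mkEntry, val_pair, val_var,
    val_maxOf, val_layout, val_append, h5, h6, val_lit, decide_eq_true_eq, val_gsSplit, val_fst,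
    val_snd]

theorem le_completion : ∀ {σ : List entryTy.den}, 0 ≤ completion σ ∧
    ∀ x ∈ σ, max (x.2.1 + pt₁ x.1) (x.2.2 + pt₂ x.1) ≤ completion σ := by
  intro σ
  induction σ using List.reverseRecOn with
  | nil => exact ⟨le_rfl, by simp⟩
  | append_singleton σ x ih =>
    have : completion (σ ++ [x])
        = max (completion σ) (max (x.2.1 + pt₁ x.1) (x.2.2 + pt₂ x.1)) := by
      rw [completion, List.foldl_append]; rfl
    rw [this]
    refine ⟨ih.1.trans (le_max_left _ _), ?_⟩
    intro y hy
    rcases List.mem_append.1 hy with hy | hy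
    · exact (ih.2 y hy).trans (le_max_left _ _)
    · obtain rfl := List.mem_singleton.1 hy
      exact le_max_right _ _

/-- The makespan bound is the larger load or the length of the special job `r` or `l`. If that job
is a dummy, its length is zero and the load alone remains. -/
theorem gsEntries_spec (J : List arcTy.den) (h0 : ∀ j ∈ J, 0 ≤ pt₁ j ∧ 0 ≤ pt₂ j) :
    ∃ C, Feas pt₁ pt₂ (gsEntries J) C ∧
      ((gsEntries J).map Prod.fst).Perm (dummyJob :: dummyJob :: J) ∧ 0 ≤ C ∧
      (C ≤ max (J.map pt₁).sum (J.map pt₂).sum ∨ ∃ j ∈ J, C ≤ pt₁ j + pt₂ j) := by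
  obtain ⟨hp, hA, hB⟩ := split_spec J
  unfold gsEntries
  generalize J.foldl splitStep (([], []), (dummyJob, dummyJob)) = x at *
  obtain ⟨⟨A, B⟩, r, l⟩ := x
  simp only at hp hA hB ⊢
  have hd : ∀ j ∈ r :: l :: (B ++ A), j = dummyJob ∨ j ∈ J := fun j hj => by
    have := hp.subset hj
    simp only [List.mem_cons] at this
    tauto
  have h0' : ∀ j ∈ r :: l :: (B ++ A), 0 ≤ pt₁ j ∧ 0 ≤ pt₂ j := fun j hj => by
    rcases hd j hj with rfl | hj
    · simp [dummyJob, pt₁, pt₂]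
    · exact h0 j hj
  have e1 := (hp.map pt₁).sum_eq
  have e2 := (hp.map pt₂).sum_eq
  have d1 : pt₁ dummyJob = 0 := rfl
  have d2 : pt₂ dummyJob = 0 := rfl
  simp only [List.map_cons, List.map_append, List.sum_cons, List.sum_append, d1, d2] at e1 e2
  have n1 := sum_map_nonneg fun k hk => (h0 k hk).1
  have n2 := sum_map_nonneg fun k hk => (h0 k hk).2
  set T₁ := (J.map pt₁).sum
  set T₂ := (J.map pt₂).sum
  have hC : ∀ j ∈ r :: l :: (B ++ A), ∀ C, C ≤ max (max T₁ T₂) (pt₁ j + pt₂ j) →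
      C ≤ max T₁ T₂ ∨ ∃ j ∈ J, C ≤ pt₁ j + pt₂ j := by
    intro j hj C hC
    rcases hd j hj with rfl | hj
    · rw [d1, d2, add_zero, max_eq_left (n1.trans (le_max_left _ _))] at hC
      exact Or.inl hC
    · rcases le_max_iff.1 hC with h | h
      · exact Or.inl h
      · exact Or.inr ⟨j, hj, h⟩
  split_ifs with hc
  · refine ⟨_, gonzalezSahni_feas h0' hA hB (by linarith) (by linarith) hc, ?_,
      (n1.trans (le_max_left _ _)).trans (le_max_left _ _), hC r (by simp) _ le_rfl⟩
    rw [List.map_cons, List.map_reverse, map_fst_lay]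
    exact ((List.reverse_perm _).cons r).trans hp
  -- The other case is the mirror image: exchange the machines, `r` with `l`, and `A` with `B`. The
  -- negation of the test supplies the required inequality.
  · have hf := gonzalezSahni_feas (f := pt₂) (g := pt₁) (r := l) (l := r) (A := B) (B := A)
      (T₁ := T₂) (T₂ := T₁) (fun j hj => (h0' j (by
        simp only [List.mem_cons, List.mem_append] at hj ⊢; tauto)).symm) hB hA (by linarith)
      (by linarith) (by linarith)
    have := hf.swap
    rw [List.map_cons, List.map_reverse, lay_swap] at this
    refine ⟨_, this, ?_, (n1.trans (le_max_right _ _)).trans (le_max_left _ _),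
      hC l (by simp) _ (by rw [max_comm T₁, add_comm])⟩
    rw [List.map_cons, List.map_reverse, map_fst_lay]
    refine ((List.reverse_perm _).cons l).trans (List.Perm.trans ?_ hp)
    rw [List.perm_iff_count]
    intro z; simp only [List.count_cons, List.count_append]; omega

/-- Dummies have number `-1` and real jobs nonnegative numbers, so the filter removes precisely the
dummies; deleting entries keeps the schedule feasible and cannot raise the makespan. -/
theorem gs_spec (J : Tm Ty.den (.list arcTy)) (h0 : ∀ j ∈ J.val, 0 ≤ pt₁ j ∧ 0 ≤ pt₂ j)
    (hid : ∀ j ∈ J.val, 0 ≤ j.1) :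
    ∃ σ : List entryTy.den, (gs J).val = (σ, completion σ) ∧ (σ.map Prod.fst).Perm J.val ∧
      Feas pt₁ pt₂ σ (completion σ) ∧ (completion σ ≤ max (J.val.map pt₁).sum (J.val.map pt₂).sum ∨
        ∃ j ∈ J.val, completion σ ≤ pt₁ j + pt₂ j) := by
  refine ⟨_, val_gs J, ?_⟩
  obtain ⟨C, hF, hp, hC0, hC⟩ := gsEntries_spec J.val h0
  have hF' := hF.filter fun x => decide (0 ≤ x.1.1)
  set σ := (gsEntries J.val).filter fun x => decide (0 ≤ x.1.1) with hσ
  have hle : completion σ ≤ C := completion_le hC0 fun x hx => by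
    obtain ⟨-, -, h1, h2, -⟩ := hF'.each x hx
    exact max_le h1 h2
  refine ⟨?_, ⟨hF'.pw, ?_⟩, ?_⟩
  · have h1 := hp.filter fun j => decide (0 ≤ j.1)
    have h2 : (dummyJob :: dummyJob :: J.val).filter (fun j => decide (0 ≤ j.1)) = J.val := by
      have hd : ¬ (0 : ℚ) ≤ dummyJob.1 := by simp [dummyJob]
      rw [List.filter_cons_of_neg (by simpa using hd), List.filter_cons_of_neg (by simpa using hd),
        List.filter_eq_self]
      simpa using hid
    rw [h2, List.filter_map] at h1
    exact h1
  · intro a ha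
    obtain ⟨h1, h2, -, -, h3⟩ := hF'.each a ha
    have := le_completion.2 a ha
    exact ⟨h1, h2, (le_max_left _ _).trans this, (le_max_right _ _).trans this, h3⟩
  · rcases hC with h | ⟨j, hj, h⟩
    · exact Or.inl (hle.trans h)
    · exact Or.inr ⟨j, hj, hle.trans h⟩

end Shop

/-! ### Instances and their encodings -/

section Encoding

variable (I : Inst)

/-- The record of the arc `j`. -/
def enc (j : Fin I.numA) : arcTy.den :=
  (((j : ℕ) : ℚ), ((I.tail j : ℕ) : ℚ), ((I.head j : ℕ) : ℚ), I.p 0 j, I.p 1 j)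

/-- The weighted arc `j`, where the weights of the marked arcs are `M`. -/
def mkArc (M : ℚ) (mark : Fin I.numA → Bool) (j : Fin I.numA) : warcTy.den :=
  (enc I j, if mark j then (M, M) else (I.p 0 j, I.p 1 j), mark j)

/-- All weighted arcs. -/
def arcs (M : ℚ) (mark : Fin I.numA → Bool) : List warcTy.den :=
  (List.finRange I.numA).map (mkArc I M mark)

variable {I} {M : ℚ} {mark : Fin I.numA → Bool}

theorem enc_injective : Function.Injective (enc I) := fun i j h => by
  have := congrArg Prod.fst h
  simp only [enc, Nat.cast_inj] at this
  exact Fin.ext this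

theorem isWalk_append {u v : Fin I.numV} {P : List (Fin I.numA)} {e : Fin I.numA} :
    I.IsWalk u (P ++ [e]) v ↔ I.IsWalk u P (I.tail e) ∧ I.head e = v := by
  induction P generalizing u with
  | nil => simp [Inst.IsWalk, eq_comm]
  | cons f P ih => simp [Inst.IsWalk, ih, and_assoc]

theorem natCast_fin_inj {n : ℕ} {u v : Fin n} : ((u : ℕ) : ℚ) = ((v : ℕ) : ℚ) ↔ u = v := by
  rw [Nat.cast_inj, Fin.val_inj]

theorem rwalk_iff {s : Fin I.numV} : ∀ {P : List (Fin I.numA)} {v : Fin I.numV},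
    RWalk wtail whead ((s : ℕ) : ℚ) (P.map (mkArc I M mark)) ((v : ℕ) : ℚ)
      ↔ I.IsWalk s P.reverse v
  | [], v => by simp [RWalk, Inst.IsWalk, Fin.val_inj, eq_comm]
  | e :: P, v => by
    rw [List.reverse_cons, isWalk_append, ← rwalk_iff (P := P), List.map_cons, RWalk, and_comm]
    refine and_congr Iff.rfl ?_
    exact natCast_fin_inj

theorem simple_iff {s : Fin I.numV} {P : List (Fin I.numA)} :
    (((s : ℕ) : ℚ) :: (P.map (mkArc I M mark)).map whead).Nodup
      ↔ (s :: P.reverse.map I.head).Nodup := by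
  have h : ((s : ℕ) : ℚ) :: (P.map (mkArc I M mark)).map whead
      = (s :: P.map I.head).map (fun v : Fin I.numV => ((v : ℕ) : ℚ)) := by
    simp [whead, mkArc, enc, Function.comp_def]
  rw [h, List.nodup_map_iff (fun u v h => natCast_fin_inj.1 h)]
  simp

/-- Tails and heads do not depend on weights and marks, so `M` and `mark` are arbitrary here; the
list is reversed because labels store the last arc first. -/
theorem isPath_iff {P : List (Fin I.numA)} :
    I.IsPath P ↔
      RWalk wtail whead ((I.s : ℕ) : ℚ) (P.reverse.map (mkArc I M mark)) ((I.t : ℕ) : ℚ) ∧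
      (((I.s : ℕ) : ℚ) :: (P.reverse.map (mkArc I M mark)).map whead).Nodup := by
  rw [rwalk_iff, simple_iff, List.reverse_reverse]; rfl

theorem Inst.IsPath.nodup {P : List (Fin I.numA)} (h : I.IsPath P) : P.Nodup :=
  List.Nodup.of_map _ (List.nodup_cons.1 h.2).2

theorem map_mkArc_subset (P : List (Fin I.numA)) : P.map (mkArc I M mark) ⊆ arcs I M mark :=
  List.map_subset _ fun j _ => List.mem_finRange j

theorem exists_of_subset_arcs {R : List warcTy.den} (h : R ⊆ arcs I M mark) :
    ∃ P : List (Fin I.numA), R = P.map (mkArc I M mark) := by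
  induction R with
  | nil => exact ⟨[], rfl⟩
  | cons e R ih =>
    obtain ⟨he, hR⟩ := List.cons_subset.1 h
    obtain ⟨P, rfl⟩ := ih hR
    obtain ⟨j, -, rfl⟩ := List.mem_map.1 he
    exact ⟨j :: P, rfl⟩

end Encoding

/-! ### Lower bounds for the makespan -/

section LowerBound

/-- Remove the last job: all other jobs end by its start, so induction applies with that start in
place of `C`. -/
theorem sum_le_of_disjoint {ι : Type*} {a p : ι → ℝ} {C : ℝ} (hC : 0 ≤ C) (S : Finset ι) :
    (∀ j ∈ S, 0 ≤ a j) → (∀ j ∈ S, 0 ≤ p j) →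
    (∀ j ∈ S, ∀ k ∈ S, j ≠ k → a j + p j ≤ a k ∨ a k + p k ≤ a j) →
    (∀ j ∈ S, a j + p j ≤ C) → ∑ j ∈ S, p j ≤ C := by
  classical
  induction hn : S.card generalizing S C with
  | zero =>
    obtain rfl := Finset.card_eq_zero.1 hn
    exact fun _ _ _ _ => by simpa using hC
  | succ n ih =>
    intro ha hp hd hle
    -- The last job is the one with the latest midpoint. Ordering by start or by completion alone
    -- would leave ties with jobs of length zero.
    obtain ⟨j, hj, hmax⟩ := S.exists_max_image (fun j => a j + (a j + p j))
      (Finset.card_pos.1 (by omega))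
    rw [← Finset.add_sum_erase _ _ hj]
    have := ih (C := a j) (ha j hj) (S.erase j) (by rw [Finset.card_erase_of_mem hj]; omega)
      (fun k hk => ha k (Finset.mem_of_mem_erase hk)) (fun k hk => hp k (Finset.mem_of_mem_erase hk))
      (fun k hk l hl => hd k (Finset.mem_of_mem_erase hk) l (Finset.mem_of_mem_erase hl))
      (fun k hk => by
        have hk' := Finset.mem_of_mem_erase hk
        have h1 := hmax k hk'
        have h2 := hp k hk'
        have h3 := hp j hj
        rcases hd j hj k hk' (Finset.ne_of_mem_erase hk).symm with h | h <;> linarith)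
    have := hle j hj
    linarith

variable {I : Inst} {P : List (Fin I.numA)} {start : Fin 2 → Fin I.numA → ℝ}

theorem foldr_max_spec {l : List ℝ} : 0 ≤ l.foldr max 0 ∧ (∀ x ∈ l, x ≤ l.foldr max 0) ∧
    ∀ C, 0 ≤ C → (∀ x ∈ l, x ≤ C) → l.foldr max 0 ≤ C := by
  induction l with
  | nil => simp
  | cons y l ih =>
    refine ⟨ih.1.trans (le_max_right _ _), ?_, ?_⟩
    · intro x hx
      rcases List.mem_cons.1 hx with rfl | hx
      · exact le_max_left _ _
      · exact (ih.2.1 x hx).trans (le_max_right _ _)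
    · intro C hC h
      exact max_le (h y (by simp)) (ih.2.2 C hC fun x hx => h x (by simp [hx]))

theorem makespan_nonneg : 0 ≤ I.makespan P start := foldr_max_spec.1

theorem le_makespan {j : Fin I.numA} (hj : j ∈ P) (i : Fin 2) :
    start i j + (I.p i j : ℝ) ≤ I.makespan P start := by
  have : max (start 0 j + (I.p 0 j : ℝ)) (start 1 j + (I.p 1 j : ℝ)) ≤ I.makespan P start :=
    foldr_max_spec.2.1 _ (List.mem_map.2 ⟨j, hj, rfl⟩)
  fin_cases i
  · exact (le_max_left _ _).trans this
  · exact (le_max_right _ _).trans this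

theorem sum_le_makespan (h : I.IsSchedule P start) (hP : P.Nodup) (i : Fin 2) :
    ((P.map (I.p i)).sum : ℝ) ≤ I.makespan P start := by
  have hn : ∀ j, (0 : ℝ) ≤ I.p i j := fun j => by exact_mod_cast I.p_nonneg i j
  have := sum_le_of_disjoint (a := start i) (p := fun j => (I.p i j : ℝ))
    (makespan_nonneg (P := P) (start := start)) P.toFinset
    (fun j hj => h.nonneg i j (by simpa using hj)) (fun j _ => hn j)
    (fun j hj k hk hjk => h.machine i j (by simpa using hj) k (by simpa using hk) hjk)
    (fun j hj => le_makespan (by simpa using hj) i)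
  rw [List.sum_toFinset _ hP] at this
  refine le_of_eq_of_le ?_ this
  rw [Rat.cast_list_sum, List.map_map]; rfl

theorem job_le_makespan (h : I.IsSchedule P start) {j : Fin I.numA} (hj : j ∈ P) :
    (I.p 0 j : ℝ) + I.p 1 j ≤ I.makespan P start := by
  have h0 := h.nonneg 0 j hj
  have h1 := h.nonneg 1 j hj
  have h2 := le_makespan (start := start) hj 0
  have h3 := le_makespan (start := start) hj 1
  rcases h.job j hj with h | h <;> linarith

end LowerBound

/-! ### The framework -/

section Framework

/-- `x` describes a solution with the path `P`. -/
structure IsSol (I : Inst) (x : solTy.den) (P : List (Fin I.numA)) : Prop where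
  path : I.IsPath P
  arcs : x.1.map Prod.fst = P.map (enc I)
  perm : (x.2.1.map Prod.fst).Perm (P.map (enc I))
  feas : Feas pt₁ pt₂ x.2.1 x.2.2
  comp : x.2.2 = completion x.2.1
  alg : x.2 = (gs (.var (x.1.map Prod.fst))).val

/-- `x` describes a solution obtained for the weights given by `M` and `mark`. -/
structure IsCur (I : Inst) (ε M : ℚ) (mark : Fin I.numA → Bool) (x : solTy.den)
    (P : List (Fin I.numA)) : Prop extends IsSol I x P where
  eq : x.1 = P.map (mkArc I M mark)
  min : ∀ Q, I.IsPath Q → max (P.map fun j => wt₁ (mkArc I M mark j)).sum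
      (P.map fun j => wt₂ (mkArc I M mark j)).sum ≤
    (1 + ε) * max (Q.map fun j => wt₁ (mkArc I M mark j)).sum
      (Q.map fun j => wt₂ (mkArc I M mark j)).sum
  bound : x.2.2 ≤ max (P.map (I.p 0)).sum (P.map (I.p 1)).sum ∨
    ∃ j ∈ P, x.2.2 ≤ I.p 0 j + I.p 1 j

variable {I : Inst} {ε M : ℚ} {mark : Fin I.numA → Bool}

theorem val_solve (inp : Tm Ty.den inputTy) (E : Tm Ty.den (.list warcTy)) :
    (solve gs inp E).val =
      let P : List warcTy.den := (abv (.var inp.val.1) (.var inp.val.2.1) (.var inp.val.2.2.2.1)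
        (.var inp.val.2.2.2.2) E).val
      (P, (gs (.var (P.map Prod.fst))).val) := by
  simp only [solve, val_lets, val_pair, val_fst, val_snd, val_var]
  rw [val_gs, val_gs, val_map]
  rfl

/-- Correctness of one ABV and Gonzalez–Sahni call, translated back to the instance. Nothing is
required of `M` here but nonnegativity; its size matters only at the end of the loop. -/
theorem solve_spec (hI : ∃ P, I.IsPath P) (hε : 0 < ε) (hM : 0 ≤ M) (inp : Tm Ty.den inputTy)
    (E : Tm Ty.den (.list warcTy)) (hinp : inp.val = encode I ε) (hE : E.val = arcs I M mark) :
    ∃ P, IsCur I ε M mark (solve gs inp E).val P := by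
  obtain ⟨P₀, hP₀⟩ := hI
  have hw : ∀ e ∈ arcs I M mark, 0 ≤ wt₁ e ∧ 0 ≤ wt₂ e := by
    intro e he
    obtain ⟨j, -, rfl⟩ := List.mem_map.1 he
    simp only [wt₁, wt₂, mkArc]
    split_ifs
    · exact ⟨hM, hM⟩
    · exact ⟨I.p_nonneg 0 j, I.p_nonneg 1 j⟩
  have hv : ∀ v : Fin I.numV, ((v : ℕ) : ℚ) ∈ (encode I ε).2.1 := fun v =>
    List.mem_map.2 ⟨v, List.mem_finRange v, rfl⟩
  have hvE : ∀ e ∈ arcs I M mark, whead e ∈ (encode I ε).2.1 := by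
    intro e he
    obtain ⟨j, -, rfl⟩ := List.mem_map.1 he
    exact hv (I.head j)
  obtain ⟨hP₀w, hP₀n⟩ := isPath_iff (M := M) (mark := mark).1 hP₀
  obtain ⟨R, hR, hRE, hRw, hRn, hRm⟩ := abv_spec (ε := .var (encode I ε).1)
    (vs := .var (encode I ε).2.1) (s := .var (encode I ε).2.2.2.1) (t := .var (encode I ε).2.2.2.2)
    (E := E) hε (hv I.s) (by rw [hE]; exact hvE) (by rw [hE]; exact fun e he => (hw e he).1)
    (by rw [hE]; exact fun e he => (hw e he).2) (by rw [hE]; exact map_mkArc_subset P₀.reverse)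
    hP₀w hP₀n
  rw [hE] at hRE hRm
  obtain ⟨P, rfl⟩ := exists_of_subset_arcs hRE
  have hsol : (solve gs inp E).val = (P.reverse.map (mkArc I M mark),
      (gs (.var (P.reverse.map (enc I)))).val) := by
    rw [val_solve, hinp, hR, ← List.map_reverse]
    simp only [List.map_map]
    rfl
  have hPath : I.IsPath P.reverse := by
    rw [isPath_iff (M := M) (mark := mark), List.reverse_reverse]
    exact ⟨hRw, hRn⟩
  obtain ⟨σ, hσ, hσp, hσf, hσC⟩ := gs_spec (.var (P.reverse.map (enc I)))
    (fun j hj => by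
      obtain ⟨k, -, rfl⟩ := List.mem_map.1 hj
      exact ⟨I.p_nonneg 0 k, I.p_nonneg 1 k⟩)
    (fun j hj => by
      obtain ⟨k, -, rfl⟩ := List.mem_map.1 hj
      exact Nat.cast_nonneg _)
  have harcs : (P.reverse.map (mkArc I M mark)).map Prod.fst = P.reverse.map (enc I) := by
    simp only [List.map_map]; rfl
  have halg := hσ
  rw [← harcs] at halg
  rw [hsol, hσ]
  simp only [val_var, List.map_map] at hσC hσp
  refine ⟨P.reverse, ⟨⟨hPath, harcs, hσp, hσf, rfl, halg.symm⟩, rfl, ?_, ?_⟩⟩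
  · intro Q hQ
    obtain ⟨hQw, hQn⟩ := isPath_iff (M := M) (mark := mark).1 hQ
    have := hRm _ (map_mkArc_subset Q.reverse) hQw hQn
    simp only [List.map_reverse, List.sum_reverse, List.map_map, Function.comp_def] at this ⊢
    exact this
  · rcases hσC with h | ⟨j, hj, h⟩
    · exact Or.inl h
    · obtain ⟨k, hk, rfl⟩ := List.mem_map.1 hj
      exact Or.inr ⟨k, hk, h⟩

/-- The invariant of the loop. -/
structure Inv (I : Inst) (ε M : ℚ) (mark : Fin I.numA → Bool) (x : stateTy.den) : Prop where
  inp : x.1 = (encode I ε, M)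
  arcs : x.2.1 = arcs I M mark
  cur : ∃ P, IsCur I ε M mark x.2.2.1 P
  best : ∃ P, IsSol I x.2.2.2 P
  le : x.2.2.2.2.2 ≤ x.2.2.1.2.2
  opt : ∀ Q, I.IsPath Q → (∀ j ∈ Q, mark j = false) ∨ ∃ j ∈ Q, x.2.2.2.2.2 ≤ I.p 0 j + I.p 1 j

theorem val_guard (x : stateTy.den) : (gar.guard (V := Ty.den) x).val =
    (!(x.2.2.1.1.any fun e => e.2.2) &&
      x.2.2.1.1.any fun e => decide (x.2.2.1.2.2 ≤ pt₁ e.1 + pt₂ e.1)) := by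
  simp only [gar, uar, val_lets, val_and, val_not, val_any, val_fst, val_snd, val_var, val_mul,
    val_lit, val_le, val_add, p₁, p₂, marked, one_mul]
  rfl

/-- The marks after the body of the loop. -/
def newMark (I : Inst) (mark : Fin I.numA → Bool) (C : ℚ) (j : Fin I.numA) : Bool :=
  mark j || decide (C ≤ I.p 0 j + I.p 1 j)

theorem val_map_mark (x : stateTy.den) (hE : x.2.1 = arcs I M mark) :
    (map ((Tm.var x : Tm Ty.den stateTy).snd.fst) fun e =>
      .cond (and (not (marked e)) (.le (.var (1 * x.2.2.1.2.2)) (p₁ e.fst + p₂ e.fst)))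
        (mkWarc e.fst (.var M) (.var M) .tt) e).val
      = arcs I M (newMark I mark x.2.2.1.2.2) := by
  rw [val_map]
  simp only [val_fst, val_snd, val_var, hE, arcs, List.map_map, one_mul]
  refine List.map_congr_left fun j _ => ?_
  simp only [Function.comp, val_cond, val_and, val_not, val_le, val_var, marked, val_snd, mkWarc,
    p₁, p₂, val_fst, val_pair, val_tt, val_add]
  by_cases hm : mark j <;> by_cases hc : x.2.2.1.2.2 ≤ I.p 0 j + I.p 1 j <;>
    simp [mkArc, newMark, hm, hc, enc]

theorem val_body (x : stateTy.den) (hx : x.1 = (encode I ε, M)) (hE : x.2.1 = arcs I M mark) :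
    ∃ E : List warcTy.den, E = arcs I M (newMark I mark x.2.2.1.2.2) ∧
    (gar.body (V := Ty.den) x).val = (x.1, E, (solve gs (.var (encode I ε)) (.var E)).val,
      if (solve gs (.var (encode I ε)) (.var E)).val.2.2 < x.2.2.2.2.2 then
        (solve gs (.var (encode I ε)) (.var E)).val else x.2.2.2) := by
  refine ⟨_, val_map_mark x hE, ?_⟩
  obtain ⟨y, E, cur, best⟩ := x
  obtain rfl : y = (encode I ε, M) := hx
  simp only [gar, uar, val_lets, val_pair, val_cond, val_lt, decide_eq_true_eq, val_fst, val_snd,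
    val_var]
  rfl

theorem val_map_init (ε M : ℚ) :
    (map (.var (encode I ε).2.2.1) fun e => mkWarc e (p₁ e) (p₂ e) .ff).val
      = arcs I M (fun _ => false) := by
  rw [val_map]
  simp only [arcs, encode, List.map_map, val_var]
  rfl

theorem inv_init (hI : ∃ P, I.IsPath P) (hε : 0 < ε) :
    Inv I ε ((1 + ε) * ((List.finRange I.numA).map fun j => I.p 0 j + I.p 1 j).sum + 1)
      (fun _ => false) (gar.init (V := Ty.den) (encode I ε)).val := by
  have hM : 0 ≤ (1 + ε) * ((List.finRange I.numA).map fun j => I.p 0 j + I.p 1 j).sum + 1 := by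
    have := sum_map_nonneg (P := List.finRange I.numA) (w := fun j => I.p 0 j + I.p 1 j)
      fun j _ => add_nonneg (I.p_nonneg 0 j) (I.p_nonneg 1 j)
    positivity
  have hE := val_map_init (I := I) ε
    ((1 + ε) * ((List.finRange I.numA).map fun j => I.p 0 j + I.p 1 j).sum + 1)
  have hMv : ((.lit 1 + Tm.fst (.var (encode I ε))) *
      sumOf (.var (encode I ε).2.2.1) (fun e => p₁ e + p₂ e) + .lit 1 : Tm Ty.den .num).val
      = (1 + ε) * ((List.finRange I.numA).map fun j => I.p 0 j + I.p 1 j).sum + 1 := by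
    simp only [val_add, val_mul, val_lit, val_fst, val_var, val_sumOf, encode, List.map_map]
    rfl
  obtain ⟨P, hP⟩ := solve_spec hI hε hM (.var (encode I ε)) (.var (map (.var (encode I ε).2.2.1)
    fun e => mkWarc e (p₁ e) (p₂ e) .ff).val) rfl hE
  exact ⟨Prod.ext rfl hMv, hE, ⟨P, hP⟩, ⟨P, hP.toIsSol⟩, le_rfl, fun Q _ => Or.inl (by simp)⟩

/-- The only delicate field is `opt`: when a path loses its unmarked status, one of its jobs must be
long enough to certify the best solution. -/
theorem inv_body (hI : ∃ P, I.IsPath P) (hε : 0 < ε) (hM : 0 ≤ M) {x : stateTy.den}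
    (h : Inv I ε M mark x) :
    Inv I ε M (newMark I mark x.2.2.1.2.2) (gar.body (V := Ty.den) x).val := by
  obtain ⟨E, hE, hb⟩ := val_body x h.inp h.arcs
  obtain ⟨P, hP⟩ := solve_spec hI hε hM (.var (encode I ε)) (.var E) rfl hE
  rw [hb]
  set y := (solve gs (.var (encode I ε)) (.var E)).val
  have hle : (if y.2.2 < x.2.2.2.2.2 then y else x.2.2.2).2.2 ≤ x.2.2.2.2.2 := by
    split_ifs with hc
    · exact hc.le
    · exact le_rfl
  refine ⟨h.inp, hE, ⟨P, hP⟩, ?_, ?_, ?_⟩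
  · simp only
    split_ifs with hc
    · exact ⟨P, hP.toIsSol⟩
    · exact h.best
  · simp only
    split_ifs with hc
    · exact le_rfl
    · exact not_lt.1 hc
  · intro Q hQ
    simp only
    rcases h.opt Q hQ with hQ' | ⟨j, hj, hj'⟩
    -- A job of `Q` marked now has length at least the current makespan, which is at least the old
    -- best one, hence at least the new best one.
    · by_cases hm : ∃ j ∈ Q, x.2.2.1.2.2 ≤ I.p 0 j + I.p 1 j
      · obtain ⟨j, hj, hj'⟩ := hm
        exact Or.inr ⟨j, hj, (hle.trans h.le).trans hj'⟩
      · left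
        intro j hj
        simp only [newMark, hQ' j hj, Bool.false_or, decide_eq_false_iff_not]
        exact fun hc => hm ⟨j, hj, hc⟩
    · exact Or.inr ⟨j, hj, hle.trans hj'⟩

/-- The number of unmarked arcs decreases. -/
theorem unmarked_lt {x : stateTy.den} (h : Inv I ε M mark x)
    (hg : (gar.guard (V := Ty.den) x).val = true) :
    (Finset.univ.filter fun j => newMark I mark x.2.2.1.2.2 j = false).card
      < (Finset.univ.filter fun j => mark j = false).card := by
  rw [val_guard, Bool.and_eq_true, Bool.not_eq_true', ← Bool.not_eq_true, List.any_eq_true,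
    List.any_eq_true] at hg
  obtain ⟨h1, e, he, h2⟩ := hg
  obtain ⟨P, hP⟩ := h.cur
  have he' := he
  rw [hP.eq] at he'
  obtain ⟨j, hj, rfl⟩ := List.mem_map.1 he'
  -- The guard also demands that the current path has no marked arc, so the long job found on it is
  -- newly marked.
  have hj1 : mark j = false := by
    by_contra hc
    exact h1 ⟨_, he, by simpa [mkArc] using hc⟩
  apply Finset.card_lt_card
  rw [Finset.ssubset_iff_of_subset]
  · refine ⟨j, by simp [hj1], ?_⟩
    simpa [newMark, mkArc, enc, pt₁, pt₂, hj1] using h2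
  · intro k hk
    simp only [newMark, Finset.mem_filter, Finset.mem_univ, true_and, Bool.or_eq_false_iff] at hk ⊢
    exact hk.1

/-- The quality of the solution when the loop terminates. -/
theorem best_le (hε : 0 < ε)
    (hM : M = (1 + ε) * ((List.finRange I.numA).map fun j => I.p 0 j + I.p 1 j).sum + 1)
    {x : stateTy.den} (h : Inv I ε M mark x) (hg : (gar.guard (V := Ty.den) x).val = false)
    (Q : List (Fin I.numA)) (hQ : I.IsPath Q) :
    x.2.2.2.2.2 ≤ (1 + ε) * max (Q.map (I.p 0)).sum (Q.map (I.p 1)).sum ∨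
      ∃ j ∈ Q, x.2.2.2.2.2 ≤ I.p 0 j + I.p 1 j := by
  refine (h.opt Q hQ).imp (fun hQm => ?_) id
  obtain ⟨P, hP⟩ := h.cur
  have hmin := hP.min Q hQ
  have hQ₁ : (Q.map fun j => wt₁ (mkArc I M mark j)) = Q.map (I.p 0) :=
    List.map_congr_left fun j hj => by simp [wt₁, mkArc, hQm j hj]
  have hQ₂ : (Q.map fun j => wt₂ (mkArc I M mark j)) = Q.map (I.p 1) :=
    List.map_congr_left fun j hj => by simp [wt₂, mkArc, hQm j hj]
  rw [hQ₁, hQ₂] at hmin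
  have hpn : ∀ j, 0 ≤ I.p 0 j + I.p 1 j := fun j => add_nonneg (I.p_nonneg 0 j) (I.p_nonneg 1 j)
  have hMn : 0 ≤ M := by
    have := sum_map_nonneg (P := List.finRange I.numA) (w := fun j => I.p 0 j + I.p 1 j)
      fun j _ => hpn j
    rw [hM]; positivity
  -- One marked arc alone would bring the weight of `P` up to `M`, beyond what the guarantee against
  -- the unmarked path `Q` allows.
  have hPm : ∀ j ∈ P, mark j = false := by
    by_contra! hc
    obtain ⟨j, hj, hjm⟩ := hc
    have h1 : M ≤ (P.map fun j => wt₁ (mkArc I M mark j)).sum := by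
      have : wt₁ (mkArc I M mark j) = M := by simp [wt₁, mkArc, hjm]
      refine this.symm.trans_le ?_
      refine List.single_le_sum (l := P.map fun j => wt₁ (mkArc I M mark j)) ?_ _
        (List.mem_map.2 ⟨j, hj, rfl⟩)
      intro y hy
      obtain ⟨k, -, rfl⟩ := List.mem_map.1 hy
      simp only [wt₁, mkArc]
      split_ifs
      · exact hMn
      · exact I.p_nonneg 0 k
    -- The loads of a path never exceed the sum of all processing times. With the factor `1 + ε`
    -- this is exactly `M - 1`.
    have h2 : max (Q.map (I.p 0)).sum (Q.map (I.p 1)).sum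
        ≤ ((List.finRange I.numA).map fun j => I.p 0 j + I.p 1 j).sum := by
      have h3 : (Q.map fun j => I.p 0 j + I.p 1 j).sum
          ≤ ((List.finRange I.numA).map fun j => I.p 0 j + I.p 1 j).sum :=
        sum_map_le_of_subset hQ.nodup (fun j _ => List.mem_finRange j) fun j _ => hpn j
      refine le_trans (max_le ?_ ?_) h3
      · exact List.sum_le_sum fun j _ => by linarith [I.p_nonneg 1 j]
      · exact List.sum_le_sum fun j _ => by linarith [I.p_nonneg 0 j]
    have h4 := mul_le_mul_of_nonneg_left h2 (by linarith : 0 ≤ 1 + ε)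
    linarith [le_max_left (P.map fun j => wt₁ (mkArc I M mark j)).sum
      (P.map fun j => wt₂ (mkArc I M mark j)).sum]
  have hP₁ : (P.map fun j => wt₁ (mkArc I M mark j)) = P.map (I.p 0) :=
    List.map_congr_left fun j hj => by simp [wt₁, mkArc, hPm j hj]
  have hP₂ : (P.map fun j => wt₂ (mkArc I M mark j)) = P.map (I.p 1) :=
    List.map_congr_left fun j hj => by simp [wt₂, mkArc, hPm j hj]
  rw [hP₁, hP₂] at hmin
  refine h.le.trans (le_trans ?_ hmin)
  rcases hP.bound with hb | ⟨j, hj, hb⟩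
  · exact hb
  -- A job at least as long as the makespan keeps the guard true, unless a marked arc lies on the
  -- path; `hPm` excludes the latter.
  · exfalso
    rw [val_guard, Bool.and_eq_false_iff, Bool.not_eq_false', ← Bool.not_eq_true,
      List.any_eq_true, List.any_eq_true] at hg
    rcases hg with ⟨e, he, he'⟩ | hg
    · rw [hP.eq] at he
      obtain ⟨k, hk, rfl⟩ := List.mem_map.1 he
      simp [mkArc, hPm k hk] at he'
    · refine hg ⟨mkArc I M mark j, ?_, decide_eq_true hb⟩
      rw [hP.eq]
      exact List.mem_map.2 ⟨j, hj, rfl⟩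

end Framework

/-! ### The output -/

section Output

variable {I : Inst} {ε M : ℚ} {mark : Fin I.numA → Bool}

/-- A simple path has distinct arcs, so a list with one entry per job is the graph of a function on
these jobs; elsewhere the values are irrelevant. -/
theorem exists_start {x : solTy.den} {P : List (Fin I.numA)} (h : IsSol I x P) :
    ∃ start : Fin 2 → Fin I.numA → ℚ,
      x.2.1.Perm (P.map fun j => (enc I j, start 0 j, start 1 j)) := by
  have hn : (x.2.1.map Prod.fst).Nodup :=
    (h.perm.nodup_iff).2 (h.path.nodup.map enc_injective)
  have hinj : ∀ a ∈ x.2.1, ∀ b ∈ x.2.1, a.1 = b.1 → a = b := fun a ha b hb hab =>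
    List.inj_on_of_nodup_map hn ha hb hab
  have hex : ∀ k : arcTy.den, ∃ y : ℚ × ℚ, ∀ a ∈ x.2.1, a.1 = k → a.2 = y := by
    intro k
    by_cases hk : ∃ a ∈ x.2.1, a.1 = k
    · obtain ⟨a, ha, rfl⟩ := hk
      exact ⟨a.2, fun b hb hab => congrArg Prod.snd (hinj b hb a ha hab)⟩
    · exact ⟨0, fun a ha hak => absurd ⟨a, ha, hak⟩ hk⟩
  choose y hy using hex
  refine ⟨fun i j => if i = 0 then (y (enc I j)).1 else (y (enc I j)).2, ?_⟩
  have h1 : x.2.1 = (x.2.1.map Prod.fst).map fun k => (k, y k) := by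
    rw [List.map_map]
    conv_lhs => rw [← List.map_id x.2.1]
    refine List.map_congr_left fun a ha => ?_
    exact Prod.ext rfl (hy a.1 a ha rfl)
  rw [h1]
  refine (h.perm.map _).trans (List.Perm.of_eq ?_)
  rw [List.map_map]
  rfl

/-- One side folds rational maxima from the left, the other real ones from the right, over permuted
lists. Both are the least upper bound of `0` and the completion times. -/
theorem completion_eq {σ : List entryTy.den} {P : List (Fin I.numA)}
    {start : Fin 2 → Fin I.numA → ℚ}
    (h : σ.Perm (P.map fun j => (enc I j, start 0 j, start 1 j))) :
    (completion σ : ℝ) = I.makespan P fun i j => (start i j : ℝ) := by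
  have hmem : ∀ a, a ∈ σ ↔ ∃ j ∈ P, a = (enc I j, start 0 j, start 1 j) := fun a => by
    simp only [h.mem_iff, List.mem_map, eq_comm]
  apply le_antisymm
  · have hrat : ∀ σ' : List entryTy.den, σ' ⊆ σ →
        (completion σ' : ℝ) ≤ I.makespan P fun i j => (start i j : ℝ) := by
      intro σ'
      induction σ' using List.reverseRecOn with
      | nil => intro _; simpa [completion] using makespan_nonneg
      | append_singleton σ' a ih =>
        intro hs
        have : completion (σ' ++ [a])
            = max (completion σ') (max (a.2.1 + pt₁ a.1) (a.2.2 + pt₂ a.1)) := by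
          rw [completion, List.foldl_append]; rfl
        rw [this]
        obtain ⟨j, hj, rfl⟩ := (hmem a).1 (hs (by simp))
        push_cast
        refine max_le (ih fun b hb => hs (by simp [hb])) (max_le ?_ ?_)
        · exact le_makespan (start := fun i j => (start i j : ℝ)) hj 0
        · exact le_makespan (start := fun i j => (start i j : ℝ)) hj 1
    exact hrat σ (List.Subset.refl σ)
  · refine foldr_max_spec.2.2 _ (by exact_mod_cast le_completion.1) ?_
    intro y hy
    obtain ⟨j, hj, rfl⟩ := List.mem_map.1 hy
    have h1 := le_completion.2 _ ((hmem _).2 ⟨j, hj, rfl⟩)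
    have h2 : start 0 j + I.p 0 j ≤ completion σ := (le_max_left _ _).trans h1
    have h3 : start 1 j + I.p 1 j ≤ completion σ := (le_max_right _ _).trans h1
    have h4 : (start 0 j : ℝ) + (I.p 0 j : ℝ) ≤ completion σ := by exact_mod_cast h2
    have h5 : (start 1 j : ℝ) + (I.p 1 j : ℝ) ≤ completion σ := by exact_mod_cast h3
    exact max_le h4 h5

theorem isSchedule_of_feas {σ : List entryTy.den} {C : ℚ} {P : List (Fin I.numA)}
    {start : Fin 2 → Fin I.numA → ℚ} (hF : Feas pt₁ pt₂ σ C)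
    (h : σ.Perm (P.map fun j => (enc I j, start 0 j, start 1 j))) :
    I.IsSchedule P fun i j => (start i j : ℝ) := by
  have hmem : ∀ j ∈ P, (enc I j, start 0 j, start 1 j) ∈ σ := fun j hj =>
    h.mem_iff.2 (List.mem_map.2 ⟨j, hj, rfl⟩)
  refine ⟨?_, ?_, ?_⟩
  · intro i j hj
    obtain ⟨h1, h2, -⟩ := hF.each _ (hmem j hj)
    fin_cases i
    · exact_mod_cast h1
    · exact_mod_cast h2
  · intro i j hj k hk hjk
    -- `Pairwise` gives the condition for one order of each pair only; it is symmetric, so the order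
    -- can be forgotten.
    have hsym : Std.Symm fun a b : entryTy.den =>
        (a.2.1 + pt₁ a.1 ≤ b.2.1 ∨ b.2.1 + pt₁ b.1 ≤ a.2.1) ∧
        (a.2.2 + pt₂ a.1 ≤ b.2.2 ∨ b.2.2 + pt₂ b.1 ≤ a.2.2) :=
      ⟨fun a b h => ⟨h.1.symm, h.2.symm⟩⟩
    have := hF.pw.forall (hmem j hj) (hmem k hk)
      fun hc => hjk (enc_injective (congrArg Prod.fst hc))
    fin_cases i
    · exact_mod_cast this.1
    · exact_mod_cast this.2
  · intro j hj
    obtain ⟨-, -, -, -, h3⟩ := hF.each _ (hmem j hj)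
    exact_mod_cast h3

theorem val_output (x : stateTy.den) : (gar.output (V := Ty.den) x).val =
    (x.2.2.2.1.map fun e => e.1.1, x.2.2.2.2.1.map fun e => (e.1.1, e.2), x.2.2.2.2.2) := by
  simp only [gar, uar, val_lets, val_pair, val_map, val_fst, val_snd, val_var, jobId, start₁,
    start₂]

theorem describes_output {x : stateTy.den} {P : List (Fin I.numA)} (h : IsSol I x.2.2.2 P) :
    ∃ start : Fin 2 → Fin I.numA → ℚ, Describes I (gar.output (V := Ty.den) x).val P start ∧
      I.IsSchedule P (fun i j => (start i j : ℝ)) ∧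
      I.makespan P (fun i j => (start i j : ℝ)) = (x.2.2.2.2.2 : ℝ) := by
  obtain ⟨start, hst⟩ := exists_start h
  have hm := completion_eq hst
  rw [← h.comp] at hm
  refine ⟨start, ⟨?_, ?_, ?_⟩, isSchedule_of_feas h.feas hst, hm.symm⟩
  · rw [val_output]
    have := congrArg (List.map Prod.fst) h.arcs
    rw [List.map_map, List.map_map] at this
    exact this
  · rw [val_output]
    have := hst.map fun e : entryTy.den => (e.1.1, e.2)
    rw [List.map_map] at this
    exact this
  · rw [val_output]
    exact hm

/-- Both alternatives of `best_le` are lower bounds for any schedule of `Q`, up to the factor `1 +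
ε`. -/
theorem makespan_le_opt (hε : 0 < ε)
    (hM : M = (1 + ε) * ((List.finRange I.numA).map fun j => I.p 0 j + I.p 1 j).sum + 1)
    {x : stateTy.den} (h : Inv I ε M mark x) (hg : (gar.guard (V := Ty.den) x).val = false) :
    (x.2.2.2.2.2 : ℝ) ≤ (1 + (ε : ℝ)) * I.opt := by
  have hε' : (0 : ℝ) < 1 + ε := by
    have : (0 : ℝ) < ε := by exact_mod_cast hε
    linarith
  rw [mul_comm, ← div_le_iff₀ hε']
  obtain ⟨P₀, hP₀⟩ := h.best
  obtain ⟨start₀, -, hs₀, -⟩ := describes_output hP₀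
  -- The infimum is over a nonempty set: the solution computed belongs to it.
  refine le_csInf ⟨_, P₀, _, hP₀.path, hs₀, rfl⟩ ?_
  rintro C ⟨Q, start, hQ, hst, rfl⟩
  rw [div_le_iff₀ hε', mul_comm]
  have h1 : ∀ i, ((Q.map (I.p i)).sum : ℝ) ≤ I.makespan Q start :=
    sum_le_makespan hst hQ.nodup
  rcases best_le hε hM h hg Q hQ with hb | ⟨j, hj, hb⟩
  · have : (x.2.2.2.2.2 : ℝ) ≤ (1 + ε) * max ((Q.map (I.p 0)).sum : ℝ) ((Q.map (I.p 1)).sum : ℝ) := by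
      exact_mod_cast hb
    refine this.trans (mul_le_mul_of_nonneg_left (max_le (h1 0) (h1 1)) hε'.le)
  · have h2 := job_le_makespan hst hj
    have h3 : (x.2.2.2.2.2 : ℝ) ≤ (I.p 0 j : ℝ) + I.p 1 j := by exact_mod_cast hb
    have h4 : (0 : ℝ) ≤ ε := by exact_mod_cast hε.le
    nlinarith [makespan_nonneg (I := I) (P := Q) (start := start)]

/-- Termination and correctness, with a bound for the number of steps. -/
theorem gar_spec (hI : ∃ P, I.IsPath P) (hε : 0 < ε) {c₀ : ℕ}
    (hM : M = (1 + ε) * ((List.finRange I.numA).map fun j => I.p 0 j + I.p 1 j).sum + 1)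
    (hcost : ∀ mark x, Inv I ε M mark x → (gar.guard (V := Ty.den) x).cost ≤ c₀ ∧
      (gar.body (V := Ty.den) x).cost ≤ c₀ ∧ (gar.output (V := Ty.den) x).cost ≤ c₀) :
    ∀ {n : ℕ} {mark : Fin I.numA → Bool} {x : stateTy.den}, Inv I ε M mark x →
      (Finset.univ.filter fun j => mark j = false).card ≤ n →
      ∃ (o : outputTy.den) (c : ℕ), gar.Loop x o c ∧ c ≤ 2 * (n + 1) * c₀ ∧
        ∃ (P : List (Fin I.numA)) (start : Fin 2 → Fin I.numA → ℚ), Describes I o P start ∧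
          I.IsPath P ∧ I.IsSchedule P (fun i j => (start i j : ℝ)) ∧
          I.makespan P (fun i j => (start i j : ℝ)) ≤ (1 + (ε : ℝ)) * I.opt := by
  have hM0 : 0 ≤ M := by
    have := sum_map_nonneg (P := List.finRange I.numA) (w := fun j => I.p 0 j + I.p 1 j)
      fun j _ => add_nonneg (I.p_nonneg 0 j) (I.p_nonneg 1 j)
    rw [hM]; positivity
  intro n
  induction n with
  | zero =>
    intro mark x h hn
    obtain ⟨h1, h2, h3⟩ := hcost mark x h
    -- With no unmarked arc left, a true guard would have to decrease the count below zero.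
    have hg : (gar.guard (V := Ty.den) x).val = false := by
      by_contra hg
      have := unmarked_lt h (by simpa using hg)
      omega
    obtain ⟨P, hP⟩ := h.best
    obtain ⟨start, hd, hs, hm⟩ := describes_output hP
    exact ⟨_, _, .exit hg, by omega, P, start, hd, hP.path, hs,
      hm.trans_le (makespan_le_opt hε hM h hg)⟩
  | succ n ih =>
    intro mark x h hn
    obtain ⟨h1, h2, h3⟩ := hcost mark x h
    by_cases hg : (gar.guard (V := Ty.den) x).val = true
    · obtain ⟨o, c, hl, hc, hr⟩ := ih (inv_body hI hε hM0 h) (by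
        have := unmarked_lt h hg
        omega)
      exact ⟨o, _, .step hg hl, by nlinarith, hr⟩
    · have hg : (gar.guard (V := Ty.den) x).val = false := by simpa using hg
      obtain ⟨P, hP⟩ := h.best
      obtain ⟨start, hd, hs, hm⟩ := describes_output hP
      exact ⟨_, _, .exit hg, by nlinarith, P, start, hd, hP.path, hs,
        hm.trans_le (makespan_le_opt hε hM h hg)⟩

end Output

/-! ### Numbers of bits -/

section Bits

theorem size_mul_le (m n : ℕ) : (m * n).size ≤ m.size + n.size := by
  rw [Nat.size_le, pow_add]
  exact Nat.mul_lt_mul'' (Nat.lt_size_self m) (Nat.lt_size_self n)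

theorem size_add_le (m n : ℕ) : (m + n).size ≤ max m.size n.size + 1 := by
  rw [Nat.size_le, pow_succ]
  have h1 : m < 2 ^ max m.size n.size :=
    (Nat.lt_size_self m).trans_le (Nat.pow_le_pow_right two_pos (le_max_left _ _))
  have h2 : n < 2 ^ max m.size n.size :=
    (Nat.lt_size_self n).trans_le (Nat.pow_le_pow_right two_pos (le_max_right _ _))
  omega

theorem one_le_size_den (q : ℚ) : 1 ≤ q.den.size := Nat.size_pos.2 q.den_pos

theorem size_le_of_dvd {m n : ℕ} (h : m ∣ n) (hn : n ≠ 0) : m.size ≤ n.size :=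
  Nat.size_le_size (Nat.le_of_dvd (Nat.pos_of_ne_zero hn) h)

/-- The fraction `a / d` need not be reduced, and reducing it only shrinks numerator and
denominator. -/
theorem bits_le_of_mul_eq {q : ℚ} {a : ℤ} {d : ℕ} (hd : d ≠ 0) (h : q * d = a) :
    bits q ≤ a.natAbs.size + d.size := by
  have hd' : (d : ℚ) ≠ 0 := by exact_mod_cast hd
  have hq : q = (a : ℚ) / ((d : ℤ) : ℚ) := by rw [Int.cast_natCast, eq_div_iff hd', h]
  have h1 : q.den ∣ d := by
    have := Rat.den_dvd a d
    rw [hq]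
    rw [Rat.divInt_eq_div] at this
    exact_mod_cast this
  have h2 : q.num.natAbs ≤ a.natAbs := by
    by_cases ha : a = 0
    · have : q = 0 := by rw [hq, ha]; simp
      simp [this]
    · have := Rat.num_dvd a (b := (d : ℤ)) (by exact_mod_cast hd)
      rw [Rat.divInt_eq_div, ← hq] at this
      exact Nat.le_of_dvd (Int.natAbs_pos.2 ha) (Int.natAbs_dvd_natAbs.2 this)
  exact Nat.add_le_add (Nat.size_le_size h2) (size_le_of_dvd h1 hd)

theorem bits_mul_le (x y : ℚ) : bits (x * y) ≤ bits x + bits y := by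
  have h := bits_le_of_mul_eq (q := x * y) (a := x.num * y.num) (d := x.den * y.den)
    (mul_ne_zero x.den_nz y.den_nz) (by
      push_cast
      rw [← Rat.mul_den_eq_num x, ← Rat.mul_den_eq_num y]; ring)
  rw [Int.natAbs_mul] at h
  have h1 := size_mul_le x.num.natAbs y.num.natAbs
  have h2 := size_mul_le x.den y.den
  unfold bits at *
  omega

theorem bits_add_le (x y : ℚ) : bits (x + y) ≤ 2 * (bits x + bits y) + 1 := by
  have h := bits_le_of_mul_eq (q := x + y) (a := x.num * y.den + y.num * x.den) (d := x.den * y.den)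
    (mul_ne_zero x.den_nz y.den_nz) (by
      push_cast
      rw [← Rat.mul_den_eq_num x, ← Rat.mul_den_eq_num y]; ring)
  have h1 := size_mul_le x.num.natAbs y.den
  have h2 := size_mul_le y.num.natAbs x.den
  have h3 := size_mul_le x.den y.den
  have h4 := size_add_le (x.num.natAbs * y.den) (y.num.natAbs * x.den)
  have h5 : (x.num * y.den + y.num * x.den).natAbs.size
      ≤ (x.num.natAbs * y.den + y.num.natAbs * x.den).size :=
    Nat.size_le_size ((Int.natAbs_add_le _ _).trans (by simp [Int.natAbs_mul]))
  unfold bits at *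
  omega

theorem bits_inv_le (x : ℚ) : bits x⁻¹ ≤ bits x := by
  by_cases hx : x = 0
  · simp [hx]
  · have hn : x.num ≠ 0 := Rat.num_ne_zero.2 hx
    have h := bits_le_of_mul_eq (q := x⁻¹) (a := x.num.sign * x.den) (d := x.num.natAbs)
      (Int.natAbs_ne_zero.2 hn) (by
        have h1 : ((x.num.natAbs : ℕ) : ℚ) = x.num.sign * x.num := by
          have : x.num.sign * x.num = ((x.num.natAbs : ℕ) : ℤ) := Int.sign_mul_self_eq_natAbs x.num
          rw [← Int.cast_mul, this, Int.cast_natCast]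
        rw [h1, ← Rat.mul_den_eq_num x]
        push_cast
        field_simp)
    rw [Int.natAbs_mul, Int.natAbs_sign_of_ne_zero hn, one_mul, Int.natAbs_natCast] at h
    unfold bits at *
    omega

theorem bits_div_le (x y : ℚ) : bits (x / y) ≤ bits x + bits y := by
  rw [div_eq_mul_inv]
  exact (bits_mul_le _ _).trans (Nat.add_le_add_left (bits_inv_le y) _)

theorem bits_natCast (m : ℕ) : bits (m : ℚ) = m.size + 1 := by
  simp [bits]

/-- A nonnegative rational is at most its numerator, and any denominator takes at least the one bit
that a natural number spends on its own. -/
theorem bits_natCast_le {m : ℕ} {q : ℚ} (h : (m : ℚ) ≤ q) : bits (m : ℚ) ≤ bits q := by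
  rw [bits_natCast]
  have h1 := one_le_size_den q
  have h2 : (m : ℚ) ≤ q.num := by
    rw [← Rat.mul_den_eq_num]
    have h0 : (1 : ℚ) ≤ q.den := by exact_mod_cast q.den_pos
    have h3 : (0 : ℚ) ≤ m := Nat.cast_nonneg m
    nlinarith
  have h3 : m ≤ q.num.natAbs := by
    have : (m : ℤ) ≤ q.num := by exact_mod_cast h2
    omega
  have := Nat.size_le_size h3
  unfold bits
  omega

theorem exists_floor_eq {q : ℚ} (h : 0 ≤ q) : ∃ m : ℕ, ((⌊q⌋ : ℤ) : ℚ) = m ∧ (m : ℚ) ≤ q := by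
  refine ⟨⌊q⌋.toNat, ?_, ?_⟩
  · have := Int.toNat_of_nonneg (Int.floor_nonneg.2 h)
    exact_mod_cast this.symm
  · have h1 := Int.toNat_of_nonneg (Int.floor_nonneg.2 h)
    have h2 : ((⌊q⌋.toNat : ℤ) : ℚ) ≤ q := by rw [h1]; exact Int.floor_le q
    exact_mod_cast h2

theorem bits_floor_le {q : ℚ} (h : 0 ≤ q) : bits ((⌊q⌋ : ℤ) : ℚ) ≤ bits q := by
  obtain ⟨m, h1, h2⟩ := exists_floor_eq h
  rw [h1]
  exact bits_natCast_le h2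

/-- `q` is a multiple of `1 / D` of absolute value at most `X`. -/
def Rep (D X : ℕ) (q : ℚ) : Prop := (∃ z : ℤ, q * D = z) ∧ |q| ≤ X

variable {D X Y : ℕ} {x y : ℚ}

theorem Rep.mono (h : Rep D X x) (hXY : X ≤ Y) : Rep D Y x :=
  ⟨h.1, h.2.trans (by exact_mod_cast hXY)⟩

theorem Rep.zero : Rep D X 0 := ⟨⟨0, by simp⟩, by simp⟩

theorem Rep.neg (h : Rep D X x) : Rep D X (-x) := by
  obtain ⟨⟨z, hz⟩, h⟩ := h
  exact ⟨⟨-z, by push_cast; rw [← hz]; ring⟩, by rwa [abs_neg]⟩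

theorem Rep.add (hx : Rep D X x) (hy : Rep D Y y) : Rep D (X + Y) (x + y) := by
  obtain ⟨⟨z, hz⟩, hx⟩ := hx
  obtain ⟨⟨u, hu⟩, hy⟩ := hy
  refine ⟨⟨z + u, by push_cast; rw [← hz, ← hu]; ring⟩, (abs_add_le _ _).trans ?_⟩
  push_cast
  linarith

theorem Rep.sub (hx : Rep D X x) (hy : Rep D Y y) : Rep D (X + Y) (x - y) := by
  rw [sub_eq_add_neg]; exact hx.add hy.neg

theorem Rep.max (hx : Rep D X x) (hy : Rep D X y) : Rep D X (max x y) := by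
  rcases max_choice x y with h | h <;> rw [h] <;> assumption

theorem Rep.sum_map {α : Type} {w : α → ℚ} : ∀ {P : List α}, (∀ e ∈ P, Rep D X (w e)) →
    Rep D (P.length * X) (P.map w).sum
  | [], _ => by simpa using Rep.zero
  | e :: P, h => by
    have := (h e (by simp)).add (Rep.sum_map (P := P) fun f hf => h f (by simp [hf]))
    simp only [List.map_cons, List.sum_cons, List.length_cons]
    exact this.mono (by rw [add_mul]; omega)

theorem Rep.sum_map_of_le {α : Type} {w : α → ℚ} {P : List α} {n : ℕ}
    (h : ∀ e ∈ P, Rep D X (w e)) (hn : P.length ≤ n) : Rep D (n * X) (P.map w).sum :=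
  (Rep.sum_map h).mono (Nat.mul_le_mul_right _ hn)

/-- The unreduced numerator is at most `X * D ≤ 2 ^ (2 * b)` and the denominator at most `2 ^ b`.
The bound does not depend on how many additions produced `x`, whereas iterating `bits_add_le` would
grow exponentially. -/
theorem Rep.bits_le {b : ℕ} (h : Rep D X x) (hD : D ≠ 0) (hDb : D ≤ 2 ^ b) (hX : X ≤ 2 ^ b) :
    bits x ≤ 3 * b + 2 := by
  obtain ⟨⟨z, hz⟩, hx⟩ := h
  have h1 := bits_le_of_mul_eq hD hz
  have h2 : z.natAbs ≤ X * D := by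
    have : (|z| : ℚ) ≤ (X * D : ℕ) := by
      rw [← hz, abs_mul, Nat.abs_cast]
      push_cast
      exact mul_le_mul_of_nonneg_right hx (Nat.cast_nonneg D)
    have h3 : |z| ≤ ((X * D : ℕ) : ℤ) := by exact_mod_cast this
    rw [Int.abs_eq_natAbs] at h3
    exact_mod_cast h3
  have h3 : z.natAbs.size ≤ 2 * b + 1 := by
    rw [Nat.size_le]
    calc z.natAbs ≤ 2 ^ b * 2 ^ b := h2.trans (Nat.mul_le_mul hX hDb)
      _ = 2 ^ (2 * b) := by rw [← pow_add]; ring_nf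
      _ < 2 ^ (2 * b + 1) := Nat.pow_lt_pow_right (by omega) (by omega)
  have h4 : D.size ≤ b + 1 := by
    rw [Nat.size_le]
    exact hDb.trans_lt (Nat.pow_lt_pow_right (by omega) (by omega))
  omega

end Bits

/-! ### The cost of the min-max path algorithm -/

/-- Costs are tracked as a coefficient times a power of the common list bound `S`; every level of
nesting raises the exponent by one. -/
theorem Cst.loop_pow {K S m n k c d : ℕ} {a b : Ty} {l : Tm Ty.den (.list a)} {i : Tm Ty.den b}
    {f : Tm Ty.den b → Tm Ty.den a → Tm Ty.den b} (Inv : b.den → Prop) (hS : 1 ≤ S)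
    (hl : Cst K m l) (hi : Cst K n i) (hlen : l.val.length ≤ S) (h0 : Inv i.val)
    (h : ∀ v, Inv v → ∀ x ∈ l.val, Inv (f (.var v) (.var x)).val ∧
      Cst K (c * S ^ k) (f (.var v) (.var x))) (hd : m + n + c + 2 ≤ d) :
    Cst K (d * S ^ (k + 1)) (OpenShopPath.loop l i f) := by
  refine (loop Inv hl hi h0 h).mono ?_
  have h1 : 1 ≤ S ^ k := Nat.one_le_pow _ _ hS
  have h2 : S ≤ S ^ (k + 1) := by rw [pow_succ]; nlinarith
  have h3 : l.val.length * (c * S ^ k + 1) ≤ S * (c * S ^ k + 1) := Nat.mul_le_mul_right _ hlen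
  have h4 : S * (c * S ^ k + 1) = c * S ^ (k + 1) + S := by rw [pow_succ]; ring
  have h5 : (m + n + c + 2) * S ^ (k + 1) ≤ d * S ^ (k + 1) := Nat.mul_le_mul_right _ hd
  nlinarith

/-! ### Cost of the shortest path computation. -/

section SP

variable {K S : ℕ}

theorem cst_relaxTm {w : Tm Ty.den warcTy → Tm Ty.den .num} {e : warcTy.den}
    {T : List (ℚ × ℚ × List warcTy.den)} {x : ℚ × ℚ × List warcTy.den} (hS : 1 ≤ S)
    (hT : T.length ≤ S) (hw : Cst K 9 (w (.var e))) (bT : ∀ z ∈ T, bits z.1 ≤ K ∧ bits z.2.1 ≤ K)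
    (bx : bits x.1 ≤ K ∧ bits x.2.1 ≤ K) (be : bits (wtail e) ≤ K ∧ bits (whead e) ≤ K)
    (bw : bits (w (.var e)).val ≤ K) (bd : bits (x.2.1 + (w (.var e)).val) ≤ K) :
    Cst K (150 * S ^ 1) (relaxTm w (.var e) (.var T) (.var x)) := by
  unfold relaxTm
  refine Cst.mono (Cst.cond (m := 110 * S + 15) (n := 1) (Cst.eq (Cst.fst .var) (Cst.fst (Cst.snd (Cst.fst .var)))
    bx.1 be.1) (fun _ => ?_) fun _ => .var) (by rw [pow_one]; omega)
  refine Cst.mono (Cst.lets (Cst.fst (Cst.snd (Cst.snd (Cst.fst .var)))) (Cst.lets (n := 100 * S)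
    (Cst.add (Cst.fst (Cst.snd .var)) hw bx.2 bw) ?_)) (by omega)
  refine Cst.mono (Cst.cond (Cst.any (k := 20) .var fun z hz => ?_) (fun _ => .var)
    fun _ => Cst.cons (Cst.pair .var (Cst.pair .var (Cst.cons .var (Cst.snd (Cst.snd .var)))))
      (Cst.filter (k := 20) .var fun z hz => ?_)) (by simp only [val_var]; omega)
  · exact Cst.mono (Cst.and (Cst.eq (Cst.fst .var) .var (bT z hz).1 be.2)
      fun _ => Cst.le (Cst.fst (Cst.snd .var)) .var (bT z hz).2 bd) (by omega)
  · exact Cst.mono (Cst.not (Cst.eq (Cst.fst .var) .var (bT z hz).1 be.2)) (by omega)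

variable {vs : List ℚ} {s t : ℚ} {E : List warcTy.den} {D X : ℕ}

/-- The hypotheses on the numbers and list lengths for the computation of shortest paths. -/
structure SPBound (K S D X : ℕ) (vs : List ℚ) (s : ℚ) (E : List warcTy.den) : Prop where
  one : 1 ≤ S
  lenV : vs.length ≤ S
  lenE : E.length ≤ S
  s_mem : s ∈ vs
  head : ∀ e ∈ E, whead e ∈ vs
  tail : ∀ e ∈ E, wtail e ∈ vs
  bv : ∀ v ∈ vs, bits v ≤ K
  nonneg : ∀ e ∈ E, 0 ≤ wt₁ e ∧ 0 ≤ wt₂ e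
  rep : ∀ e ∈ E, Rep D X (wt₁ e) ∧ Rep D X (wt₂ e)
  bits : ∀ q, Rep D (vs.length * (2 * X) + 2 * X) q → bits q ≤ K

theorem cst_spLabels (h : SPBound K S D X vs s E) :
    Cst K (170 * S ^ 4) (spLabels (.var vs) (.var s) (.var E) fun e => w₁ e + w₂ e) := by
  set w : warcTy.den → ℚ := fun e => wt₁ e + wt₂ e with hw
  have hwn : ∀ e ∈ E, 0 ≤ w e := fun e he => add_nonneg (h.nonneg e he).1 (h.nonneg e he).2
  have hwr : ∀ e ∈ E, Rep D (2 * X) (w e) := fun e he =>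
    ((h.rep e he).1.add (h.rep e he).2).mono (by omega)
  have hlab : ∀ {T x}, GoodLabel wtail whead s w E T x → Rep D (vs.length * (2 * X)) x.2.1 ∧
      x.1 ∈ vs := by
    intro T x hx
    refine ⟨?_, hx.walk.mem_of_sub hx.sub h.s_mem h.head⟩
    rw [← hx.sum]
    have := hx.length_le h.s_mem h.head
    exact Rep.sum_map_of_le (fun e he => hwr e (hx.sub he)) (by omega)
  have hb : ∀ {T x}, GoodLabel wtail whead s w E T x → bits x.1 ≤ K ∧ bits x.2.1 ≤ K :=
    fun hx => ⟨h.bv _ (hlab hx).2, h.bits _ ((hlab hx).1.mono (by omega))⟩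
  have b0 : bits 0 ≤ K := h.bits 0 Rep.zero
  have harc : ∀ T, Good wtail whead s w E T → ∀ e ∈ E,
      Cst K (154 * S ^ 2) (relaxArcTm (fun e => w₁ e + w₂ e) (.var T) (.var e)) := by
    intro T hT e he
    -- The second half of the invariant keeps the labels of the snapshot `T` good with respect to
    -- the changing table `T'`.
    refine Cst.loop_pow (fun T' => Good wtail whead s w E T' ∧ ∀ v d, Cov T v d → Cov T' v d)
      h.one .var .var ((hT.length_le h.s_mem h.head).trans h.lenV) ⟨hT, fun _ _ => id⟩ ?_
      (c := 150) (by omega)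
    rintro T' ⟨hT', hc⟩ x hx
    have hx' := (hT.label x hx).mono hc
    refine ⟨?_, ?_⟩
    · rw [val_relaxTm]
      exact ⟨hT'.relax hwn he hx', fun v d hv => cov_relax (hc v d hv)⟩
    · refine cst_relaxTm h.one ((hT'.length_le h.s_mem h.head).trans h.lenV) ?_
        (fun z hz => hb (hT'.label z hz)) (hb hx') ⟨h.bv _ (h.tail e he), h.bv _ (h.head e he)⟩
        (h.bits _ ((hwr e he).mono (by omega))) (h.bits _ ((hlab hx').1.add (hwr e he)))
      exact Cst.add (Cst.fst (Cst.fst (Cst.snd .var))) (Cst.snd (Cst.fst (Cst.snd .var)))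
        (h.bits _ ((h.rep e he).1.mono (by omega))) (h.bits _ ((h.rep e he).2.mono (by omega)))
  have : spLabels (V := Ty.den) (.var vs) (.var s) (.var E) (fun e => w₁ e + w₂ e)
      = loop (.var vs : Tm Ty.den (.list .num)) (.cons (.pair (.var s) (.pair (.lit 0) .nil)) .nil) fun T _ =>
    loop (.var E) T fun T e => relaxArcTm (fun e => w₁ e + w₂ e) T e := rfl
  rw [this]
  refine Cst.loop_pow (Good wtail whead s w E) h.one .var
    (Cst.cons (Cst.pair .var (Cst.pair (Cst.lit b0) .nil)) .nil) h.lenV good_init ?_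
    (c := 158) (by omega)
  intro T hT _ _
  refine ⟨?_, Cst.loop_pow (Good wtail whead s w E) h.one .var .var h.lenE hT ?_
    (c := 154) (by omega)⟩
  · have := (relaxAll_aux hwn hT (List.Subset.refl E)).1
    simp only [val_loop, val_relaxArcTm]
    exact this
  · intro T' hT' e he
    refine ⟨?_, harc T' hT' e he⟩
    rw [val_relaxArcTm]
    exact hT'.relaxArc hwn he

theorem cst_shortestPath (h : SPBound K S D X vs s E) (ht : t ∈ vs) :
    Cst K (200 * S ^ 4) (shortestPath (.var vs) (.var s) (.var t) (.var E)) := by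
  have hwn : ∀ e ∈ E, 0 ≤ wt₁ e + wt₂ e := fun e he =>
    add_nonneg (h.nonneg e he).1 (h.nonneg e he).2
  obtain ⟨hG, -⟩ := rounds_spec (s := s) (tl := wtail) (hd := whead) hwn vs
  have hval : (spLabels (.var vs) (.var s) (.var E) fun e => w₁ e + w₂ e).val = vs.foldl
      (fun T _ => relaxAll wtail whead (fun e => wt₁ e + wt₂ e) E T) [(s, 0, [])] := by
    rw [val_spLabels]; rfl
  set T := vs.foldl
      (fun T _ => relaxAll wtail whead (fun e => wt₁ e + wt₂ e) E T) [(s, 0, [])]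
  have hTl : T.length ≤ S := (hG.length_le h.s_mem h.head).trans h.lenV
  have hS4 : S ≤ S ^ 4 := by
    have := h.one
    calc S = S ^ 1 := (pow_one S).symm
      _ ≤ S ^ 4 := Nat.pow_le_pow_right this (by omega)
  unfold shortestPath
  have hloop := Cst.loop (l := spLabels (.var vs) (.var s) (.var E) fun e => w₁ e + w₂ e)
    (i := (.nil : Tm Ty.den (.list warcTy)))
    (f := fun P x => .cond (eq x.fst (.var t)) x.snd.snd P)
    (fun P => P.length ≤ S) (cst_spLabels h) .nil (k := 20) (Nat.zero_le _) (fun P hP x hx => by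
      rw [hval] at hx
      have hg := hG.label x hx
      have hxl := hg.length_le h.s_mem h.head
      refine ⟨?_, ?_⟩
      · simp only [val_cond, val_snd, val_var]
        split_ifs
        · have := h.lenV
          exact le_trans (Nat.le_of_succ_le hxl) this
        · exact hP
      · exact Cst.mono (Cst.cond (Cst.eq (Cst.fst .var) .var
          (h.bv _ (hg.walk.mem_of_sub hg.sub h.s_mem h.head)) (h.bv _ ht))
          (fun _ => Cst.snd (Cst.snd .var)) fun _ => .var) (by omega))
  refine Cst.mono (Cst.reverse hloop) ?_
  have hlen : (loop (spLabels (.var vs) (.var s) (.var E) fun e => w₁ e + w₂ e)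
      (.nil : Tm Ty.den (.list warcTy)) fun P x => .cond (eq x.fst (.var t)) x.snd.snd P).val.length
      ≤ S := by
    rw [val_loop, hval]
    refine (Cst.foldCost_le (c := fun _ _ => 0) (M := 0) (fun P : List warcTy.den => P.length ≤ S)
      (Nat.zero_le _) fun P hP x hx => ⟨?_, le_rfl⟩).1
    have hxl := (hG.label x hx).length_le h.s_mem h.head
    simp only [val_cond, val_snd, val_var]
    split_ifs
    · have := h.lenV
      exact le_trans (Nat.le_of_succ_le hxl) this
    · exact hP
  rw [hval]
  have := h.one
  omega

end SP

/-! ### Cost of the dynamic program. -/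

section MM

variable {K S : ℕ}

theorem cst_extendTm {c₁ c₂ B : ℚ} {e : warcTy.den} {T : List (ℚ × (ℚ × ℚ) × List warcTy.den)}
    {x : ℚ × (ℚ × ℚ) × List warcTy.den} (hS : 1 ≤ S) (hT : T.length ≤ S)
    (bT : ∀ z ∈ T, bits z.1 ≤ K ∧ bits z.2.1.1 ≤ K ∧ bits z.2.1.2 ≤ K)
    (bx : bits x.1 ≤ K ∧ bits x.2.1.1 ≤ K ∧ bits x.2.1.2 ≤ K)
    (be : bits (wtail e) ≤ K ∧ bits (whead e) ≤ K) (bc : bits c₁ ≤ K ∧ bits c₂ ≤ K)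
    (ba : bits (x.2.1.1 + c₁) ≤ K ∧ bits (x.2.1.2 + c₂) ≤ K) (bB : bits B ≤ K) :
    Cst K (150 * S ^ 1) (extendTm (.var c₁) (.var c₂) (.var B) (.var e) (.var T) (.var x)) := by
  unfold extendTm
  refine Cst.mono (Cst.cond (m := 110 * S + 10) (n := 1) (Cst.eq (Cst.fst .var) (Cst.fst (Cst.snd (Cst.fst .var)))
    bx.1 be.1) (fun _ => ?_) fun _ => .var) (by rw [pow_one]; omega)
  refine Cst.mono (Cst.lets (Cst.fst (Cst.snd (Cst.snd (Cst.fst .var)))) (Cst.lets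
    (Cst.add (Cst.fst (Cst.fst (Cst.snd .var))) .var bx.2.1 bc.1) (Cst.lets (n := 90 * S)
    (Cst.add (Cst.snd (Cst.fst (Cst.snd .var))) .var bx.2.2 bc.2) ?_))) (by omega)
  refine Cst.mono (Cst.cond (Cst.and (Cst.and (Cst.le .var .var ba.1 bB) fun _ => Cst.le .var .var ba.2 bB)
    fun _ => Cst.not (Cst.any (k := 45) .var fun z hz => ?_))
    (fun _ => Cst.cons (Cst.pair .var (Cst.pair (Cst.pair .var .var)
      (Cst.cons .var (Cst.snd (Cst.snd .var))))) .var) fun _ => .var)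
    (by simp only [val_var]; omega)
  exact Cst.mono (Cst.and (Cst.eq (Cst.fst .var) .var (bT z hz).1 be.2) fun _ =>
    Cst.and (Cst.eq (Cst.fst (Cst.fst (Cst.snd .var))) .var (bT z hz).2.1 ba.1) fun _ =>
      Cst.eq (Cst.snd (Cst.fst (Cst.snd .var))) .var (bT z hz).2.2 ba.2) (by omega)

/-- The hypotheses on the numbers and list lengths for the dynamic program. -/
structure MMBound (K S K' b : ℕ) (vs : List ℚ) (s k B : ℚ) (E : List warcTy.den) : Prop where
  one : 1 ≤ S
  lenV : vs.length ≤ S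
  lenE : E.length ≤ S
  s_mem : s ∈ vs
  head : ∀ e ∈ E, whead e ∈ vs
  tail : ∀ e ∈ E, wtail e ∈ vs
  bv : ∀ v ∈ vs, bits v ≤ K
  nonneg : ∀ e ∈ E, 0 ≤ wt₁ e ∧ 0 ≤ wt₂ e
  k_nonneg : 0 ≤ k
  B_nonneg : 0 ≤ B
  B_lt : B < b
  labels : vs.length * b ^ 2 ≤ S
  bw : ∀ e ∈ E, bits (wt₁ e) ≤ K' ∧ bits (wt₂ e) ≤ K'
  bkw : ∀ e ∈ E, bits (k * wt₁ e) ≤ K' ∧ bits (k * wt₂ e) ≤ K'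
  bk : bits k ≤ K'
  bB : bits B ≤ K'
  b0 : bits 0 ≤ K
  le : 4 * K' + 1 ≤ K

variable {K' b : ℕ} {vs : List ℚ} {s t k B : ℚ} {E : List warcTy.den}

/-- The weights of a label are sums of roundings, hence natural numbers, and at most `B`; so they
have no more bits than `B`. -/
theorem MGoodLabel.bits_le (h : MMBound K S K' b vs s k B E) {x}
    (hx : MGoodLabel wtail whead s (fun e => ((⌊k * wt₁ e⌋ : ℤ) : ℚ))
      (fun e => ((⌊k * wt₂ e⌋ : ℤ) : ℚ)) B E x) :
    bits x.1 ≤ K ∧ bits x.2.1.1 ≤ K' ∧ bits x.2.1.2 ≤ K' := by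
  have key : ∀ w : warcTy.den → ℚ, (∀ e ∈ E, 0 ≤ w e) → ∀ P ⊆ E,
      (P.map fun e => ((⌊k * w e⌋ : ℤ) : ℚ)).sum ≤ B →
      bits (P.map fun e => ((⌊k * w e⌋ : ℤ) : ℚ)).sum ≤ K' := by
    intro w hw P hP hB
    have : ∃ n : ℕ, (P.map fun e => ((⌊k * w e⌋ : ℤ) : ℚ)).sum = n := by
      clear hB
      induction P with
      | nil => exact ⟨0, by simp⟩
      | cons e P ih =>
        obtain ⟨he, hP⟩ := List.cons_subset.1 hP
        obtain ⟨n, hn⟩ := ih hP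
        obtain ⟨m, hm, -⟩ := exists_floor_eq (mul_nonneg h.k_nonneg (hw e he))
        exact ⟨m + n, by simp [hn, hm]⟩
    obtain ⟨n, hn⟩ := this
    rw [hn] at hB ⊢
    exact (bits_natCast_le hB).trans h.bB
  refine ⟨h.bv _ (hx.walk.mem_of_sub hx.sub h.s_mem h.head), ?_, ?_⟩
  · rw [← hx.sum₁]
    exact key wt₁ (fun e he => (h.nonneg e he).1) _ hx.sub (hx.sum₁.trans_le hx.le₁)
  · rw [← hx.sum₂]
    exact key wt₂ (fun e he => (h.nonneg e he).2) _ hx.sub (hx.sum₂.trans_le hx.le₂)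

theorem MMBound.length_le (h : MMBound K S K' b vs s k B E) {T}
    (hT : MGood wtail whead s (fun e => ((⌊k * wt₁ e⌋ : ℤ) : ℚ))
      (fun e => ((⌊k * wt₂ e⌋ : ℤ) : ℚ)) B E T) : T.length ≤ S := by
  refine (hT.length_le h.s_mem h.head (fun e he => ?_) (fun e he => ?_) h.B_lt).trans h.labels
  · obtain ⟨m, hm, -⟩ := exists_floor_eq (mul_nonneg h.k_nonneg (h.nonneg e he).1)
    exact ⟨m, hm⟩
  · obtain ⟨m, hm, -⟩ := exists_floor_eq (mul_nonneg h.k_nonneg (h.nonneg e he).2)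
    exact ⟨m, hm⟩

theorem cst_mmLabels (h : MMBound K S K' b vs s k B E) :
    Cst K (220 * S ^ 4) (mmLabels (.var vs) (.var s) (.var E) (.var k) (.var B)) := by
  set c₁ : warcTy.den → ℚ := fun e => ((⌊k * wt₁ e⌋ : ℤ) : ℚ) with hc₁
  set c₂ : warcTy.den → ℚ := fun e => ((⌊k * wt₂ e⌋ : ℤ) : ℚ) with hc₂
  have hKK : K' ≤ K := by have := h.le; omega
  have bc : ∀ e ∈ E, bits (c₁ e) ≤ K' ∧ bits (c₂ e) ≤ K' := fun e he =>
    ⟨(bits_floor_le (mul_nonneg h.k_nonneg (h.nonneg e he).1)).trans (h.bkw e he).1,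
      (bits_floor_le (mul_nonneg h.k_nonneg (h.nonneg e he).2)).trans (h.bkw e he).2⟩
  have hb : ∀ {x}, MGoodLabel wtail whead s c₁ c₂ B E x →
      bits x.1 ≤ K ∧ bits x.2.1.1 ≤ K ∧ bits x.2.1.2 ≤ K := fun hx => by
    obtain ⟨h1, h2, h3⟩ := MGoodLabel.bits_le h hx
    exact ⟨h1, h2.trans hKK, h3.trans hKK⟩
  have harc : ∀ T, MGood wtail whead s c₁ c₂ B E T → ∀ e ∈ E,
      Cst K (180 * S ^ 2) (extendArcTm (.var k) (.var B) (.var T) (.var e)) := by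
    intro T hT e he
    unfold extendArcTm
    have hS2 : 1 ≤ S ^ 2 := Nat.one_le_pow _ _ h.one
    refine Cst.mono (Cst.lets (Cst.floor (Cst.mul .var (Cst.fst (Cst.fst (Cst.snd .var)))
        (h.bk.trans hKK) ((h.bw e he).1.trans hKK)) ((h.bkw e he).1.trans hKK))
      (Cst.lets (n := 160 * S ^ 2) (Cst.floor (Cst.mul .var (Cst.snd (Cst.fst (Cst.snd .var)))
        (h.bk.trans hKK) ((h.bw e he).2.trans hKK)) ((h.bkw e he).2.trans hKK)) ?_))
      (by omega)
    refine Cst.loop_pow (MGood wtail whead s c₁ c₂ B E)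
      h.one .var .var (h.length_le hT) hT ?_ (c := 150) (by omega)
    intro T' hT' x hx
    have hx' := hT.label x hx
    refine ⟨?_, ?_⟩
    · have e1 := val_extendTm c₁ c₂ (.var B) e T' x
      have e2 := hT'.extend he hx'
      exact e1 ▸ e2
    · obtain ⟨h1, h2, h3⟩ := MGoodLabel.bits_le h hx'
      -- The new weights are computed before they are compared with `B`, so they may exceed it. One
      -- addition of numbers of `K'` bits gives at most `4 * K' + 1` bits.
      have h4 := bits_add_le x.2.1.1 (c₁ e)
      have h5 := bits_add_le x.2.1.2 (c₂ e)
      have h6 := bc e he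
      have h7 := h.le
      exact cst_extendTm h.one (h.length_le hT') (fun z hz => hb (hT'.label z hz)) (hb hx')
        ⟨h.bv _ (h.tail e he), h.bv _ (h.head e he)⟩ ⟨h6.1.trans hKK, h6.2.trans hKK⟩
        ⟨show bits (x.2.1.1 + c₁ e) ≤ K by omega, show bits (x.2.1.2 + c₂ e) ≤ K by omega⟩
        (h.bB.trans hKK)
  have : mmLabels (V := Ty.den) (.var vs) (.var s) (.var E) (.var k) (.var B) = loop (.var vs : Tm Ty.den (.list .num))
    (.cons (.pair (.var s) (.pair (.pair (.lit 0) (.lit 0)) .nil)) .nil) fun S _ =>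
    loop (.var E) S fun S e => extendArcTm (.var k) (.var B) S e := rfl
  rw [this]
  refine Cst.loop_pow (MGood wtail whead s c₁ c₂ B E) h.one .var
    (Cst.cons (Cst.pair .var (Cst.pair (Cst.pair (Cst.lit h.b0) (Cst.lit h.b0)) .nil)) .nil) h.lenV
    (mgood_init h.B_nonneg) ?_ (c := 184) (by omega)
  intro T hT _ _
  refine ⟨?_, Cst.loop_pow (MGood wtail whead s c₁ c₂ B E) h.one .var .var h.lenE hT ?_
    (c := 180) (by omega)⟩
  · have := (extendAll_aux hT (List.Subset.refl E)).1
    simp only [val_loop, val_extendArcTm]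
    exact this
  · intro T' hT' e he
    refine ⟨?_, harc T' hT' e he⟩
    rw [val_extendArcTm]
    exact (extendArc_aux he hT' hT'.label).1

theorem cst_mmSelect (h : MMBound K S K' b vs s k B E) (ht : t ∈ vs) :
    Cst K (300 * S ^ 4)
      (mmSelect (mmLabels (.var vs) (.var s) (.var E) (.var k) (.var B)) (.var t) (.var B)) := by
  set c₁ : warcTy.den → ℚ := fun e => ((⌊k * wt₁ e⌋ : ℤ) : ℚ) with hc₁
  set c₂ : warcTy.den → ℚ := fun e => ((⌊k * wt₂ e⌋ : ℤ) : ℚ) with hc₂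
  have hKK : K' ≤ K := by have := h.le; omega
  have hn₁ : ∀ e ∈ E, 0 ≤ c₁ e := fun e he => by
    simpa [hc₁] using Int.floor_nonneg.2 (mul_nonneg h.k_nonneg (h.nonneg e he).1)
  have hn₂ : ∀ e ∈ E, 0 ≤ c₂ e := fun e he => by
    simpa [hc₂] using Int.floor_nonneg.2 (mul_nonneg h.k_nonneg (h.nonneg e he).2)
  obtain ⟨hG, -⟩ := mrounds_spec (s := s) (tl := wtail) (hd := whead) h.B_nonneg hn₁ hn₂ vs
  have hval : (mmLabels (.var vs) (.var s) (.var E) (.var k) (.var B)).val = vs.foldl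
      (fun S _ => extendAll wtail whead c₁ c₂ B E S) [(s, (0, 0), [])] := by
    rw [val_mmLabels]; rfl
  set T := vs.foldl (fun S _ => extendAll wtail whead c₁ c₂ B E S) [(s, (0, 0), [])]
  have hTl : T.length ≤ S := h.length_le hG
  have hS4 : S ≤ S ^ 4 := by
    calc S = S ^ 1 := (pow_one S).symm
      _ ≤ S ^ 4 := Nat.pow_le_pow_right h.one (by omega)
  unfold mmSelect
  refine Cst.mono (Cst.snd (Cst.loop (k := 60) (fun r => bits r.1 ≤ K) (cst_mmLabels h)
    (Cst.pair .var .nil) (h.bB.trans hKK) ?_)) (by rw [hval]; have := h.one; omega)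
  intro r hr x hx
  rw [hval] at hx
  obtain ⟨h1, h2, h3⟩ := MGoodLabel.bits_le h (hG.label x hx)
  have hm : bits (max x.2.1.1 x.2.1.2) ≤ K := by
    rcases max_choice x.2.1.1 x.2.1.2 with h | h <;> rw [h] <;> omega
  refine ⟨?_, ?_⟩
  · simp only [val_cond, val_eq, val_fst, val_snd, val_var, val_lets, val_maxOf, val_le, val_pair]
    split_ifs
    · exact hm
    · exact hr
    · exact hr
  · refine Cst.mono (Cst.cond (Cst.eq (Cst.fst .var) .var h1 (h.bv _ ht)) (fun _ => Cst.lets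
      (Cst.maxOf (Cst.fst (Cst.fst (Cst.snd .var))) (Cst.snd (Cst.fst (Cst.snd .var)))
        (h2.trans hKK) (h3.trans hKK)) (Cst.cond (Cst.le .var (Cst.fst .var) ?_ hr)
          (fun _ => Cst.pair .var (Cst.snd (Cst.snd .var))) fun _ => .var)) fun _ => .var)
      (by omega)
    rw [val_var, val_maxOf]
    exact hm

end MM

/-! ### Cost of the complete min-max path algorithm. -/

section ABVCost

/-- The part of the algorithm that works with scaled weights. -/
def abvScaled {V : Ty → Type} (ε : Tm V .num) (vs : Tm V (.list .num)) (s t : Tm V .num)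
    (E : Tm V (.list warcTy)) (U L : Tm V .num) : Tm V (.list warcTy) :=
  lets (sumOf vs (fun _ => .lit 1) / (ε * L)) fun k => lets (U * k) fun B =>
    lets (mmSelect (mmLabels vs s E k B) t B) fun Q => shortestPath vs s t Q

/-- The hypotheses on the numbers and list lengths for the min-max path algorithm. -/
structure ABVBound (K₀ K S D X b : ℕ) (ε : ℚ) (vs : List ℚ) (s t : ℚ) (E : List warcTy.den) :
    Prop where
  sp : SPBound K S D X vs s E
  t_mem : t ∈ vs
  eps : 0 < ε
  beps : bits ε ≤ K₀
  bn : bits (vs.length : ℚ) ≤ K₀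
  bits₀ : ∀ q, Rep D (vs.length * (2 * X) + 2 * X) q → bits q ≤ K₀
  le : 16 * K₀ + 20 ≤ K
  lt : 2 * vs.length / ε < b
  labels : vs.length * b ^ 2 ≤ S
  lenQ : vs.length * E.length ≤ S
  walk : ∃ P, P ⊆ E ∧ RWalk wtail whead s P t ∧ (s :: P.map whead).Nodup

variable {K₀ K S D X b : ℕ} {ε : ℚ} {vs : List ℚ} {s t : ℚ} {E : List warcTy.den}

theorem le_pow_four (h : 1 ≤ S) : S ≤ S ^ 4 := by
  calc S = S ^ 1 := (pow_one S).symm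
    _ ≤ S ^ 4 := Nat.pow_le_pow_right h (by omega)

theorem cst_abvScaled (h : ABVBound K₀ K S D X b ε vs s t E) {U L : ℚ} (hL : 0 < L) (hU : 0 ≤ U)
    (hUL : U ≤ 2 * L) (bU : bits U ≤ K₀) (bL : bits L ≤ K₀ + 3) {R : List warcTy.den}
    (hRE : R ⊆ E) (hRw : RWalk wtail whead s R t) (hRn : (s :: R.map whead).Nodup)
    (hR₁ : (R.map wt₁).sum ≤ U) (hR₂ : (R.map wt₂).sum ≤ U) :
    Cst K (600 * S ^ 4)
      (abvScaled (.var ε) (.var vs) (.var s) (.var t) (.var E) (.var U) (.var L)) := by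
  have hS4 := le_pow_four h.sp.one
  have hle := h.le
  have hn : (sumOf (.var vs : Tm Ty.den (.list .num)) fun _ => .lit 1).val = (vs.length : ℚ) := by
    rw [val_sumOf]; simp
  have hlen := List.length_pos_of_mem h.sp.s_mem
  have bnat : ∀ m : ℕ, m ≤ vs.length → bits (m : ℚ) ≤ K := fun m hm =>
    (bits_natCast_le (by exact_mod_cast hm)).trans (h.bn.trans (by omega))
  have b1 : bits 1 ≤ K := by simpa using bnat 1 hlen
  set k : ℚ := (vs.length : ℚ) / (ε * L) with hk
  have hεL : 0 < ε * L := mul_pos h.eps hL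
  have hlen' : (0 : ℚ) < vs.length := by exact_mod_cast hlen
  have hk0 : 0 < k := div_pos hlen' hεL
  have bεL : bits (ε * L) ≤ 2 * K₀ + 3 := (bits_mul_le _ _).trans (by have := h.beps; omega)
  have bk : bits k ≤ 3 * K₀ + 3 := (bits_div_le _ _).trans (by have := h.bn; omega)
  set B : ℚ := U * k with hB
  have bB : bits B ≤ 4 * K₀ + 3 := (bits_mul_le _ _).trans (by omega)
  have bw : ∀ e ∈ E, bits (wt₁ e) ≤ K₀ ∧ bits (wt₂ e) ≤ K₀ := fun e he =>
    ⟨h.bits₀ _ ((h.sp.rep e he).1.mono (by omega)), h.bits₀ _ ((h.sp.rep e he).2.mono (by omega))⟩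
  have hmm : MMBound K S (4 * K₀ + 3) b vs s k B E :=
    { one := h.sp.one, lenV := h.sp.lenV, lenE := h.sp.lenE, s_mem := h.sp.s_mem
      head := h.sp.head, tail := h.sp.tail, bv := h.sp.bv, nonneg := h.sp.nonneg
      k_nonneg := hk0.le, B_nonneg := mul_nonneg hU hk0.le
      B_lt := by
        -- From `U ≤ 2 * L` one gets `U * k ≤ 2 * |V| / ε`: the budget does not depend on the size
        -- of the weights.
        refine lt_of_le_of_lt ?_ h.lt
        rw [hB, hk, ← mul_div_assoc, div_le_div_iff₀ hεL h.eps]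
        have h1 : U * (vs.length * ε) ≤ 2 * L * (vs.length * ε) :=
          mul_le_mul_of_nonneg_right hUL (mul_nonneg hlen'.le h.eps.le)
        linarith
      labels := h.labels
      bw := fun e he => ⟨(bw e he).1.trans (by omega), (bw e he).2.trans (by omega)⟩
      bkw := fun e he => ⟨(bits_mul_le _ _).trans (by have := (bw e he).1; omega),
        (bits_mul_le _ _).trans (by have := (bw e he).2; omega)⟩
      bk := by omega
      bB := bB
      b0 := h.sp.bits 0 Rep.zero
      le := by omega }
  obtain ⟨Q, hQ, hQE, hQw, hQl, -⟩ := mmSelect_spec (vs := .var vs) (s := .var s) (t := .var t)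
    (E := .var E) (k := .var k) (B := .var B) h.sp.s_mem h.sp.head
    (fun e he => (h.sp.nonneg e he).1) (fun e he => (h.sp.nonneg e he).2) hk0
    (mul_nonneg hU hk0.le) hRE hRw hRn
    (by simp only [val_var, hB]; rw [mul_comm]; exact mul_le_mul_of_nonneg_right hR₁ hk0.le)
    (by simp only [val_var, hB]; rw [mul_comm]; exact mul_le_mul_of_nonneg_right hR₂ hk0.le)
  simp only [val_var] at hQE hQl
  -- The walk `Q` can repeat arcs, so its length is controlled by `|V| * |E|`; hence the requirement
  -- that `S` bound this product.
  have hspQ : SPBound K S D X vs s Q :=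
    { one := h.sp.one, lenV := h.sp.lenV, lenE := hQl.trans h.lenQ, s_mem := h.sp.s_mem
      head := fun e he => h.sp.head e (hQE he), tail := fun e he => h.sp.tail e (hQE he)
      bv := h.sp.bv, nonneg := fun e he => h.sp.nonneg e (hQE he)
      rep := fun e he => h.sp.rep e (hQE he), bits := h.sp.bits }
  have hlenS := h.sp.lenV
  unfold abvScaled
  refine Cst.mono (Cst.lets (m := 10 * S + 10) (n := 560 * S ^ 4) (Cst.mono (Cst.div (Cst.sumOf
    (k := 1) .var (fun _ _ => Cst.lit b1) (fun _ _ => b1) ?_) (Cst.mul .var .var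
    (h.beps.trans (by omega)) (bL.trans (by omega))) ?_ ?_) ?_) ?_) (by have := h.sp.one; omega)
  · intro l' hl'
    have := bnat l'.length hl'.length_le
    simpa using this
  · rw [hn]; exact bnat _ le_rfl
  · exact bεL.trans (by omega)
  · simp only [val_var]; omega
  · rw [val_div, hn]
    simp only [val_mul, val_var]
    rw [← hk]
    refine Cst.mono (Cst.lets (Cst.mul .var .var (bU.trans (by omega)) (bk.trans (by omega)))
      (Cst.lets (cst_mmSelect (t := t) hmm h.t_mem) (n := 200 * S ^ 4) ?_))
      (by have := h.sp.one; omega)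
    have e : (mmSelect (mmLabels (.var vs) (.var s) (.var E) (.var k)
      (.var ((Tm.var U * .var k : Tm Ty.den .num)).val)) (.var t)
      (.var ((Tm.var U * .var k : Tm Ty.den .num)).val)).val = Q := hQ
    rw [e]
    exact cst_shortestPath hspQ h.t_mem

theorem cst_abv (h : ABVBound K₀ K S D X b ε vs s t E) :
    Cst K (1000 * S ^ 4) (abv (.var ε) (.var vs) (.var s) (.var t) (.var E)) := by
  have hS4 := le_pow_four h.sp.one
  have hle := h.le
  obtain ⟨P, hPE, hPw, hPn⟩ := h.walk
  have hlen : ∀ P, P ⊆ E → (s :: P.map whead).Nodup → P.length ≤ vs.length := by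
    intro P hPE hP
    exact Nat.le_of_succ_le (length_lt_of_simple hP (List.cons_subset.2 ⟨h.sp.s_mem, fun v hv => by
      obtain ⟨e, he, rfl⟩ := List.mem_map.1 hv
      exact h.sp.head e (hPE he)⟩))
  obtain ⟨R, hR, hRE, hRw, hRn, -⟩ := shortestPath_spec (vs := .var vs) (s := .var s)
    (t := .var t) (E := .var E) (fun e he => add_nonneg (h.sp.nonneg e he).1 (h.sp.nonneg e he).2)
    hPE hPw (hlen P hPE hPn)
  simp only [val_var] at hRE hRw hRn
  have hRl := hlen R hRE hRn
  have hlenS := h.sp.lenV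
  have b0 : bits 0 ≤ K := h.sp.bits 0 Rep.zero
  have hwK : ∀ e ∈ E, bits (wt₁ e) ≤ K ∧ bits (wt₂ e) ≤ K := fun e he =>
    ⟨h.sp.bits _ ((h.sp.rep e he).1.mono (by omega)),
      h.sp.bits _ ((h.sp.rep e he).2.mono (by omega))⟩
  have hsum : ∀ w : warcTy.den → ℚ, (∀ e ∈ E, Rep D X (w e)) → ∀ l : List warcTy.den, l ⊆ E →
      l.length ≤ vs.length → Rep D (vs.length * X) (l.map w).sum := fun w hw l hl hl' =>
    Rep.sum_map_of_le (fun e he => hw e (hl he)) hl'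
  have hr₁ := hsum wt₁ (fun e he => (h.sp.rep e he).1)
  have hr₂ := hsum wt₂ (fun e he => (h.sp.rep e he).2)
  have hRE' : R.reverse ⊆ E := fun e he => hRE (List.mem_reverse.1 he)
  have hX : vs.length * X + vs.length * X = vs.length * (2 * X) := by ring
  have hpre : ∀ l', l' <+: R.reverse → l' ⊆ E ∧ l'.length ≤ vs.length := fun l' hl' =>
    ⟨fun e he => hRE' (hl'.subset he), hl'.length_le.trans (by simpa using hRl)⟩
  set W₁ : ℚ := (R.map wt₁).sum with hW₁
  set W₂ : ℚ := (R.map wt₂).sum with hW₂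
  have rW₁ : Rep D (vs.length * X) W₁ := hr₁ R hRE hRl
  have rW₂ : Rep D (vs.length * X) W₂ := hr₂ R hRE hRl
  have hW₁0 : 0 ≤ W₁ := sum_map_nonneg fun e he => (h.sp.nonneg e (hRE he)).1
  have hW₂0 : 0 ≤ W₂ := sum_map_nonneg fun e he => (h.sp.nonneg e (hRE he)).2
  have v₁ : (sumOf (.var R.reverse) w₁).val = W₁ := by
    rw [val_sumOf, val_var, List.map_reverse, List.sum_reverse]; rfl
  have v₂ : (sumOf (.var R.reverse) w₂).val = W₂ := by
    rw [val_sumOf, val_var, List.map_reverse, List.sum_reverse]; rfl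
  have bsum : bits (W₁ + W₂) ≤ K₀ := h.bits₀ _ ((rW₁.add rW₂).mono (by omega))
  have b2 : bits 2 = 3 := by decide
  have bU : bits (max W₁ W₂) ≤ K₀ := h.bits₀ _ ((rW₁.max rW₂).mono (by omega))
  have bL : bits ((W₁ + W₂) / 2) ≤ K₀ + 3 := (bits_div_le _ _).trans (by omega)
  have e : abv (V := Ty.den) (.var ε) (.var vs) (.var s) (.var t) (.var E) =
    lets (.var E) fun E => lets (shortestPath (.var vs) (.var s) (.var t) E) fun P₀ =>
    lets (sumOf P₀ w₁) fun W₁ => lets (sumOf P₀ w₂) fun W₂ =>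
    lets (maxOf W₁ W₂) fun U => lets ((W₁ + W₂) / .lit 2) fun L =>
    .cond (.le U (.lit 0)) P₀ (abvScaled (.var ε) (.var vs) (.var s) (.var t) E U L) := rfl
  rw [e]
  refine Cst.mono (Cst.lets .var (Cst.lets (cst_shortestPath h.sp h.t_mem)
    (n := 750 * S ^ 4) ?_)) (by have := h.sp.one; omega)
  have hR' : (shortestPath (.var vs) (.var s) (.var t)
    (.var (Tm.var E : Tm Ty.den (.list warcTy)).val)).val = R.reverse := hR
  rw [hR']
  refine Cst.mono (Cst.lets (Cst.sumOf (k := 4) .var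
      (fun e he => Cst.fst (Cst.fst (Cst.snd .var))) (fun e he => (hwK e (hRE' he)).1)
      (fun l' hl' => h.sp.bits _ ((hr₁ l' (hpre l' hl').1 (hpre l' hl').2).mono (by omega))))
    (Cst.lets (Cst.sumOf (k := 4) .var (fun e he => Cst.snd (Cst.fst (Cst.snd .var)))
      (fun e he => (hwK e (hRE' he)).2)
      (fun l' hl' => h.sp.bits _ ((hr₂ l' (hpre l' hl').1 (hpre l' hl').2).mono (by omega))))
      (n := 700 * S ^ 4) ?_))
    (by simp only [val_var, List.length_reverse]; have := h.sp.one; omega)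
  rw [v₁, v₂]
  refine Cst.mono (Cst.lets (Cst.maxOf .var .var (h.sp.bits _ (rW₁.mono (by omega)))
    (h.sp.bits _ (rW₂.mono (by omega)))) (Cst.lets (Cst.div (Cst.add .var .var
    (h.sp.bits _ (rW₁.mono (by omega))) (h.sp.bits _ (rW₂.mono (by omega))))
    (Cst.lit (by omega)) (bsum.trans (by omega)) (show bits 2 ≤ K by omega)) (n := 610 * S ^ 4) ?_))
    (by have := h.sp.one; omega)
  simp only [val_maxOf, val_div, val_add, val_var, val_lit]
  refine Cst.mono (Cst.cond (n := 600 * S ^ 4) (Cst.le .var (Cst.lit b0) (bU.trans (by omega)) b0)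
    (fun _ => .var) fun hc => ?_) (by have := h.sp.one; omega)
  have hU : 0 < max W₁ W₂ := not_le.1 (of_decide_eq_false hc)
  exact cst_abvScaled h (by rcases lt_max_iff.1 hU with h | h <;> linarith) hU.le
    (max_le (by linarith) (by linarith)) bU bL hRE hRw hRn (le_max_left _ _) (le_max_right _ _)

end ABVCost

/-! ### The cost of the open shop algorithm -/

section GSCost

variable {K S D X : ℕ}

/-- Needed for the layout, whose accumulated times are bounded as partial sums over the jobs already
placed. -/
theorem Cst.loop_of_prefix {m n k : ℕ} {a b : Ty} {l : Tm Ty.den (.list a)} {i : Tm Ty.den b}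
    {f : Tm Ty.den b → Tm Ty.den a → Tm Ty.den b} (hl : Cst K m l) (hi : Cst K n i)
    (h : ∀ l₁ x, l₁ ++ [x] <+: l.val →
      Cst K k (f (.var (l₁.foldl (fun b x => (f (.var b) (.var x)).val) i.val)) (.var x))) :
    Cst K (m + n + l.val.length * (k + 1) + 1) (OpenShopPath.loop l i f) := by
  have := foldCost_le_of_prefix (l := l.val) (b := i.val) (M := k * (4 * K ^ 2 + 1))
    (step := fun b x => (f (.var b) (.var x)).val) (c := fun b x => (f (.var b) (.var x)).cost) h
  simp only [Cst, OpenShopPath.loop, Tm.cost] at *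
  refine (Nat.add_le_add_right (Nat.add_le_add (Nat.add_le_add hl hi) this) 1).trans ?_
  have : l.val.length * (k * (4 * K ^ 2 + 1) + 1)
      ≤ l.val.length * ((k + 1) * (4 * K ^ 2 + 1)) := by
    apply Nat.mul_le_mul_left; nlinarith
  nlinarith

theorem foldl_layout (J : List arcTy.den) (r : List entryTy.den) (x y : ℚ) :
    (J.foldl (fun (st : List entryTy.den × ℚ × ℚ) j =>
      ((j, st.2.1, st.2.2) :: st.1, st.2.1 + pt₁ j, st.2.2 + pt₂ j)) (r, x, y)).2
      = (x + (J.map pt₁).sum, y + (J.map pt₂).sum) := by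
  induction J generalizing r x y with
  | nil => simp
  | cons j J ih => rw [List.foldl_cons, ih]; simp [add_assoc]

theorem cst_layout {J : Tm Ty.den (.list arcTy)} {x y : Tm Ty.den .num} {m n n' : ℕ}
    (hJ : Cst K m J) (hx : Cst K n x) (hy : Cst K n' y)
    (hp : ∀ j ∈ J.val, bits (pt₁ j) ≤ K ∧ bits (pt₂ j) ≤ K)
    (hs : ∀ l', l' <+: J.val → bits (HAdd.hAdd (α := ℚ) (β := ℚ) (γ := ℚ) x.val (l'.map pt₁).sum) ≤ K ∧
      bits (HAdd.hAdd (α := ℚ) (β := ℚ) (γ := ℚ) y.val (l'.map pt₂).sum) ≤ K) :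
    Cst K (m + n + n' + J.val.length * 60 + 10) (layout J x y) := by
  refine Cst.mono (Cst.fst (Cst.loop_of_prefix (k := 59) hJ (Cst.pair .nil (Cst.pair hx hy)) ?_))
    (by omega)
  intro l₁ j hj
  have hjJ : j ∈ J.val := hj.subset (by simp)
  have e := foldl_layout l₁ [] x.val y.val
  obtain ⟨h1, h2⟩ := hs l₁ ((List.prefix_append _ _).trans hj)
  obtain ⟨h3, h4⟩ := hp j hjJ
  have e' : (l₁.foldl (fun (b : Ty.den (.prod (.list entryTy) (.prod .num .num))) x =>
      (Tm.pair (.cons (mkEntry (.var x) (Tm.var b).snd.fst (Tm.var b).snd.snd) (Tm.var b).fst)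
        (.pair ((Tm.var b).snd.fst + p₁ (.var x)) ((Tm.var b).snd.snd + p₂ (.var x))) :
          Tm Ty.den (.prod (.list entryTy) (.prod .num .num))).val)
      (Tm.pair (.nil : Tm Ty.den (.list entryTy)) (.pair x y)).val).2
      = (HAdd.hAdd (α := ℚ) (β := ℚ) (γ := ℚ) x.val (l₁.map pt₁).sum,
        HAdd.hAdd (α := ℚ) (β := ℚ) (γ := ℚ) y.val (l₁.map pt₂).sum) := e
  generalize (l₁.foldl _ (Tm.pair (.nil : Tm Ty.den (.list entryTy)) (.pair x y)).val) = st at e' ⊢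
  clear e
  have b1 : bits st.2.1 ≤ K := by rw [e']; exact h1
  have b2 : bits st.2.2 ≤ K := by rw [e']; exact h2
  exact Cst.mono (Cst.pair (Cst.cons (Cst.pair .var (Cst.pair (Cst.fst (Cst.snd .var))
    (Cst.snd (Cst.snd .var)))) (Cst.fst .var)) (Cst.pair
    (Cst.add (Cst.fst (Cst.snd .var)) (Cst.fst (Cst.snd (Cst.snd (Cst.snd .var)))) b1 h3)
    (Cst.add (Cst.snd (Cst.snd .var)) (Cst.snd (Cst.snd (Cst.snd (Cst.snd .var)))) b2 h4)))
    (by omega)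

/-- The hypotheses on the numbers for the open shop algorithm. -/
structure GSBound (K D X : ℕ) (J : List arcTy.den) : Prop where
  two : 2 ≤ K
  nonneg : ∀ j ∈ J, 0 ≤ pt₁ j ∧ 0 ≤ pt₂ j
  rep : ∀ j ∈ J, Rep D X (pt₁ j) ∧ Rep D X (pt₂ j)
  bid : ∀ j ∈ J, bits j.1 ≤ K
  bits : ∀ q, Rep D (20 * ((J.length + 2) * X)) q → bits q ≤ K

variable {J : List arcTy.den}

theorem GSBound.rep' (h : GSBound K D X J) {j : arcTy.den} (hj : j = dummyJob ∨ j ∈ J) :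
    Rep D X (pt₁ j) ∧ Rep D X (pt₂ j) := by
  rcases hj with rfl | hj
  · exact ⟨Rep.zero, Rep.zero⟩
  · exact h.rep j hj

theorem GSBound.le (J : List arcTy.den) (X : ℕ) : X ≤ (J.length + 2) * X ∧
    J.length * X ≤ (J.length + 2) * X :=
  ⟨Nat.le_mul_of_pos_left _ (by omega), Nat.mul_le_mul_right _ (by omega)⟩

theorem GSBound.bp (h : GSBound K D X J) {j : arcTy.den} (hj : j = dummyJob ∨ j ∈ J) :
    OpenShopPath.bits (pt₁ j) ≤ K ∧ OpenShopPath.bits (pt₂ j) ≤ K := by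
  have := GSBound.le J X
  exact ⟨h.bits _ ((h.rep' hj).1.mono (by omega)), h.bits _ ((h.rep' hj).2.mono (by omega))⟩

theorem cst_dummy (h : GSBound K D X J) : Cst K 9 (dummy : Tm Ty.den arcTy) := by
  have b0 : bits 0 ≤ K := h.bits 0 Rep.zero
  have b1 : bits (-1) ≤ K := le_trans (by decide) h.two
  exact Cst.mono (Cst.pair (Cst.lit b1) (Cst.pair (Cst.lit b0) (Cst.pair (Cst.lit b0)
    (Cst.pair (Cst.lit b0) (Cst.lit b0))))) (by omega)

/-- Only the processing times of `j` and of the candidates `r`, `l` are compared, so the invariant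
can ignore the two lists. -/
theorem cst_gsSplit (h : GSBound K D X J) :
    Cst K (J.length * 151 + 30) (gsSplit (.var J)) := by
  refine Cst.mono (Cst.loop (k := 150)
    (fun x => (x.2.1 = dummyJob ∨ x.2.1 ∈ J) ∧ (x.2.2 = dummyJob ∨ x.2.2 ∈ J)) .var
    (Cst.pair (Cst.pair .nil .nil) (Cst.pair (cst_dummy h) (cst_dummy h)))
    ⟨Or.inl rfl, Or.inl rfl⟩ ?_) (by simp only [val_var]; omega)
  rintro x ⟨hr, hl⟩ j hj
  have hj' : j = dummyJob ∨ j ∈ J := Or.inr hj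
  refine ⟨?_, ?_⟩
  · simp only [val_lets, val_cond, val_pair, val_fst, val_snd, val_var, val_cons]
    split_ifs
    · exact ⟨hj', hl⟩
    · exact ⟨hr, hl⟩
    · exact ⟨hr, hj'⟩
    · exact ⟨hr, hl⟩
  · have c₁ : ∀ y : arcTy.den, Cst K 5 (p₁ (.var y)) := fun y =>
      Cst.fst (Cst.snd (Cst.snd (Cst.snd .var)))
    have c₂ : ∀ y : arcTy.den, Cst K 5 (p₂ (.var y)) := fun y =>
      Cst.snd (Cst.snd (Cst.snd (Cst.snd .var)))
    refine Cst.mono (Cst.lets (Cst.fst (Cst.fst .var)) (Cst.lets (Cst.snd (Cst.fst .var))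
      (Cst.lets (Cst.fst (Cst.snd .var)) (Cst.lets (Cst.snd (Cst.snd .var))
      (Cst.cond (Cst.le (c₂ _) (c₁ _) (h.bp hj').2 (h.bp hj').1)
        (fun _ => Cst.cond (Cst.le (c₁ _) (c₁ _) (h.bp hr).1 (h.bp hj').1)
          (fun _ => Cst.pair (Cst.pair (Cst.cons .var .var) .var) (Cst.pair .var .var))
          (fun _ => Cst.pair (Cst.pair (Cst.cons .var .var) .var) (Cst.pair .var .var)))
        (fun _ => Cst.cond (Cst.le (c₂ _) (c₂ _) (h.bp hl).2 (h.bp hj').2)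
          (fun _ => Cst.pair (Cst.pair .var (Cst.cons .var .var)) (Cst.pair .var .var))
          (fun _ => Cst.pair (Cst.pair .var (Cst.cons .var .var)) (Cst.pair .var .var)))))))) (by omega)

theorem split_facts (J : List arcTy.den) :
    let x := J.foldl splitStep (([], []), (dummyJob, dummyJob))
    (∀ j, j ∈ x.2.1 :: x.2.2 :: (x.1.2 ++ x.1.1) → j = dummyJob ∨ j ∈ J) ∧
      x.1.2.length + x.1.1.length = J.length := by
  obtain ⟨hp, -, -⟩ := split_spec J
  refine ⟨fun j hj => ?_, ?_⟩
  · have := hp.subset hj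
    simp only [List.mem_cons] at this
    tauto
  · have := hp.length_eq
    simpa using this

/-- With `Z = (|J| + 2) * X`, where the `2` counts the dummies, an offset such as `T₁ - T₂ + p₂ r`
is at most `3 * Z` in absolute value, and the jobs placed before add at most `Z`. -/
theorem gsEntries_facts (h : GSBound K D X J) :
    (gsEntries J).length = J.length + 2 ∧ ∀ a ∈ gsEntries J, (a.1 = dummyJob ∨ a.1 ∈ J) ∧
      Rep D (4 * ((J.length + 2) * X)) a.2.1 ∧ Rep D (4 * ((J.length + 2) * X)) a.2.2 := by
  obtain ⟨C, -, hp, -, -⟩ := gsEntries_spec J h.nonneg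
  refine ⟨by simpa using hp.length_eq, fun a ha => ⟨?_, ?_⟩⟩
  · have := hp.subset (List.mem_map.2 ⟨a, ha, rfl⟩)
    simp only [List.mem_cons] at this
    tauto
  · obtain ⟨h1, h2⟩ := split_facts J
    have hZ := GSBound.le J X
    have r₁ : Rep D (J.length * X) (J.map pt₁).sum := Rep.sum_map fun j hj => (h.rep j hj).1
    have r₂ : Rep D (J.length * X) (J.map pt₂).sum := Rep.sum_map fun j hj => (h.rep j hj).2
    have hlay : ∀ (L : List arcTy.den) (x y : ℚ), (∀ j ∈ L, j = dummyJob ∨ j ∈ J) →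
        L.length ≤ J.length + 2 → Rep D (3 * ((J.length + 2) * X)) x →
        Rep D (3 * ((J.length + 2) * X)) y → ∀ a ∈ (lay pt₁ pt₂ L x y).reverse,
        Rep D (4 * ((J.length + 2) * X)) a.2.1 ∧ Rep D (4 * ((J.length + 2) * X)) a.2.2 := by
      intro L x y hL hl hx hy a ha
      obtain ⟨J₁, J₂, e1, e2, e3⟩ := mem_lay (List.mem_reverse.1 ha)
      have hJ₁ : ∀ j ∈ J₁, j = dummyJob ∨ j ∈ J := fun j hj => hL j (by rw [e1]; simp [hj])
      have hl₁ : J₁.length ≤ J.length + 2 := by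
        have := congrArg List.length e1
        simp at this; omega
      rw [e2, e3]
      exact ⟨(hx.add (Rep.sum_map_of_le (fun j hj => (h.rep' (hJ₁ j hj)).1) hl₁)).mono (by omega),
        (hy.add (Rep.sum_map_of_le (fun j hj => (h.rep' (hJ₁ j hj)).2) hl₁)).mono (by omega)⟩
    unfold gsEntries at ha
    generalize J.foldl splitStep (([], []), (dummyJob, dummyJob)) = x at *
    obtain ⟨⟨A, B⟩, r, l⟩ := x
    simp only at h1 h2 ha
    have hr := h.rep' (h1 r (by simp))
    have hl := h.rep' (h1 l (by simp))
    split_ifs at ha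
    · rcases List.mem_cons.1 ha with rfl | ha
      · exact ⟨((r₁.sub hr.1).mono (by omega)).max (hr.2.mono (by omega)), Rep.zero⟩
      · refine hlay _ _ _ (fun j hj => h1 j (List.mem_cons_of_mem _ hj)) (by simp; omega) Rep.zero
          ((hr.2.mono (by omega)).max (((r₁.sub r₂).add hr.2).mono (by omega))) a ha
    · rcases List.mem_cons.1 ha with rfl | ha
      · exact ⟨Rep.zero, ((r₂.sub hl.2).mono (by omega)).max (hl.1.mono (by omega))⟩
      · refine hlay _ _ _ (fun j hj => h1 j ?_) (by simp; omega)
          ((hl.1.mono (by omega)).max (((r₂.sub r₁).add hl.1).mono (by omega))) Rep.zero a ha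
        simp only [List.mem_cons, List.mem_append] at hj ⊢; tauto

theorem rep_completion (h : GSBound K D X J) {σ : List entryTy.den} (hσ : σ ⊆ gsEntries J) :
    Rep D (5 * ((J.length + 2) * X)) (completion σ) := by
  have hZ := GSBound.le J X
  induction σ using List.reverseRecOn with
  | nil => exact Rep.zero
  | append_singleton σ a ih =>
    have e : completion (σ ++ [a])
        = max (completion σ) (max (a.2.1 + pt₁ a.1) (a.2.2 + pt₂ a.1)) := by
      rw [completion, List.foldl_append]; rfl
    rw [e]
    obtain ⟨h1, h2, h3⟩ := (gsEntries_facts h).2 a (hσ (by simp))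
    exact (ih fun b hb => hσ (by simp [hb])).max (((h2.add (h.rep' h1).1).mono (by omega)).max
      ((h3.add (h.rep' h1).2).mono (by omega)))

theorem bits_gs (h : GSBound K D X J) : bits (gs (.var J)).val.2 ≤ K := by
  rw [val_gs]
  exact h.bits _ ((rep_completion h (List.filter_subset_self _)).mono (by omega))

/-- The schedule computed by the algorithm, before the dummy jobs are removed. -/
def gsRaw {V : Ty → Type} (A' B' : Tm V (.list arcTy)) (r l : Tm V arcTy) (T₁ T₂ : Tm V .num) :
    Tm V (.list entryTy) :=
  .cond (.le (T₂ - p₂ r) (T₁ - p₁ l))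
    (.cons (mkEntry r (maxOf (T₁ - p₁ r) (p₂ r)) (.lit 0))
      (layout (.cons l (append B' A')) (.lit 0) (maxOf (p₂ r) (T₁ - T₂ + p₂ r))))
    (.cons (mkEntry l (.lit 0) (maxOf (T₂ - p₂ l) (p₁ l)))
      (layout (.cons r (append A' B')) (maxOf (p₁ l) (T₂ - T₁ + p₁ l)) (.lit 0)))

/-- Removal of the dummy jobs and computation of the makespan. -/
def gsFinish {V : Ty → Type} (σ : Tm V (.list entryTy)) : Tm V (.prod (.list entryTy) .num) :=
  lets (filter σ fun x => .le (.lit 0) (jobId x.fst)) fun σ =>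
  .pair σ (loop σ (.lit 0) fun C x =>
    maxOf C (maxOf (start₁ x + p₁ x.fst) (start₂ x + p₂ x.fst)))

theorem cst_gsFinish (h : GSBound K D X J) :
    Cst K (80 * J.length + 200) (gsFinish (.var (gsEntries J))) := by
  obtain ⟨hlen, hf⟩ := gsEntries_facts h
  have hZ := GSBound.le J X
  have b0 : bits 0 ≤ K := h.bits 0 Rep.zero
  have bid : ∀ a ∈ gsEntries J, bits a.1.1 ≤ K := fun a ha => by
    rcases (hf a ha).1 with e | e
    · rw [e]; exact le_trans (by decide) h.two
    · exact h.bid _ e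
  refine Cst.mono (Cst.lets (Cst.filter (k := 5) .var fun x hx =>
    Cst.mono (Cst.le (Cst.lit b0) (Cst.fst (Cst.fst .var)) b0 (bid x hx)) (by omega))
    (n := 60 * J.length + 150) ?_) (by simp only [val_var, hlen]; omega)
  set σ := (filter (.var (gsEntries J)) fun x => .le (.lit 0) (jobId x.fst)).val with hσ
  have hσJ : σ ⊆ gsEntries J := by
    rw [hσ, val_filter]; exact List.filter_subset_self _
  have hσl : σ.length ≤ J.length + 2 := by
    rw [hσ, val_filter, ← hlen]; exact List.length_filter_le _ _
  refine Cst.mono (Cst.pair .var (Cst.loop (k := 50)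
    (fun C => Rep D (5 * ((J.length + 2) * X)) C) .var (Cst.lit b0) Rep.zero ?_))
    (by simp only [val_var]; omega)
  intro C hC x hx
  obtain ⟨h1, h2, h3⟩ := hf x (hσJ hx)
  obtain ⟨r1, r2⟩ := h.rep' h1
  have s1 := (h2.add r1).mono (Y := 5 * ((J.length + 2) * X)) (by omega)
  have s2 := (h3.add r2).mono (Y := 5 * ((J.length + 2) * X)) (by omega)
  have hb : ∀ q, Rep D (5 * ((J.length + 2) * X)) q → bits q ≤ K := fun q hq =>
    h.bits q (hq.mono (by omega))
  refine ⟨?_, Cst.mono (Cst.maxOf .var (Cst.maxOf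
    (Cst.add (Cst.fst (Cst.snd .var)) (Cst.fst (Cst.snd (Cst.snd (Cst.snd (Cst.fst .var)))))
      (h.bits _ (h2.mono (by omega))) (h.bp h1).1)
    (Cst.add (Cst.snd (Cst.snd .var)) (Cst.snd (Cst.snd (Cst.snd (Cst.snd (Cst.fst .var)))))
      (h.bits _ (h3.mono (by omega))) (h.bp h1).2) (hb _ s1) (hb _ s2)) (hb _ hC) ?_) (by omega)⟩
  · rw [val_maxOf, val_maxOf]
    exact hC.max (s1.max s2)
  · rw [val_maxOf]
    exact hb _ (s1.max s2)

theorem cst_gsRaw (h : GSBound K D X J) {A B : List arcTy.den} {r l : arcTy.den}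
    (hm : ∀ j, j ∈ r :: l :: (B ++ A) → j = dummyJob ∨ j ∈ J)
    (hl : B.length + A.length = J.length) {T₁ T₂ : ℚ}
    (r₁ : Rep D (J.length * X) T₁) (r₂ : Rep D (J.length * X) T₂) :
    Cst K (140 * J.length + 300)
      (gsRaw (.var A) (.var B) (.var r) (.var l) (.var T₁) (.var T₂)) := by
  have hZ := GSBound.le J X
  have b0 : bits 0 ≤ K := h.bits 0 Rep.zero
  obtain ⟨rr₁, rr₂⟩ := h.rep' (hm r (by simp))
  obtain ⟨rl₁, rl₂⟩ := h.rep' (hm l (by simp))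
  have hb : ∀ {Y q}, Rep D Y q → Y ≤ 20 * ((J.length + 2) * X) → bits q ≤ K := fun hq hY =>
    h.bits _ (hq.mono hY)
  have c₁ : ∀ y : arcTy.den, Cst K 5 (p₁ (.var y)) := fun y =>
    Cst.fst (Cst.snd (Cst.snd (Cst.snd .var)))
  have c₂ : ∀ y : arcTy.den, Cst K 5 (p₂ (.var y)) := fun y =>
    Cst.snd (Cst.snd (Cst.snd (Cst.snd .var)))
  have bp : ∀ L : List arcTy.den, (∀ j ∈ L, j = dummyJob ∨ j ∈ J) → ∀ j ∈ L,
      bits (pt₁ j) ≤ K ∧ bits (pt₂ j) ≤ K := fun L hL j hj => h.bp (hL j hj)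
  have bs : ∀ (L : List arcTy.den) (x y : ℚ), (∀ j ∈ L, j = dummyJob ∨ j ∈ J) →
      L.length ≤ J.length + 2 → Rep D (3 * ((J.length + 2) * X)) x →
      Rep D (3 * ((J.length + 2) * X)) y → ∀ l', l' <+: L → bits (x + (l'.map pt₁).sum) ≤ K ∧
      bits (y + (l'.map pt₂).sum) ≤ K := fun L x y hL hl hx hy l' hl' => by
    have h1 : l'.length ≤ J.length + 2 := hl'.length_le.trans hl
    have h2 := fun j hj => h.rep' (hL j (hl'.subset hj))
    exact ⟨hb (hx.add (Rep.sum_map_of_le (fun j hj => (h2 j hj).1) h1)) (by omega),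
      hb (hy.add (Rep.sum_map_of_le (fun j hj => (h2 j hj).2) h1)) (by omega)⟩
  have hL₁ : ∀ j ∈ l :: (B ++ A), j = dummyJob ∨ j ∈ J := fun j hj =>
    hm j (List.mem_cons_of_mem _ hj)
  have hL₂ : ∀ j ∈ r :: (A ++ B), j = dummyJob ∨ j ∈ J := fun j hj => hm j (by
    simp only [List.mem_cons, List.mem_append] at hj ⊢; tauto)
  have y₁ := (rr₂.mono (Y := 3 * ((J.length + 2) * X)) (by omega)).max
    (((r₁.sub r₂).add rr₂).mono (Y := 3 * ((J.length + 2) * X)) (by omega))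
  have y₂ := (rl₁.mono (Y := 3 * ((J.length + 2) * X)) (by omega)).max
    (((r₂.sub r₁).add rl₁).mono (Y := 3 * ((J.length + 2) * X)) (by omega))
  have bT₁ := hb r₁ (by omega)
  have bT₂ := hb r₂ (by omega)
  have bT₁₂ := hb (r₁.sub r₂) (by omega)
  have bT₂₁ := hb (r₂.sub r₁) (by omega)
  have br₁ := hb rr₁ (by omega)
  have br₂ := hb rr₂ (by omega)
  have bl₁ := hb rl₁ (by omega)
  have bl₂ := hb rl₂ (by omega)
  refine Cst.mono (Cst.cond (Cst.le (Cst.sub .var (c₂ r) bT₂ br₂) (Cst.sub .var (c₁ l) bT₁ bl₁)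
    (hb (r₂.sub rr₂) (by omega)) (hb (r₁.sub rl₁) (by omega)))
    (m := 70 * J.length + 140) (fun _ => ?_) (n := 70 * J.length + 140) fun _ => ?_) (by omega)
  · refine Cst.mono (Cst.cons (Cst.pair .var (Cst.pair (Cst.maxOf (Cst.sub .var (c₁ r) bT₁ br₁)
      (c₂ r) (hb (r₁.sub rr₁) (by omega)) br₂) (Cst.lit b0)))
      (cst_layout (Cst.cons .var (Cst.append .var .var)) (Cst.lit b0) (Cst.maxOf (c₂ r)
        (Cst.add (Cst.sub .var .var bT₁ bT₂) (c₂ r) bT₁₂ br₂) br₂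
        (hb ((r₁.sub r₂).add rr₂) (by omega))) ?_ ?_)) ?_
    · simp only [val_cons, val_append, val_var]
      exact bp _ hL₁
    · simp only [val_cons, val_append, val_var]
      rw [val_maxOf]
      exact bs _ _ _ hL₁ (by simp; omega) Rep.zero y₁
    · simp only [val_cons, val_append, val_var, List.length_cons, List.length_append]; omega
  · refine Cst.mono (Cst.cons (Cst.pair .var (Cst.pair (Cst.lit b0) (Cst.maxOf
      (Cst.sub .var (c₂ l) bT₂ bl₂) (c₁ l) (hb (r₂.sub rl₂) (by omega)) bl₁)))
      (cst_layout (Cst.cons .var (Cst.append .var .var)) (Cst.maxOf (c₁ l)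
        (Cst.add (Cst.sub .var .var bT₂ bT₁) (c₁ l) bT₂₁ bl₁) bl₁
        (hb ((r₂.sub r₁).add rl₁) (by omega))) (Cst.lit b0) ?_ ?_)) ?_
    · simp only [val_cons, val_append, val_var]
      exact bp _ hL₂
    · simp only [val_cons, val_append, val_var]
      rw [val_maxOf]
      exact bs _ _ _ hL₂ (by simp; omega) y₂ Rep.zero
    · simp only [val_cons, val_append, val_var, List.length_cons, List.length_append]; omega

theorem val_gsRaw (J : List arcTy.den) :
    (gsRaw (.var (J.foldl splitStep (([], []), (dummyJob, dummyJob))).1.1)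
      (.var (J.foldl splitStep (([], []), (dummyJob, dummyJob))).1.2)
      (.var (J.foldl splitStep (([], []), (dummyJob, dummyJob))).2.1)
      (.var (J.foldl splitStep (([], []), (dummyJob, dummyJob))).2.2)
      (.var (J.map pt₁).sum) (.var (J.map pt₂).sum)).val = gsEntries J := by
  have h5 : ∀ x : arcTy.den, (p₁ (.var x)).val = pt₁ x := fun _ => rfl
  have h6 : ∀ x : arcTy.den, (p₂ (.var x)).val = pt₂ x := fun _ => rfl
  simp only [gsRaw, gsEntries, val_cond, val_le, val_sub, val_add, val_cons, mkEntry, val_pair,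
    val_var, val_maxOf, val_layout, val_append, h5, h6, val_lit, decide_eq_true_eq]

/-- The algorithm, for a list of jobs that has already been evaluated. -/
def gsMain {V : Ty → Type} (J : Tm V (.list arcTy)) : Tm V (.prod (.list entryTy) .num) :=
  lets (gsSplit J) fun x =>
  lets x.fst.fst fun A' => lets x.fst.snd fun B' => lets x.snd.fst fun r => lets x.snd.snd fun l =>
  lets (sumOf J p₁) fun T₁ => lets (sumOf J p₂) fun T₂ =>
  lets (gsRaw A' B' r l T₁ T₂) gsFinish

theorem cst_gsMain (h : GSBound K D X J) :
    Cst K (400 * J.length + 690) (gsMain (.var J)) := by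
  have hZ := GSBound.le J X
  refine Cst.mono (Cst.lets (cst_gsSplit h) (n := 240 * J.length + 600) ?_) (by omega)
  rw [val_gsSplit, val_var]
  have hp : ∀ l', l' <+: J → Rep D (J.length * X) (l'.map pt₁).sum ∧
      Rep D (J.length * X) (l'.map pt₂).sum := fun l' hl' =>
    ⟨Rep.sum_map_of_le (fun j hj => (h.rep j (hl'.subset hj)).1) hl'.length_le,
      Rep.sum_map_of_le (fun j hj => (h.rep j (hl'.subset hj)).2) hl'.length_le⟩
  obtain ⟨hm, hl⟩ := split_facts J
  have v := val_gsRaw J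
  generalize J.foldl splitStep (([], []), (dummyJob, dummyJob)) = x at *
  refine Cst.mono (Cst.lets (Cst.fst (Cst.fst .var)) (Cst.lets (Cst.snd (Cst.fst .var))
    (Cst.lets (Cst.fst (Cst.snd .var)) (Cst.lets (Cst.snd (Cst.snd .var))
    (Cst.lets (Cst.sumOf (k := 5) .var (fun y _ => Cst.fst (Cst.snd (Cst.snd (Cst.snd .var))))
      (fun y hy => (h.bp (Or.inr hy)).1) fun l' hl' => h.bits _ ((hp l' hl').1.mono (by omega)))
    (Cst.lets (Cst.sumOf (k := 5) .var (fun y _ => Cst.snd (Cst.snd (Cst.snd (Cst.snd .var))))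
      (fun y hy => (h.bp (Or.inr hy)).2) fun l' hl' => h.bits _ ((hp l' hl').2.mono (by omega)))
    (Cst.lets (m := 140 * J.length + 300) (n := 80 * J.length + 200) ?_ ?_)))))))
    (by simp only [val_var]; omega)
  · have e₁ : (sumOf (.var J) p₁).val = (J.map pt₁).sum := by rw [val_sumOf]; rfl
    have e₂ : (sumOf (.var J) p₂).val = (J.map pt₂).sum := by rw [val_sumOf]; rfl
    exact cst_gsRaw h hm hl (by rw [e₁]; exact (hp J List.prefix_rfl).1)
      (by rw [e₂]; exact (hp J List.prefix_rfl).2)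
  · have e : (gsRaw (.var x.1.1) (.var x.1.2) (.var x.2.1) (.var x.2.2)
        (.var (sumOf (.var J) p₁).val) (.var (sumOf (.var J) p₂).val)).val = gsEntries J := by
      rw [val_sumOf, val_sumOf]; exact v
    have := cst_gsFinish h
    rw [← e] at this
    exact this

theorem cst_gs {J : Tm Ty.den (.list arcTy)} {m : ℕ} (hJ : Cst K m J) (h : GSBound K D X J.val) :
    Cst K (m + 400 * J.val.length + 700) (gs J) :=
  Cst.mono (Cst.lets hJ (cst_gsMain h)) (by omega)

end GSCost

/-! ### The cost of the framework -/

section FrameworkCost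

/-- Bounds for the numbers that occur in the algorithm and for the sizes of its data. -/
structure InstBound (I : Inst) (ε M : ℚ) (K₀ K S D X b : ℕ) : Prop where
  path : ∃ P, I.IsPath P
  eps : 0 < ε
  nonneg : 0 ≤ M
  one : 1 ≤ S
  numV : I.numV ≤ S
  numA : I.numA ≤ S
  prod : I.numV * I.numA ≤ S
  labels : I.numV * b ^ 2 ≤ S
  lt : 2 * I.numV / ε < b
  bnat : ∀ m : ℕ, m ≤ I.numV ∨ m ≤ I.numA → bits (m : ℚ) ≤ K₀
  beps : bits ε ≤ K₀
  rep : ∀ i j, Rep D X (I.p i j)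
  repM : Rep D X M
  bits₀ : ∀ q, Rep D (20 * ((I.numV + I.numA + 2) * X)) q → bits q ≤ K₀
  le : 16 * K₀ + 20 ≤ K

variable {I : Inst} {ε M : ℚ} {K₀ K S D X b : ℕ} {mark : Fin I.numA → Bool}

theorem InstBound.mul_le (_ : InstBound I ε M K₀ K S D X b) {n : ℕ}
    (hn : n ≤ I.numV + I.numA + 2) : n * X ≤ (I.numV + I.numA + 2) * X :=
  Nat.mul_le_mul_right _ hn

theorem InstBound.abv (h : InstBound I ε M K₀ K S D X b) :
    ABVBound K₀ K S D X b ε (encode I ε).2.1 (encode I ε).2.2.2.1 (encode I ε).2.2.2.2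
      (arcs I M mark) := by
  have hle := h.le
  have hmem : ∀ v : Fin I.numV, ((v : ℕ) : ℚ) ∈ (encode I ε).2.1 := fun v =>
    List.mem_map.2 ⟨v, List.mem_finRange v, rfl⟩
  have hlen : (encode I ε).2.1.length = I.numV := by simp [encode]
  have hlenE : (arcs I M mark).length = I.numA := by simp [arcs]
  have hlenV : ∀ m : ℕ, m ≤ I.numV → bits (m : ℚ) ≤ K₀ := fun m hm => h.bnat m (Or.inl hm)
  have hb : ∀ q, Rep D (I.numV * (2 * X) + 2 * X) q → bits q ≤ K₀ := fun q hq =>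
    h.bits₀ q (hq.mono (by nlinarith [Nat.zero_le (I.numV * X), Nat.zero_le (I.numA * X)]))
  obtain ⟨P, hP⟩ := h.path
  obtain ⟨h1, h2⟩ := isPath_iff (M := M) (mark := mark).1 hP
  refine
    { sp :=
        { one := h.one, lenV := hlen ▸ h.numV, lenE := hlenE ▸ h.numA, s_mem := hmem I.s
          head := ?_, tail := ?_, bv := ?_, nonneg := ?_, rep := ?_
          bits := fun q hq => (hb q (by rwa [hlen] at hq)).trans (by omega) }
      t_mem := hmem I.t
      eps := h.eps
      beps := h.beps
      bn := by rw [hlen]; exact hlenV _ le_rfl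
      bits₀ := fun q hq => hb q (by rwa [hlen] at hq)
      le := hle
      lt := by rw [hlen]; exact h.lt
      labels := by rw [hlen]; exact h.labels
      lenQ := by rw [hlen, hlenE]; exact h.prod
      walk := ⟨_, map_mkArc_subset P.reverse, h1, h2⟩ }
  · intro e he
    obtain ⟨j, -, rfl⟩ := List.mem_map.1 he
    exact hmem (I.head j)
  · intro e he
    obtain ⟨j, -, rfl⟩ := List.mem_map.1 he
    exact hmem (I.tail j)
  · intro v hv
    obtain ⟨u, -, rfl⟩ := List.mem_map.1 hv
    exact (hlenV _ u.isLt.le).trans (by omega)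
  · intro e he
    obtain ⟨j, -, rfl⟩ := List.mem_map.1 he
    simp only [wt₁, wt₂, mkArc]
    split_ifs
    · exact ⟨h.nonneg, h.nonneg⟩
    · exact ⟨I.p_nonneg 0 j, I.p_nonneg 1 j⟩
  · intro e he
    obtain ⟨j, -, rfl⟩ := List.mem_map.1 he
    simp only [wt₁, wt₂, mkArc]
    split_ifs
    · exact ⟨h.repM, h.repM⟩
    · exact ⟨h.rep 0 j, h.rep 1 j⟩

theorem Inst.IsPath.length_le {P : List (Fin I.numA)} (h : I.IsPath P) : P.length ≤ I.numV := by
  have := h.2.length_le_card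
  simp only [List.length_cons, List.length_map, Fintype.card_fin] at this
  omega

theorem InstBound.gs (h : InstBound I ε M K₀ K S D X b) {P : List (Fin I.numA)} (hP : I.IsPath P) :
    GSBound K D X (P.map (enc I)) := by
  have hle := h.le
  have hlen := hP.length_le
  refine ⟨by omega, ?_, ?_, ?_, fun q hq => (h.bits₀ q (hq.mono ?_)).trans (by omega)⟩
  · intro e he
    obtain ⟨j, -, rfl⟩ := List.mem_map.1 he
    exact ⟨I.p_nonneg 0 j, I.p_nonneg 1 j⟩
  · intro e he
    obtain ⟨j, -, rfl⟩ := List.mem_map.1 he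
    exact ⟨h.rep 0 j, h.rep 1 j⟩
  · intro e he
    obtain ⟨j, -, rfl⟩ := List.mem_map.1 he
    exact (h.bnat _ (Or.inr j.isLt.le)).trans (by omega)
  · have := h.mul_le (n := P.length + 2) (by omega)
    rw [List.length_map]
    omega

/-- The best solution may stem from an earlier pass with other marks. The field `alg` remembers that
it was still computed by Gonzalez–Sahni on a path, which is all that the bound needs. -/
theorem IsSol.bits_le (h : InstBound I ε M K₀ K S D X b) {x : solTy.den} {P : List (Fin I.numA)}
    (hx : IsSol I x P) : bits x.2.2 ≤ K := by
  rw [hx.alg, hx.arcs]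
  exact bits_gs (h.gs hx.path)

theorem IsSol.length_le {x : solTy.den} {P : List (Fin I.numA)}
    (hx : IsSol I x P) : x.1.length ≤ I.numV ∧ x.2.1.length ≤ I.numV := by
  have h1 := congrArg List.length hx.arcs
  have h2 := hx.perm.length_eq
  simp only [List.length_map] at h1 h2
  exact ⟨h1 ▸ hx.path.length_le, h2 ▸ hx.path.length_le⟩

/-- The scheduling cost is bounded for every list of arcs whose jobs form a path of the instance;
`solve_spec` says that the list returned by ABV is of this kind. -/
theorem cst_solve (h : InstBound I ε M K₀ K S D X b) :
    Cst K (2500 * S ^ 4) (solve gs (.var (encode I ε)) (.var (arcs I M mark))) := by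
  have hS4 := le_pow_four h.one
  have hone := h.one
  have hnumV := h.numV
  obtain ⟨P, hP⟩ := solve_spec (mark := mark) h.path h.eps h.nonneg (.var (encode I ε))
    (.var (arcs I M mark)) rfl rfl
  have harcs := hP.toIsSol.arcs
  rw [congrArg Prod.fst (val_solve (.var (encode I ε)) (.var (arcs I M mark)))] at harcs
  have key : ∀ R : List warcTy.den, R.map Prod.fst = P.map (enc I) → Cst K (450 * S + 720)
      (Tm.pair (.var R : Tm Ty.den (.list warcTy)) (OpenShopPath.gs (map (.var R : Tm Ty.den (.list warcTy)) fun e => e.fst)) :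
        Tm Ty.den solTy) := by
    intro R hR
    have e : (map (.var R : Tm Ty.den (.list warcTy)) fun e => e.fst).val = P.map (enc I) := by
      rw [val_map]; exact hR
    have hlen : R.length = P.length := by simpa using congrArg List.length hR
    have := hP.path.length_le
    refine Cst.mono (Cst.pair .var (cst_gs (D := D) (X := X)
      (Cst.map .var fun _ _ => Cst.fst .var) ?_)) ?_
    · rw [e]; exact h.gs hP.path
    · rw [e, List.length_map, val_var]
      omega
  exact Cst.mono (Cst.lets .var (Cst.lets (Cst.fst .var) (Cst.lets (Cst.fst (Cst.snd .var))
    (Cst.lets (Cst.fst (Cst.snd (Cst.snd (Cst.snd .var))))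
    (Cst.lets (Cst.snd (Cst.snd (Cst.snd (Cst.snd .var))))
    (Cst.lets (cst_abv h.abv) (key _ harcs))))))) (by omega)

theorem InstBound.bits_job (h : InstBound I ε M K₀ K S D X b) (e : arcTy.den)
    (he : ∃ j, e = enc I j) : bits (pt₁ e) ≤ K ∧ bits (pt₂ e) ≤ K ∧
      bits (HAdd.hAdd (α := ℚ) (β := ℚ) (γ := ℚ) (pt₁ e) (pt₂ e)) ≤ K := by
  obtain ⟨j, rfl⟩ := he
  have hle := h.le
  have h1 := h.mul_le (n := 1) (by omega)
  exact ⟨(h.bits₀ _ ((h.rep 0 j).mono (by omega))).trans (by omega),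
    (h.bits₀ _ ((h.rep 1 j).mono (by omega))).trans (by omega),
    (h.bits₀ _ (((h.rep 0 j).add (h.rep 1 j)).mono (by omega))).trans (by omega)⟩

theorem cst_guard (h : InstBound I ε M K₀ K S D X b) {x : stateTy.den} (hx : Inv I ε M mark x) :
    Cst K (200 * S ^ 4) (gar.guard (V := Ty.den) x) := by
  have hS4 := le_pow_four h.one
  have hone := h.one
  have hnumV := h.numV
  have hle := h.le
  obtain ⟨P, hP⟩ := hx.cur
  have hlen := hP.toIsSol.length_le.1
  have b1 : bits 1 ≤ K := le_trans (show bits 1 ≤ 2 by decide) (by omega)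
  have bC := hP.toIsSol.bits_le h
  have e : gar.guard (V := Ty.den) x = lets (Tm.var x).snd.snd.fst fun cur =>
    lets (.lit 1 * cur.snd.snd) fun C => and (not (any cur.fst fun e => marked e))
      (any cur.fst fun e => .le C (p₁ e.fst + p₂ e.fst)) := rfl
  rw [e]
  refine Cst.mono (Cst.lets (Cst.fst (Cst.snd (Cst.snd .var))) (Cst.lets
    (Cst.mul (Cst.lit b1) (Cst.snd (Cst.snd .var)) b1 bC)
    (Cst.and (Cst.not (Cst.any (k := 3) (Cst.fst .var) fun _ _ => Cst.snd (Cst.snd .var))) fun _ =>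
      Cst.any (k := 20) (Cst.fst .var) fun a ha => ?_)))
    (by simp only [val_fst, val_snd, val_var]; omega)
  have ha' : a ∈ x.2.2.1.1 := ha
  rw [hP.eq] at ha'
  obtain ⟨j, -, rfl⟩ := List.mem_map.1 ha'
  obtain ⟨h1, h2, h3⟩ := InstBound.bits_job h (enc I j) ⟨j, rfl⟩
  refine Cst.mono (Cst.le .var (Cst.add (Cst.fst (Cst.snd (Cst.snd (Cst.snd (Cst.fst .var)))))
    (Cst.snd (Cst.snd (Cst.snd (Cst.snd (Cst.fst .var))))) h1 h2) ?_ h3) (by omega)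
  rw [val_var, val_mul, val_lit, one_mul]
  exact bC

theorem cst_output (h : InstBound I ε M K₀ K S D X b) {x : stateTy.den} (hx : Inv I ε M mark x) :
    Cst K (200 * S ^ 4) (gar.output (V := Ty.den) x) := by
  have hS4 := le_pow_four h.one
  have hone := h.one
  have hnumV := h.numV
  obtain ⟨P, hP⟩ := hx.best
  obtain ⟨hlen, hlen'⟩ := hP.length_le
  have e : gar.output (V := Ty.den) x = lets (Tm.var x).snd.snd.snd fun best =>
    .pair (map best.fst fun e => jobId e.fst)
      (.pair (map best.snd.fst fun x => .pair (jobId x.fst) (.pair (start₁ x) (start₂ x)))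
        best.snd.snd) := rfl
  rw [e]
  exact Cst.mono (Cst.lets (Cst.snd (Cst.snd (Cst.snd .var))) (Cst.pair
    (Cst.map (k := 3) (Cst.fst .var) fun _ _ => Cst.fst (Cst.fst .var))
    (Cst.pair (Cst.map (k := 11) (Cst.fst (Cst.snd .var)) fun _ _ =>
      Cst.mono (Cst.pair (Cst.fst (Cst.fst .var)) (Cst.pair (Cst.fst (Cst.snd .var))
        (Cst.snd (Cst.snd .var)))) (by omega)) (Cst.snd (Cst.snd .var)))))
    (by simp only [val_fst, val_snd, val_var]; omega)

/-- The second half of the body of the loop. -/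
def bodyEnd {V : Ty → Type} (inp : Tm V inputTy) (M : Tm V .num) (best : Tm V solTy)
    (E : Tm V (.list warcTy)) : Tm V stateTy :=
  lets (solve gs inp E) fun cur =>
    .pair (.pair inp M) (.pair E (.pair cur (.cond (lt cur.snd.snd best.snd.snd) cur best)))

theorem cst_bodyEnd (h : InstBound I ε M K₀ K S D X b) {best : solTy.den}
    (hb : bits best.2.2 ≤ K) {E : List warcTy.den} (hE : E = arcs I M mark) :
    Cst K (2600 * S ^ 4) (bodyEnd (.var (encode I ε)) (.var M) (.var best) (.var E)) := by
  subst hE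
  have hS4 := le_pow_four h.one
  have hone := h.one
  obtain ⟨P, hP⟩ := solve_spec (mark := mark) h.path h.eps h.nonneg (.var (encode I ε))
    (.var (arcs I M mark)) rfl rfl
  exact Cst.mono (Cst.lets (cst_solve h) (Cst.pair (Cst.pair .var .var) (Cst.pair .var (Cst.pair .var
    (Cst.cond (Cst.lt (Cst.snd (Cst.snd .var)) (Cst.snd (Cst.snd .var)) (hP.toIsSol.bits_le h) hb)
      (fun _ => .var) fun _ => .var))))) (by omega)

theorem cst_body (h : InstBound I ε M K₀ K S D X b) {x : stateTy.den} (hx : Inv I ε M mark x) :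
    Cst K (2800 * S ^ 4) (gar.body (V := Ty.den) x) := by
  have hS4 := le_pow_four h.one
  have hone := h.one
  have hnumA := h.numA
  have hle := h.le
  obtain ⟨P, hP⟩ := hx.cur
  obtain ⟨P', hP'⟩ := hx.best
  have b1 : bits 1 ≤ K := le_trans (show bits 1 ≤ 2 by decide) (by omega)
  have bC := hP.toIsSol.bits_le h
  have bB := hP'.bits_le h
  have harcs := hx.arcs
  have hE := val_map_mark (M := M) x harcs
  obtain ⟨y, E, cur, best⟩ := x
  obtain rfl : y = (encode I ε, M) := hx.inp
  simp only at bC bB harcs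
  clear hP hP' hx
  have e : gar.body (V := Ty.den) ((encode I ε, M), E, cur, best) =
    lets (.var ((encode I ε, M), E, cur, best)) fun st =>
    lets st.fst.fst fun inp => lets st.fst.snd fun M =>
    lets st.snd.snd.snd fun best =>
    lets (.lit 1 * st.snd.snd.fst.snd.snd) fun C =>
    lets (map st.snd.fst fun e =>
      .cond (and (not (marked e)) (.le C (p₁ e.fst + p₂ e.fst))) (mkWarc e.fst M M .tt) e) fun E =>
    bodyEnd inp M best E := rfl
  rw [e]
  refine Cst.mono (Cst.lets .var (Cst.lets (Cst.fst (Cst.fst .var)) (Cst.lets (Cst.snd (Cst.fst .var))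
    (Cst.lets (Cst.snd (Cst.snd (Cst.snd .var))) (Cst.lets
    (Cst.mul (Cst.lit b1) (Cst.snd (Cst.snd (Cst.fst (Cst.snd (Cst.snd .var))))) b1 bC)
    (Cst.lets (Cst.map (k := 50) (Cst.fst (Cst.snd .var)) ?_) (cst_bodyEnd h bB hE)))))))
    ?_
  · intro a ha
    have ha' : a ∈ E := ha
    rw [harcs] at ha'
    obtain ⟨j, -, rfl⟩ := List.mem_map.1 ha'
    obtain ⟨h1, h2, h3⟩ := InstBound.bits_job h (enc I j) ⟨j, rfl⟩
    refine Cst.mono (Cst.cond (Cst.and (Cst.not (Cst.snd (Cst.snd .var))) fun _ => Cst.le .var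
      (Cst.add (Cst.fst (Cst.snd (Cst.snd (Cst.snd (Cst.fst .var)))))
      (Cst.snd (Cst.snd (Cst.snd (Cst.snd (Cst.fst .var))))) h1 h2) ?_ h3)
      (fun _ => Cst.pair (Cst.fst .var) (Cst.pair (Cst.pair .var .var) .tt)) fun _ => .var)
      (by omega)
    rw [val_var, val_mul, val_lit, one_mul]
    exact bC
  · have : E.length = I.numA := by rw [harcs]; simp [arcs]
    simp only [val_fst, val_snd, val_var]
    omega

/-- The end of the initialization. -/
def initEnd {V : Ty → Type} (inp : Tm V inputTy) (J : Tm V (.list arcTy))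
    (E : Tm V (.list warcTy)) : Tm V stateTy :=
  lets (solve gs inp E) fun cur =>
    lets ((.lit 1 + inp.fst) * sumOf J (fun e => p₁ e + p₂ e) + .lit 1) fun M =>
    .pair (.pair inp M) (.pair E (.pair cur cur))

theorem cst_initEnd (h : InstBound I ε M K₀ K S D X b)
    {E : List warcTy.den} (hE : E = arcs I M mark) :
    Cst K (2600 * S ^ 4) (initEnd (.var (encode I ε)) (.var (encode I ε).2.2.1) (.var E)) := by
  subst hE
  have hS4 := le_pow_four h.one
  have hone := h.one
  have hnumA := h.numA
  have hle := h.le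
  have b1 : bits 1 ≤ 2 := by decide
  have beps := h.beps
  have hlen : (encode I ε).2.2.1.length = I.numA := by simp [encode]
  have bε : bits (1 + ε) ≤ 2 * K₀ + 5 := (bits_add_le _ _).trans (by omega)
  have hsum : ∀ L : List arcTy.den, L <+: (encode I ε).2.2.1 →
      bits (L.map fun e => pt₁ e + pt₂ e).sum ≤ K₀ := by
    intro L hL
    have h1 : L.length ≤ I.numA := hlen ▸ hL.length_le
    have h2 : Rep D (I.numA * (X + X)) (L.map fun e => pt₁ e + pt₂ e).sum :=
      Rep.sum_map_of_le (fun e he => by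
        obtain ⟨j, -, rfl⟩ := List.mem_map.1 (hL.subset he)
        exact (h.rep 0 j).add (h.rep 1 j)) h1
    have h3 := h.mul_le (n := I.numA) (by omega)
    exact h.bits₀ _ (h2.mono (by rw [mul_add]; omega))
  have hs : (sumOf (.var (encode I ε).2.2.1) fun e => p₁ e + p₂ e).val
      = ((encode I ε).2.2.1.map fun e => pt₁ e + pt₂ e).sum := by
    rw [val_sumOf]; rfl
  refine Cst.mono (Cst.lets (cst_solve h) (Cst.lets (Cst.add (Cst.mul (Cst.add (Cst.lit ?_)
    (Cst.fst .var) ?_ ?_) (Cst.sumOf (k := 11) .var ?_ ?_ ?_) ?_ ?_) (Cst.lit ?_) ?_ ?_)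
    (Cst.pair (Cst.pair .var .var) (Cst.pair .var (Cst.pair .var .var)))))
    (by simp only [val_var, hlen]; omega)
  · omega
  · exact b1.trans (by omega)
  · exact beps.trans (by omega)
  · intro e he
    obtain ⟨j, -, rfl⟩ := List.mem_map.1 he
    obtain ⟨h1, h2, h3⟩ := InstBound.bits_job h (enc I j) ⟨j, rfl⟩
    exact Cst.mono (Cst.add (Cst.fst (Cst.snd (Cst.snd (Cst.snd .var))))
      (Cst.snd (Cst.snd (Cst.snd (Cst.snd .var)))) h1 h2) (by omega)
  · intro e he
    obtain ⟨j, -, rfl⟩ := List.mem_map.1 he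
    exact (InstBound.bits_job h (enc I j) ⟨j, rfl⟩).2.2
  · intro l hl
    exact (hsum l hl).trans (by omega)
  · exact bε.trans (by omega)
  · rw [hs]; exact (hsum _ List.prefix_rfl).trans (by omega)
  · omega
  · rw [val_mul, hs]
    have := hsum _ List.prefix_rfl
    exact (bits_mul_le _ _).trans ((Nat.add_le_add bε this).trans (by omega))
  · exact b1.trans (by omega)

theorem cst_init (h : InstBound I ε M K₀ K S D X b) :
    Cst K (2700 * S ^ 4) (gar.init (V := Ty.den) (encode I ε)) := by
  have hS4 := le_pow_four h.one
  have hone := h.one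
  have hnumA := h.numA
  have hlen : (encode I ε).2.2.1.length = I.numA := by simp [encode]
  have e : gar.init (V := Ty.den) (encode I ε) =
    lets (.var (encode I ε)) fun inp =>
    lets inp.snd.snd.fst fun J =>
    lets (map J fun e => mkWarc e (p₁ e) (p₂ e) .ff) fun E => initEnd inp J E := rfl
  rw [e]
  refine Cst.mono (Cst.lets .var (Cst.lets (Cst.fst (Cst.snd (Cst.snd .var))) (Cst.lets
    (Cst.map (k := 20) .var fun _ _ => Cst.mono (Cst.pair .var (Cst.pair (Cst.pair
      (Cst.fst (Cst.snd (Cst.snd (Cst.snd .var)))) (Cst.snd (Cst.snd (Cst.snd (Cst.snd .var))))) .ff))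
      (by omega)) (cst_initEnd h (val_map_init ε M)))))
    (by simp only [val_fst, val_snd, val_var, hlen]; omega)

end FrameworkCost

/-! ### The bound for the number of steps -/

section Polynomial

variable {I : Inst} {ε : ℚ}

theorem prod_map_le_two_pow {α : Type*} {f g : α → ℕ} (h : ∀ a, f a ≤ 2 ^ g a) :
    ∀ l : List α, (l.map f).prod ≤ 2 ^ (l.map g).sum
  | [] => by simp
  | a :: l => by
    rw [List.map_cons, List.prod_cons, List.map_cons, List.sum_cons, pow_add]
    exact Nat.mul_le_mul (h a) (prod_map_le_two_pow h l)

theorem den_le_two_pow (q : ℚ) : q.den ≤ 2 ^ q.den.size := (Nat.lt_size_self _).le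

theorem den_le_two_pow_bits (q : ℚ) : q.den ≤ 2 ^ bits q :=
  (den_le_two_pow q).trans (Nat.pow_le_pow_right two_pos (Nat.le_add_left _ _))

theorem le_two_pow_bits (q : ℚ) : q ≤ (2 ^ bits q : ℕ) := by
  have h1 : q ≤ q.num.natAbs := by
    refine (le_abs_self q).trans ?_
    rw [Rat.abs_def, Rat.divInt_eq_div]
    refine div_le_self (by positivity) ?_
    exact_mod_cast q.den_pos
  refine h1.trans ?_
  have h2 : q.num.natAbs ≤ 2 ^ q.num.natAbs.size := (Nat.lt_size_self _).le
  exact_mod_cast h2.trans (Nat.pow_le_pow_right two_pos (Nat.le_add_right _ _))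

/-- The encoding length of the numbers of an arc is at least the one of its processing times. -/
theorem bits_le_size_enc (j : Fin I.numA) :
    bits (I.p 0 j) + bits (I.p 1 j) ≤ size arcTy (enc I j) := by
  have : size arcTy (enc I j) = bits (enc I j).1 + (bits (enc I j).2.1 + (bits (enc I j).2.2.1 +
    (bits (I.p 0 j) + bits (I.p 1 j) + 1) + 1) + 1) + 1 := rfl
  omega

theorem length_le_sum_map {α : Type*} (f : α → ℕ) : ∀ l : List α,
    l.length ≤ (l.map fun a => f a + 1).sum
  | [] => le_rfl
  | a :: l => by
    have := length_le_sum_map f l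
    simp only [List.length_cons, List.map_cons, List.sum_cons]
    omega

theorem size_encode (I : Inst) (ε : ℚ) :
    I.numV ≤ size inputTy (encode I ε) ∧ I.numA ≤ size inputTy (encode I ε) ∧
      bits ε + ((List.finRange I.numA).map fun j => bits (I.p 0 j) + bits (I.p 1 j)).sum + 1
        ≤ size inputTy (encode I ε) := by
  have e : size inputTy (encode I ε) = bits ε + (((encode I ε).2.1.map fun x => bits x + 1).sum + 1 +
    (((encode I ε).2.2.1.map fun x => size arcTy x + 1).sum + 1 +
    (bits (I.s : ℕ) + bits (I.t : ℕ) + 1) + 1) + 1) + 1 := rfl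
  have h1 := length_le_sum_map bits (encode I ε).2.1
  have h2 := length_le_sum_map (size arcTy) (encode I ε).2.2.1
  have h3 : (encode I ε).2.1.length = I.numV := by simp [encode]
  have h4 : (encode I ε).2.2.1.length = I.numA := by simp [encode]
  have h5 : ((List.finRange I.numA).map fun j => bits (I.p 0 j) + bits (I.p 1 j)).sum
      ≤ ((encode I ε).2.2.1.map fun x => size arcTy x + 1).sum := by
    have : (encode I ε).2.2.1 = (List.finRange I.numA).map (enc I) := rfl
    rw [this, List.map_map]
    exact List.sum_le_sum fun j _ => (bits_le_size_enc j).trans (Nat.le_succ _)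
  omega

theorem exists_int_of_dvd {q : ℚ} {D : ℕ} (h : q.den ∣ D) : ∃ z : ℤ, q * D = z := by
  obtain ⟨k, rfl⟩ := h
  refine ⟨q.num * k, ?_⟩
  push_cast
  rw [← Rat.mul_den_eq_num q]; ring

theorem exists_int_sum {α : Type*} {f : α → ℚ} {D : ℕ} : ∀ {l : List α},
    (∀ a ∈ l, ∃ z : ℤ, f a * D = z) → ∃ z : ℤ, (l.map f).sum * D = z
  | [], _ => ⟨0, by simp⟩
  | a :: l, h => by
    obtain ⟨z, hz⟩ := h a (by simp)
    obtain ⟨u, hu⟩ := exists_int_sum (l := l) fun b hb => h b (by simp [hb])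
    exact ⟨z + u, by rw [List.map_cons, List.sum_cons, add_mul, hz, hu]; push_cast; rfl⟩

/-- The numbers have a common denominator and an upper bound of polynomially many bits. -/
theorem exists_rep (hε : 0 < ε) {N : ℕ} (hN : N = size inputTy (encode I ε)) :
    ∃ D : ℕ, D ≠ 0 ∧ D ≤ 2 ^ N ∧ (∀ i j, Rep D (2 ^ (3 * N + 3)) (I.p i j)) ∧
      Rep D (2 ^ (3 * N + 3))
        ((1 + ε) * ((List.finRange I.numA).map fun j => I.p 0 j + I.p 1 j).sum + 1) := by
  obtain ⟨-, hA, hs⟩ := size_encode I ε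
  rw [← hN] at hA hs
  set g : Fin I.numA → ℕ := fun j => bits (I.p 0 j) + bits (I.p 1 j) with hg
  set d : ℕ := ((List.finRange I.numA).map fun j => (I.p 0 j).den * (I.p 1 j).den).prod with hd
  set s₀ : ℚ := ((List.finRange I.numA).map fun j => I.p 0 j + I.p 1 j).sum with hs₀
  have hgN : ∀ j, g j ≤ N := fun j => by
    have := List.single_le_sum (l := (List.finRange I.numA).map g) (fun _ _ => Nat.zero_le _) _
      (List.mem_map.2 ⟨j, List.mem_finRange j, rfl⟩)
    omega
  have hdp : ∀ i j, (I.p i j).den ∣ d := fun i j => by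
    have h1 : (I.p 0 j).den * (I.p 1 j).den ∣ d :=
      List.dvd_prod (List.mem_map.2 ⟨j, List.mem_finRange j, rfl⟩)
    fin_cases i
    · exact (Nat.dvd_mul_right _ _).trans h1
    · exact (Nat.dvd_mul_left _ _).trans h1
  have hle : ∀ i j, I.p i j ≤ (2 ^ N : ℕ) := fun i j => by
    refine (le_two_pow_bits _).trans ?_
    have h1 : bits (I.p i j) ≤ g j := by
      fin_cases i
      · exact Nat.le_add_right _ _
      · exact Nat.le_add_left _ _
    exact_mod_cast Nat.pow_le_pow_right two_pos (h1.trans (hgN j))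
  have hs₀0 : 0 ≤ s₀ := sum_map_nonneg fun j _ => add_nonneg (I.p_nonneg 0 j) (I.p_nonneg 1 j)
  have hs₀le : s₀ ≤ (2 ^ (2 * N + 1) : ℕ) := by
    have h1 : s₀ ≤ I.numA * (2 * 2 ^ N : ℕ) := by
      have := List.sum_le_card_nsmul ((List.finRange I.numA).map fun j => I.p 0 j + I.p 1 j)
        ((2 * 2 ^ N : ℕ) : ℚ) (fun x hx => by
          obtain ⟨j, -, rfl⟩ := List.mem_map.1 hx
          have h0 := hle 0 j
          have h1 := hle 1 j
          push_cast at *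
          linarith)
      rwa [List.length_map, List.length_finRange, nsmul_eq_mul] at this
    have h2 : I.numA * (2 * 2 ^ N) ≤ 2 ^ (2 * N + 1) := by
      have : I.numA ≤ 2 ^ N := hA.trans (Nat.lt_two_pow_self).le
      calc I.numA * (2 * 2 ^ N) ≤ 2 ^ N * (2 * 2 ^ N) := Nat.mul_le_mul_right _ this
        _ = 2 ^ (2 * N + 1) := by rw [two_mul N, pow_succ, pow_add]; ring
    refine h1.trans ?_
    exact_mod_cast h2
  have hεle : ε ≤ (2 ^ N : ℕ) := (le_two_pow_bits _).trans (by
    exact_mod_cast Nat.pow_le_pow_right two_pos (by omega))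
  -- The factor `ε.den` is present because `M` involves `ε`; the product of the denominators has at
  -- most as many bits as the input.
  refine ⟨ε.den * d, ?_, ?_, ?_, ?_, ?_⟩
  · refine mul_ne_zero ε.den_nz ?_
    rw [hd]
    refine List.prod_ne_zero ?_
    simp
  · have h1 : d ≤ 2 ^ ((List.finRange I.numA).map g).sum := prod_map_le_two_pow (fun j => by
      rw [hg, pow_add]
      exact Nat.mul_le_mul (den_le_two_pow_bits _) (den_le_two_pow_bits _)) _
    calc ε.den * d ≤ 2 ^ bits ε * 2 ^ ((List.finRange I.numA).map g).sum :=
          Nat.mul_le_mul (den_le_two_pow_bits ε) h1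
      _ = 2 ^ (bits ε + ((List.finRange I.numA).map g).sum) := (pow_add _ _ _).symm
      _ ≤ 2 ^ N := Nat.pow_le_pow_right two_pos (by omega)
  · intro i j
    refine ⟨exists_int_of_dvd ((hdp i j).trans (Nat.dvd_mul_left _ _)), ?_⟩
    rw [abs_of_nonneg (I.p_nonneg i j)]
    refine (hle i j).trans ?_
    exact_mod_cast Nat.pow_le_pow_right two_pos (by omega)
  · obtain ⟨z, hz⟩ := exists_int_sum (f := fun j => I.p 0 j + I.p 1 j) (D := d)
      (l := List.finRange I.numA) fun j _ => by
        obtain ⟨z, hz⟩ := exists_int_of_dvd (hdp 0 j)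
        obtain ⟨u, hu⟩ := exists_int_of_dvd (hdp 1 j)
        exact ⟨z + u, by rw [add_mul, hz, hu]; push_cast; rfl⟩
    refine ⟨(ε.den + ε.num) * z + ε.den * d, ?_⟩
    push_cast
    rw [← hz, ← Rat.mul_den_eq_num ε]
    ring
  · rw [abs_of_nonneg (by positivity)]
    have h1 : (1 + ε) * s₀ ≤ (2 ^ (N + 1) : ℕ) * (2 ^ (2 * N + 1) : ℕ) := by
      refine mul_le_mul ?_ hs₀le hs₀0 (Nat.cast_nonneg _)
      have : (1 : ℚ) ≤ (2 ^ N : ℕ) := by exact_mod_cast Nat.one_le_two_pow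
      rw [pow_succ]
      push_cast at *
      linarith
    -- One extra power of two absorbs the final `+ 1` of `M`.
    have h2 : 2 ^ (N + 1) * 2 ^ (2 * N + 1) + 1 ≤ 2 ^ (3 * N + 3) := by
      rw [← pow_add, show 3 * N + 3 = (N + 1 + (2 * N + 1)) + 1 by ring, pow_succ]
      have := Nat.one_le_two_pow (n := N + 1 + (2 * N + 1))
      omega
    refine (add_le_add_left h1 1).trans ?_
    exact_mod_cast h2

/-- All bounds, in terms of `T = N + ⌈1 / ε⌉`, where `N` is the encoding length. -/
theorem exists_instBound (hI : ∃ P, I.IsPath P) (hε : 0 < ε) {T : ℕ}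
    (hT : T = size inputTy (encode I ε) + ⌈1 / ε⌉₊) :
    ∃ K₀ D X b, InstBound I ε
      ((1 + ε) * ((List.finRange I.numA).map fun j => I.p 0 j + I.p 1 j).sum + 1)
      K₀ (700 * T) (9 * T ^ 5) D X b := by
  set N := size inputTy (encode I ε) with hN
  set r := ⌈1 / ε⌉₊ with hr
  obtain ⟨hV, hA, hs⟩ := size_encode I ε
  rw [← hN] at hV hA hs
  obtain ⟨D, hD0, hD, hp, hM⟩ := exists_rep hε hN
  have hr1 : 1 ≤ r := Nat.ceil_pos.2 (by positivity)
  have hbε : 1 ≤ bits ε := (one_le_size_den ε).trans (Nat.le_add_left _ _)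
  have hVT : I.numV ≤ T := by omega
  have hAT : I.numA ≤ T := by omega
  have hT1 : 1 ≤ T := by omega
  have hTp : ∀ k, 1 ≤ k → k ≤ 5 → T ^ k ≤ 9 * T ^ 5 := fun k _ hk =>
    (Nat.pow_le_pow_right hT1 hk).trans (Nat.le_mul_of_pos_left _ (by omega))
  have hb : 2 * N * r + 1 ≤ 3 * T ^ 2 := by
    subst hT
    nlinarith [Nat.zero_le (N * N), Nat.zero_le (N * r)]
  -- `12 * N + 29 = 3 * (4 * N + 9) + 2` is the value of `Rep.bits_le` for numbers up to `2 ^ (4 * N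
  -- + 9)`; and `2 * N * r + 1` strictly exceeds the scaled budget `2 * |V| / ε`.
  refine ⟨12 * N + 29, D, 2 ^ (3 * N + 3), 2 * N * r + 1,
    { path := hI, eps := hε, nonneg := ?_, one := ?_, numV := ?_, numA := ?_, prod := ?_
      labels := ?_, lt := ?_, bnat := ?_, beps := by omega, rep := hp, repM := hM
      bits₀ := ?_, le := by omega }⟩
  · have := sum_map_nonneg (P := List.finRange I.numA) (w := fun j => I.p 0 j + I.p 1 j)
      fun j _ => add_nonneg (I.p_nonneg 0 j) (I.p_nonneg 1 j)
    positivity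
  · exact hT1.trans (by simpa using hTp 1 le_rfl (by omega))
  · exact hVT.trans (by simpa using hTp 1 le_rfl (by omega))
  · exact hAT.trans (by simpa using hTp 1 le_rfl (by omega))
  · exact (Nat.mul_le_mul hVT hAT).trans (by simpa [sq] using hTp 2 (by omega) (by omega))
  -- The number of labels is the largest of the list bounds and dictates `9 * T ^ 5`.
  · calc I.numV * (2 * N * r + 1) ^ 2 ≤ T * (3 * T ^ 2) ^ 2 :=
          Nat.mul_le_mul hVT (Nat.pow_le_pow_left hb 2)
      _ = 9 * T ^ 5 := by ring
  · have h1 : 1 / ε ≤ r := Nat.le_ceil _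
    have h2 : (I.numV : ℚ) ≤ N := by exact_mod_cast hV
    have h3 : 2 * I.numV / ε = 2 * I.numV * (1 / ε) := by ring
    have h4 : (0 : ℚ) ≤ 1 / ε := by positivity
    rw [h3]
    push_cast
    have h5 : 2 * (I.numV : ℚ) * (1 / ε) ≤ 2 * N * r :=
      mul_le_mul (by linarith) h1 h4 (by positivity)
    linarith
  · intro m hm
    rw [bits_natCast]
    have : m.size ≤ m := Nat.size_le.2 Nat.lt_two_pow_self
    omega
  · intro q hq
    have h1 : 20 * ((I.numV + I.numA + 2) * 2 ^ (3 * N + 3)) ≤ 2 ^ (4 * N + 9) := by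
      have h2 : N + 1 ≤ 2 ^ N := Nat.lt_two_pow_self
      calc 20 * ((I.numV + I.numA + 2) * 2 ^ (3 * N + 3))
          ≤ 32 * ((2 * 2 ^ N) * 2 ^ (3 * N + 3)) :=
            Nat.mul_le_mul (by omega) (Nat.mul_le_mul_right _ (by omega))
        _ = 2 ^ (4 * N + 9) := by
            rw [show 4 * N + 9 = 5 + 1 + N + (3 * N + 3) by ring, pow_add, pow_add]; ring
    have := hq.bits_le hD0 (hD.trans (Nat.pow_le_pow_right two_pos (by omega))) h1
    omega

end Polynomial

/-- The GAR algorithm is a fully polynomial time approximation scheme. -/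
theorem isFPTAS_gar : IsFPTAS gar := by
  -- The degree is `1 + 20 + 2`: the number of passes, the fourth power of the list bound `9 * T ^
  -- 5`, and the square of the number of bits `700 * T`. Moreover `14000 = 5 * 2800`, and `2 ^ 23`
  -- stems from `T ≤ 2 * (N + 1 / ε)`.
  refine ⟨14000 * 9 ^ 4 * (4 * 700 ^ 2 + 1) * 2 ^ 23, 23, fun I ε hI hε => ?_⟩
  obtain ⟨T, hT⟩ : ∃ T, T = size inputTy (encode I ε) + ⌈1 / ε⌉₊ := ⟨_, rfl⟩
  obtain ⟨K₀, D, X, b, hB⟩ := exists_instBound hI hε hT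
  obtain ⟨c₀, hc₀⟩ : ∃ c₀, c₀ = 2800 * (9 * T ^ 5) ^ 4 * (4 * (700 * T) ^ 2 + 1) := ⟨_, rfl⟩
  have hcost : ∀ {n} {a : Ty} {x : Tm Ty.den a}, n ≤ 2800 * (9 * T ^ 5) ^ 4 →
      Cst (700 * T) n x → x.cost ≤ c₀ := fun hn hx =>
    hx.trans ((Nat.mul_le_mul_right _ hn).trans hc₀.ge)
  obtain ⟨o, c, hl, hc, h⟩ := gar_spec hI hε rfl (c₀ := c₀) (fun mark x hx =>
    ⟨hcost (Nat.mul_le_mul_right _ (by omega)) (cst_guard hB hx), hcost le_rfl (cst_body hB hx),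
      hcost (Nat.mul_le_mul_right _ (by omega)) (cst_output hB hx)⟩) (n := I.numA)
    (inv_init hI hε) ((Finset.card_filter_le _ _).trans (by simp))
  refine ⟨o, _, ⟨c, hl, rfl⟩, ?_, h⟩
  have hinit : (gar.init (V := Ty.den) (encode I ε)).cost ≤ c₀ :=
    hcost (Nat.mul_le_mul_right _ (by omega)) (cst_init hB)
  have hs := size_encode I ε
  have hr : 1 ≤ ⌈1 / ε⌉₊ := Nat.ceil_pos.2 (by positivity)
  have hT1 : 1 ≤ T := by omega
  have h1 : (gar.init (V := Ty.den) (encode I ε)).cost + c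
      ≤ 14000 * 9 ^ 4 * (4 * 700 ^ 2 + 1) * T ^ 23 := by
    have h2 : 4 * (700 * T) ^ 2 + 1 ≤ (4 * 700 ^ 2 + 1) * T ^ 2 := by
      have := Nat.one_le_pow 2 T hT1
      nlinarith
    have h3 : (gar.init (V := Ty.den) (encode I ε)).cost + c ≤ 5 * T * c₀ := by
      -- Guard and body of each pass, guard and output at the end, and the initialization are
      -- charged `c₀` each.
      have : (2 * (I.numA + 1) + 1) * c₀ ≤ 5 * T * c₀ := Nat.mul_le_mul_right _ (by omega)
      linarith
    calc _ ≤ 5 * T * c₀ := h3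
      _ ≤ 5 * T * (2800 * (9 * T ^ 5) ^ 4 * ((4 * 700 ^ 2 + 1) * T ^ 2)) := by
        rw [hc₀]; gcongr
      _ = _ := by ring
  have hN1 : (1 : ℚ) ≤ size inputTy (encode I ε) := by
    have : 1 ≤ size inputTy (encode I ε) := by omega
    exact_mod_cast this
  have h4 : (T : ℚ) ≤ 2 * ((size inputTy (encode I ε) : ℚ) + 1 / ε) := by
    have := Nat.ceil_lt_add_one (a := 1 / ε) (by positivity)
    have h0 : 0 < 1 / ε := by positivity
    rw [hT]
    push_cast
    linarith
  calc (((gar.init (V := Ty.den) (encode I ε)).cost + c : ℕ) : ℚ)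
      ≤ ((14000 * 9 ^ 4 * (4 * 700 ^ 2 + 1) * T ^ 23 : ℕ) : ℚ) := by exact_mod_cast h1
    _ = 14000 * 9 ^ 4 * (4 * 700 ^ 2 + 1) * (T : ℚ) ^ 23 := by push_cast; ring
    _ ≤ 14000 * 9 ^ 4 * (4 * 700 ^ 2 + 1) *
        (2 * ((size inputTy (encode I ε) : ℚ) + 1 / ε)) ^ 23 := by gcongr
    _ = _ := by rw [mul_pow]; push_cast; ring

end OpenShopPath

theorem mainTheorem5 : OpenShopPath.IsFPTAS OpenShopPath.gar :=
  OpenShopPath.isFPTAS_gar
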